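/- Let $\mathfrak g$ be a finite-dimensional simple simply-laced complex Lie algebra with dual Coxeter number $h^\vee$, let $\langle a,b\rangle=\frac1{2h^\vee}\operatorname{tr}(\operatorname{ad}_a\operatorname{ad}_b)$, and let $v^{(i)},w^{(i)}$ be dual bases of $\mathfrak g$ for this form. For a level $k$ let $\hat{\mathfrak g}_k$ denote the algebra generated by modes $a_n$ ($a\in\mathfrak g$, $n\in\mathbb Z$), linear in $a$, with $[a_m,b_n]=[a,b]_{m+n}+m\,\delta_{m,-n}\langle a,b\rangle k$. Let $\kappa$ be a formal variable, consider over $\mathbb C(\kappa)$ the product $U=\hat{\mathfrak g}_{\kappa-1}\times\hat{\mathfrak g}_1$ (two commuting sets of modes $a_n^{(\kappa-1)},a_n^{(1)}$), the diagonal modes $a_n^{(\kappa)}=a_n^{(\kappa-1)}+a_n^{(1)}$, and the integral form $U_R\subset U$ generated by all $a_n^{(\kappa-1)}/\kappa$ and $a_n^{(1)}$ over the ring $R\subset\mathbb C(\kappa)$ of rational functions regular at $\kappa=\infty$. The limit $\kappa\to\infty$ of $U_R$, or of a $U_R$-module $M$, is the quotient by $\kappa^{-1}$. A module is smooth if each vector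 is annihilated by all modes $a_n$ with $n$ sufficiently large. On smooth modules let $L_n^{(k)}=\frac{1}{2(k+h^\vee)}\sum_{n'+n''=n}\sum_i :\!v^{(i)}_{n'}w^{(i)}_{n''}\!:$ be the Sugawara operators built from the modes of level $k$, and let $L_n^{Coset}=L_n^{(\kappa-1)}+L_n^{(1)}-L_n^{(\kappa)}$. A $\mathfrak g$-connection $d+A$ on the formal punctured disc is given by $A=\sum_n A_nz^{-n-1}$, $A_n\in\mathfrak g$, with $A_n=0$ for $n\gg0$; the ring of functions $\mathcal O$ on the space of connections is the $\mathbb C$-algebra of functions generated by $d+A\mapsto\langle A_n,a\rangle$. (1) The limit $U_R/\kappa^{-1}U_R$ is a bundle over the space of $\mathfrak g$-connections: there is an algebra isomorphism $\mathcal O\otimes\hat{\mathfrak g}_1\cong U_R/\kappa^{-1}U_R$ that sends the function $d+A\mapsto\langle A_n,a\rangle$ to the class of $a_n^{(\kappa)}/\kappa$ and $a_n\in\hat{\mathfrak g}_1$ to the class of $a_n^{(1)}$. (2) For every connection $d+A$, the fibre over $d+A$, i.e. the coinvariants of the limit with respect to all $a_n^{(\kappa)}/\kappa-\langle A_n,a\rangle$,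 is isomorphic to $\hat{\mathfrak g}_1$ as a vector space, and indeed as a left $\hat{\mathfrak g}_1$-module, with $1\mapsto 1$. Likewise, if $N\ge 0$ and $A_n=0$ for all $n\ge N$, let $P_N$ be the quotient of $U$ by the left ideal generated by all modes of degree $\ge N$; it is a smooth module, and the fibre over $d+A$ of the $U_R$-submodule generated by the class of $1$ in $P_N$ is isomorphic, as a $\hat{\mathfrak g}_1$-module, to the quotient of $\hat{\mathfrak g}_1$ by the left ideal generated by the modes of degree $\geq N$, with class of $1\mapsto$ class of $1$. (3) Let $V$ be a smooth $U$-module, $M\subset V$ a $U_R$-submodule and $d+A$ a connection. Then $L_n^{Coset}M\subset M$ for all $n\in\mathbb Z$; the fibre of $M$ over $d+A$, i.e. the coinvariants of the limit of $M$ with respect to all $a_n^{(\kappa)}/\kappa-\langle A_n,a\rangle$, is a smooth $\hat{\mathfrak g}_1$-module; and $L_n^{Coset}$ descends to it as $$L_n^{d+A}=L_n-\sum_{n'+n''=n}(A_{n''})_{n'}+\frac12\sum_{n'+n''=n}\langle A_{n'},A_{n''}\rangle ,$$ where $L_n=L_n^{(1)}$ and $(A_{n''})_{n'}$ is the mode $n'$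 of $A_{n''}\in\mathfrak g$ in $\hat{\mathfrak g}_1$. (Equivalently, if all Sugawara operators are taken with the opposite overall sign, the formula reads $L_n+\sum(A_{n''})_{n'}-\frac12\sum\langle A_{n'},A_{n''}\rangle$.) (4) On every smooth $\hat{\mathfrak g}_1$-module the operators $L_n^{d+A}$ are a Virasoro action, $[L_m^{d+A},L_n^{d+A}]=(m-n)L_{m+n}^{d+A}+\frac{c}{12}(m^3-m)\delta_{m,-n}$ with $c=\frac{\dim\mathfrak g}{1+h^\vee}$. -/

import Mathlib

open scoped TensorProduct

noncomputable section

namespace AffineCoset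

section Finite

variable {g : Type*} [LieRing g] [LieAlgebra ℂ g] [FiniteDimensional ℂ g]
  [LieAlgebra.IsKilling ℂ g] (H : LieSubalgebra ℂ g) [H.IsCartanSubalgebra]

/-- All roots have the same length, i.e. all coroots have the same Killing norm. -/
def IsSimplyLaced : Prop :=
  ∀ α ∈ H.root, ∀ β ∈ H.root,
    killingForm ℂ g (LieAlgebra.IsKilling.coroot α : H) (LieAlgebra.IsKilling.coroot α : H) =
      killingForm ℂ g (LieAlgebra.IsKilling.coroot β : H) (LieAlgebra.IsKilling.coroot β : H)

/-- The dual Coxeter number `h^∨`, computed from a long root `θ`: it is the number such that the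
form `(2 h^∨)⁻¹ • Killing` gives the long roots squared length `2`, equivalently gives `θ^∨` the
squared length `2`. -/
def dualCoxeter (θ : LieModule.Weight ℂ H g) : ℂ :=
  killingForm ℂ g (LieAlgebra.IsKilling.coroot θ : H) (LieAlgebra.IsKilling.coroot θ : H) / 4

/-- The invariant form `⟨a, b⟩ = (2 h^∨)⁻¹ tr (ad a ad b)`. -/
def normalizedForm (θ : LieModule.Weight ℂ H g) : LinearMap.BilinForm ℂ g :=
  (2 * dualCoxeter H θ)⁻¹ • killingForm ℂ g

end Finite

section ModeAlgebra

variable (S : Type*) [CommRing S] [Algebra ℂ S] {σ : Type*}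
  {g : Type*} [LieRing g] [LieAlgebra ℂ g] (B : LinearMap.BilinForm ℂ g) (k : σ → S)

/-- Defining relations, over the base ring `S`, of the product over `s : σ` of the affine Lie
algebras of level `k s`: the generator `(s, a, n)` is the mode `a_n` of the factor `s`. -/
inductive ModeRel : FreeAlgebra S (σ × g × ℤ) → FreeAlgebra S (σ × g × ℤ) → Prop
  | add (s : σ) (a b : g) (n : ℤ) :
      ModeRel (FreeAlgebra.ι S (s, a + b, n))
        (FreeAlgebra.ι S (s, a, n) + FreeAlgebra.ι S (s, b, n))
  | smul (s : σ) (c : ℂ) (a : g) (n : ℤ) :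
      ModeRel (FreeAlgebra.ι S (s, c • a, n)) (algebraMap ℂ S c • FreeAlgebra.ι S (s, a, n))
  | comm (s : σ) (a b : g) (m n : ℤ) :
      ModeRel (FreeAlgebra.ι S (s, a, m) * FreeAlgebra.ι S (s, b, n))
        (FreeAlgebra.ι S (s, b, n) * FreeAlgebra.ι S (s, a, m) +
          FreeAlgebra.ι S (s, ⁅a, b⁆, m + n) +
          algebraMap S _ (if m + n = 0 then algebraMap ℂ S (m * B a b) * k s else 0))
  | comm_of_ne (s t : σ) (hst : s ≠ t) (a b : g) (m n : ℤ) :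
      ModeRel (FreeAlgebra.ι S (s, a, m) * FreeAlgebra.ι S (t, b, n))
        (FreeAlgebra.ι S (t, b, n) * FreeAlgebra.ι S (s, a, m))

/-- The mode algebra (enveloping algebra at fixed levels) of a product of affine Lie algebras. -/
def ModeAlgebra : Type _ := RingQuot (ModeRel S B k)

instance : Ring (ModeAlgebra S B k) := inferInstanceAs (Ring (RingQuot (ModeRel S B k)))

instance {T : Type*} [CommRing T] [Algebra T S] : Algebra T (ModeAlgebra S B k) :=
  inferInstanceAs (Algebra T (RingQuot (ModeRel S B k)))

instance {T : Type*} [CommRing T] [Algebra T S] : IsScalarTower T S (ModeAlgebra S B k) :=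
  inferInstanceAs (IsScalarTower T S (RingQuot (ModeRel S B k)))

/-- The projection from the free algebra on the modes. -/
def ModeAlgebra.proj : FreeAlgebra S (σ × g × ℤ) →ₐ[S] ModeAlgebra S B k :=
  RingQuot.mkAlgHom S (ModeRel S B k)

variable {S B k} in
lemma ModeAlgebra.proj_rel {x y : FreeAlgebra S (σ × g × ℤ)} (h : ModeRel S B k x y) :
    proj S B k x = proj S B k y :=
  RingQuot.mkAlgHom_rel S h

variable {S B k} in
/-- The universal property of the mode algebra. -/
def ModeAlgebra.lift {C : Type*} [Ring C] [Algebra S C] (f : FreeAlgebra S (σ × g × ℤ) →ₐ[S] C)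
    (hf : ∀ x y, ModeRel S B k x y → f x = f y) : ModeAlgebra S B k →ₐ[S] C :=
  RingQuot.liftAlgHom S ⟨f, fun x y h => hf x y h⟩

/-- The mode `a_n` of the factor `s`. -/
def mode (s : σ) (a : g) (n : ℤ) : ModeAlgebra S B k :=
  ModeAlgebra.proj S B k (FreeAlgebra.ι S (s, a, n))

/-- Smooth modules: every vector is killed by all modes of sufficiently large degree. -/
def IsSmooth (V : Type*) [AddCommGroup V] [Module (ModeAlgebra S B k) V] : Prop :=
  ∀ x : V, ∃ N : ℤ, ∀ n ≥ N, ∀ (s : σ) (a : g), mode S B k s a n • x = 0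

/-- The left ideal generated by all modes of degree at least `N`. -/
def highModes (N : ℕ) : Submodule (ModeAlgebra S B k) (ModeAlgebra S B k) :=
  Submodule.span _ {u | ∃ (s : σ) (a : g) (n : ℤ), (N : ℤ) ≤ n ∧ u = mode S B k s a n}

lemma mode_add (s : σ) (a b : g) (n : ℤ) :
    mode S B k s (a + b) n = mode S B k s a n + mode S B k s b n := by
  simpa [mode] using ModeAlgebra.proj_rel (ModeRel.add (B := B) (k := k) s a b n)

lemma mode_smul (s : σ) (c : ℂ) (a : g) (n : ℤ) :
    mode S B k s (c • a) n = algebraMap ℂ S c • mode S B k s a n := by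
  have h := ModeAlgebra.proj_rel (ModeRel.smul (B := B) (k := k) s c a n)
  rw [map_smul] at h
  exact h

lemma mode_mul (s : σ) (a b : g) (m n : ℤ) :
    mode S B k s a m * mode S B k s b n =
      mode S B k s b n * mode S B k s a m + mode S B k s ⁅a, b⁆ (m + n) +
      algebraMap S _ (if m + n = 0 then algebraMap ℂ S (m * B a b) * k s else 0) := by
  have h := ModeAlgebra.proj_rel (ModeRel.comm (B := B) (k := k) s a b m n)
  rw [map_mul, map_add, map_add, map_mul, AlgHom.commutes] at h
  exact h

end ModeAlgebra

section Sugawara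

variable {F : Type*} [Field F] {U : Type*} [Ring U] [Algebra F U] {W : Type*} [AddCommGroup W]
  [Module U W] {g ι : Type*} [Fintype ι]

/-- The normally ordered product `:a_m b_l:` for the modes `a_n = J a n`. -/
def normalOrdered (J : g → ℤ → U) (a b : g) (m l : ℤ) : U :=
  if m < 0 then J a m * J b l else J b l * J a m

/-- The Sugawara operator
`L_n = 1 / (2 (k + h)) * ∑_{n' + n'' = n} ∑_i :v^{(i)}_{n'} w^{(i)}_{n''}:` at level `k`,
acting on a vector `x`. On a smooth module the sum has finite support. -/
def sugawara (J : g → ℤ → U) (k h : F) (v w : ι → g) (n : ℤ) (x : W) : W :=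
  algebraMap F U (2 * (k + h))⁻¹ • ∑ᶠ m : ℤ, ∑ i, normalOrdered J (v i) (w i) m (n - m) • x

/-- The operators `L n`, `n : ℤ`, on the module `W` over a complex algebra `U` are linear and
satisfy the Virasoro relations with central charge `c`. -/
def IsVirasoroAction (U : Type*) [Ring U] [Algebra ℂ U] {W : Type*} [AddCommGroup W] [Module U W]
    (L : ℤ → W → W) (c : ℂ) : Prop :=
  (∀ n x y, L n (x + y) = L n x + L n y) ∧
  (∀ n (t : ℂ) x, L n (algebraMap ℂ U t • x) = algebraMap ℂ U t • L n x) ∧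
  ∀ m n x, L m (L n x) - L n (L m x) =
    algebraMap ℂ U (m - n) • L (m + n) x +
      algebraMap ℂ U (if m + n = 0 then c / 12 * ((m : ℂ) ^ 3 - m) else 0) • x

end Sugawara

section Connections

variable {g : Type*} [LieRing g] [LieAlgebra ℂ g] (B : LinearMap.BilinForm ℂ g)

/-- A `g`-connection `d + A` on the formal punctured disc: `A = ∑ A_n z^{-n-1}` is a formal
Laurent series in `z`, i.e. `A_n = 0` for large `n`. -/
def Connection (g : Type*) [LieRing g] : Type _ :=
  {A : ℤ → g // ∃ N : ℤ, ∀ n ≥ N, A n = 0}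

/-- The ring of functions on the space of connections, generated by `d + A ↦ ⟨A_n, a⟩`. -/
def functionRing : Subalgebra ℂ (Connection g → ℂ) :=
  Algebra.adjoin ℂ {f | ∃ (a : g) (n : ℤ), f = fun A => B (A.1 n) a}

/-- The function `d + A ↦ ⟨A_n, a⟩`. -/
def coord (a : g) (n : ℤ) : functionRing B :=
  ⟨fun A => B (A.1 n) a, Algebra.subset_adjoin ⟨a, n, rfl⟩⟩

end Connections

section Family

variable {g : Type*} [LieRing g] [LieAlgebra ℂ g] (B : LinearMap.BilinForm ℂ g)

/-- The level `κ` as the variable of the field `ℂ(κ)`. -/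
def kap : RatFunc ℂ := RatFunc.X

/-- The mode algebra of the affine Lie algebra of level `1`. -/
abbrev LevelOne : Type _ := ModeAlgebra ℂ B (fun _ : Unit => (1 : ℂ))

/-- The mode `a_n` of level `1`. -/
def modeOne (a : g) (n : ℤ) : LevelOne B := mode ℂ B _ () a n

/-- The mode algebra over `ℂ(κ)` of the product of affine Lie algebras of levels `κ - 1`, `1`. -/
abbrev Generic : Type _ := ModeAlgebra (RatFunc ℂ) B (![kap - 1, 1] : Fin 2 → RatFunc ℂ)

/-- The mode `a_n^{(κ-1)}`. -/
def modeX (a : g) (n : ℤ) : Generic B := mode (RatFunc ℂ) B _ 0 a n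

/-- The mode `a_n^{(1)}`. -/
def modeY (a : g) (n : ℤ) : Generic B := mode (RatFunc ℂ) B _ 1 a n

/-- The diagonally embedded mode `a_n^{(κ)} = a_n^{(κ-1)} + a_n^{(1)}`. -/
def modeDiag (a : g) (n : ℤ) : Generic B := modeX B a n + modeY B a n

/-- The integral form: generated by `a_n^{(κ-1)} / κ` and `a_n^{(1)}` over the ring of rational
functions of `κ` that are regular at `κ = ∞` (i.e. of degree at most `0`). -/
def intForm : Subalgebra ℂ (Generic B) :=
  Algebra.adjoin ℂ
    ({u | ∃ f : RatFunc ℂ, f.intDegree ≤ 0 ∧ u = algebraMap (RatFunc ℂ) _ f} ∪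
      {u | ∃ (a : g) (n : ℤ), u = kap⁻¹ • modeX B a n} ∪ {u | ∃ (a : g) (n : ℤ), u = modeY B a n})

lemma algebraMap_kap_inv_mem :
    algebraMap (RatFunc ℂ) (Generic B) kap⁻¹ ∈ intForm B := by
  refine Algebra.subset_adjoin (Or.inl (Or.inl ⟨_, ?_, rfl⟩))
  simp [kap, RatFunc.intDegree_inv]

lemma modeY_mem (a : g) (n : ℤ) : modeY B a n ∈ intForm B :=
  Algebra.subset_adjoin (Or.inr ⟨a, n, rfl⟩)

lemma modeDiag_mem (a : g) (n : ℤ) : kap⁻¹ • modeDiag B a n ∈ intForm B := by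
  rw [modeDiag, smul_add]
  refine add_mem (Algebra.subset_adjoin (Or.inl (Or.inr ⟨a, n, rfl⟩))) ?_
  rw [Algebra.smul_def]
  exact mul_mem (algebraMap_kap_inv_mem B) (modeY_mem B a n)

/-- The element `κ⁻¹` of the integral form. -/
def kapInv : intForm B := ⟨_, algebraMap_kap_inv_mem B⟩

/-- The element `a_n^{(κ)} / κ` of the integral form. -/
def scaledDiag (a : g) (n : ℤ) : intForm B := ⟨_, modeDiag_mem B a n⟩

/-- The inclusion `a_n ↦ a_n^{(1)}` of the second factor into the integral form. -/
def inclOne : LevelOne B →ₐ[ℂ] intForm B :=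
  ModeAlgebra.lift (FreeAlgebra.lift ℂ fun p => ⟨modeY B p.2.1 p.2.2, modeY_mem B _ _⟩) <| by
    intro x y h
    apply Subtype.ext
    induction h with
    | add s a b n => simpa [modeY] using mode_add (RatFunc ℂ) B ![kap - 1, 1] 1 a b n
    | smul s c a n =>
      have h := mode_smul (RatFunc ℂ) B ![kap - 1, 1] 1 c a n
      rw [algebraMap_smul] at h
      simpa [modeY] using h
    | comm s a b m n =>
      have h := mode_mul (RatFunc ℂ) B ![kap - 1, 1] 1 a b m n
      simp only [map_mul, map_add, FreeAlgebra.lift_ι_apply, AlgHom.commutes]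
      change modeY B a m * modeY B b n = modeY B b n * modeY B a m + modeY B ⁅a, b⁆ (m + n) +
        algebraMap ℂ (Generic B) _
      rw [IsScalarTower.algebraMap_apply ℂ (RatFunc ℂ) (Generic B)]
      refine h.trans ?_
      congr 2
      split_ifs <;> simp
    | comm_of_ne s t hst => exact absurd rfl hst

/-- The limit `κ → ∞`: the integral form modulo `κ⁻¹`. -/
abbrev Limit : Type _ := RingQuot (fun x y : intForm B => x = kapInv B ∧ y = 0)

/-- The projection of the integral form to the limit. -/
def toLimit : intForm B →ₐ[ℂ] Limit B := RingQuot.mkAlgHom ℂ _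

section Coinvariants

variable (A : Connection g) (M : Type*) [AddCommGroup M] [Module (intForm B) M]

/-- The submodule of `M` generated by `κ⁻¹ M` and all `(a_n^{(κ)} / κ - ⟨A_n, a⟩) M`. -/
def coinvKer : Submodule (intForm B) M :=
  Submodule.span _ ({y | ∃ x : M, y = kapInv B • x} ∪
    {y | ∃ (a : g) (n : ℤ) (x : M),
      y = (scaledDiag B a n - algebraMap ℂ (intForm B) (B (A.1 n) a)) • x})

/-- The fibre at `d + A` of the limit of `M`: the coinvariants of the limit `M / κ⁻¹ M` with
respect to all `a_n^{(κ)} / κ - ⟨A_n, a⟩`. -/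
def Coinv : Type _ := M ⧸ coinvKer B A M

instance : AddCommGroup (Coinv B A M) := inferInstanceAs (AddCommGroup (M ⧸ coinvKer B A M))

instance : Module (intForm B) (Coinv B A M) :=
  inferInstanceAs (Module (intForm B) (M ⧸ coinvKer B A M))

/-- The fibre is a module over the second factor through `a_n ↦ a_n^{(1)}`. -/
instance : Module (LevelOne B) (Coinv B A M) :=
  Module.compHom (Coinv B A M) (inclOne B).toRingHom

variable {M}

/-- The class of a vector in the fibre at `d + A`. -/
def Coinv.mk (x : M) : Coinv B A M := (coinvKer B A M).mkQ x

end Coinvariants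

section Coset

variable {ι : Type*} [Fintype ι] (h : ℂ) (v w : ι → g)

/-- The coset Virasoro operator `L_n^{(κ-1)} + L_n^{(1)} - L_n^{(κ)}`. -/
def cosetL {V : Type*} [AddCommGroup V] [Module (Generic B) V] (n : ℤ) (x : V) : V :=
  sugawara (modeX B) (kap - 1) (algebraMap ℂ (RatFunc ℂ) h) v w n x +
    sugawara (modeY B) 1 (algebraMap ℂ (RatFunc ℂ) h) v w n x -
    sugawara (modeDiag B) kap (algebraMap ℂ (RatFunc ℂ) h) v w n x

/-- The deformed operator
`L_n - ∑_{n' + n'' = n} (A_{n''})_{n'} + 1/2 ∑_{n' + n'' = n} ⟨A_{n'}, A_{n''}⟩`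
on a module of level `1`, where `L_n` is the Sugawara operator of level `1`. -/
def deformedL (A : Connection g) {W : Type*} [AddCommGroup W] [Module (LevelOne B) W]
    (n : ℤ) (x : W) : W :=
  sugawara (modeOne B) 1 h v w n x - ∑ᶠ m : ℤ, modeOne B (A.1 (n - m)) m • x +
    algebraMap ℂ (LevelOne B) (1 / 2 * ∑ᶠ m : ℤ, B (A.1 m) (A.1 (n - m))) • x

end Coset

/-- The universal smooth module over `ℂ(κ)` generated by a vector that is killed by all modes of
degree at least `N`. -/
abbrev UnivSmooth (N : ℕ) : Type _ :=
  Generic B ⧸ highModes (RatFunc ℂ) B (![kap - 1, 1] : Fin 2 → RatFunc ℂ) N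

/-- Its cyclic vector. -/
def univVec (N : ℕ) : UnivSmooth B N := Submodule.Quotient.mk 1

/-- The integral form of the universal smooth module. -/
def univLattice (N : ℕ) : Submodule (intForm B) (UnivSmooth B N) :=
  Submodule.span _ {univVec B N}

/-- The cyclic vector of the integral form. -/
def univLatticeVec (N : ℕ) : univLattice B N :=
  ⟨univVec B N, Submodule.mem_span_singleton_self _⟩

end Family

end AffineCoset

end

open AffineCoset

open scoped TensorProduct

noncomputable section

set_option linter.unusedSectionVars false

/-! Dividing the modes of level `κ - 1` by `κ` turns their bracket into `κ⁻¹ [a, b]` and their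
central term into `(κ⁻¹ - κ⁻²) m δ ⟨a, b⟩`. Modulo `κ⁻¹` the rescaled modes, or equally the rescaled
diagonal ones, therefore commute with everything, and the relations give surjections from the
expected answers onto the limit and onto its fibres. The real content of the first two assertions is
that nothing collapses further.

For this one needs enough modules. `pbwOp` is a Poincaré–Birkhoff–Witt module for a Lie algebra with
ordered basis, bracket scaled by `s` and 2-cocycle `τ`, over any commutative ring of coefficients: a
basis element acts on polynomials by its variable plus terms of lower order. The construction is
natural in the coefficients (`map_pbwOp`). Over the functions regular at infinity it is thus a
lattice in the module over `ℂ(κ)`, and at `κ = ∞`, where `s = τ = 0`, basis elements act exactly by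
their variables. After tensoring with a level one module `Q` the whole product algebra acts, and the
integral form preserves the lattice. Evaluating at `κ = ∞` and at the coordinates of `A` yields
`fibreHom`, an action of the integral form on `Q` in which `κ⁻¹` is zero, `a_n^{(κ)} / κ` is the
scalar `⟨A_n, a⟩`, and level one acts as given. With `Q` the level one algebra this proves
injectivity for the algebra and its fibres; functions are separated by their values at connections.
For the universal smooth modules `Q` is the corresponding quotient, and one also needs that the left
ideal of high modes sends the cyclic vector to monomials containing a high variable
(`pbwOp_mem_meetLE`); these vanish at `A` because `A_n = 0` for `n ≥ N`.

For the coset operators, write the first set of modes as diagonal minus level one. The quadratic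
coefficients then become `κ⁻²`, `κ⁻¹` and `κ⁻¹` times regular functions, plus the level one Sugawara
coefficient. The powers of `κ` are absorbed by the rescaled diagonal modes, except for one spare
`κ⁻¹` on the product of two level one modes, and the limits of the coefficients are read off
(`cosetTerm_coe`, `Coinv.cosetTerm_smul`).

For the Virasoro relations, the Sugawara operators satisfy `[L_m, a_n] = -n a_{m+n}`, by a
telescoping sum whose boundary value is the Casimir eigenvalue `2h`. A second telescoping sum gives
the central charge. With `C_n` denoting the linear term of the connection, `[L_m, C_n] - [L_n, C_m]
= (m - n) C_{m+n}`, while `[C_m, C_n]` is a scalar that supplies exactly the quadratic term. -/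

namespace AffineCoset

/-! ### Degree filtrations on polynomial rings. -/

section DegreeFiltration

open MvPolynomial

variable {S I : Type*} [CommRing S]

variable (I S) in
/-- Polynomials of degree at most `n`. -/
def degLE (n : ℕ) : Submodule S (MvPolynomial I S) :=
  Submodule.span S ((fun M : I →₀ ℕ => monomial M (1 : S)) '' {M | M.degree ≤ n})

lemma monomial_mem_degLE {M : I →₀ ℕ} {n : ℕ} (h : M.degree ≤ n) :
    monomial M (1 : S) ∈ degLE S I n :=
  Submodule.subset_span ⟨M, h, rfl⟩

lemma degLE_mono {m n : ℕ} (h : m ≤ n) : degLE S I m ≤ degLE S I n :=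
  Submodule.span_mono (Set.image_mono fun _ hM => le_trans hM h)

variable (S) in
/-- The span of the monomials of degree at most `n` that involve a variable from `H`. -/
def meetLE (H : Set I) (n : ℕ) : Submodule S (MvPolynomial I S) :=
  Submodule.span S ((fun M : I →₀ ℕ => monomial M (1 : S)) ''
    {M | M.degree ≤ n ∧ ∃ i ∈ M.support, i ∈ H})

lemma meetLE_mono (H : Set I) {m n : ℕ} (h : m ≤ n) : meetLE S H m ≤ meetLE S H n :=
  Submodule.span_mono (Set.image_mono fun _ hM => ⟨le_trans hM.1 h, hM.2⟩)

lemma monomial_mem_meetLE {H : Set I} {M : I →₀ ℕ} {n : ℕ} (h : M.degree ≤ n) {i : I}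
    (hi : i ∈ M.support) (hH : i ∈ H) : monomial M (1 : S) ∈ meetLE S H n :=
  Submodule.subset_span ⟨M, ⟨h, i, hi, hH⟩, rfl⟩

lemma X_mul_monomial (i : I) (M : I →₀ ℕ) :
    X i * monomial M (1 : S) = monomial (Finsupp.single i 1 + M) 1 := by
  rw [X, monomial_mul, one_mul]

lemma X_mul_mem_degLE (i : I) {n : ℕ} {f : MvPolynomial I S} (hf : f ∈ degLE S I n) :
    X i * f ∈ degLE S I (n + 1) := by
  have : degLE S I n ≤ (degLE S I (n + 1)).comap (LinearMap.mulLeft S (X i)) := by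
    refine Submodule.span_le.mpr ?_
    rintro _ ⟨M, hM, rfl⟩
    change X i * monomial M (1 : S) ∈ degLE S I (n + 1)
    rw [X_mul_monomial]
    refine monomial_mem_degLE ?_
    rw [map_add, Finsupp.degree_single]
    exact (add_comm _ _).trans_le (Nat.succ_le_succ hM)
  exact this hf

lemma X_mul_mem_meetLE (i : I) {H : Set I} {n : ℕ} {f : MvPolynomial I S}
    (hf : f ∈ meetLE S H n) : X i * f ∈ meetLE S H (n + 1) := by
  have : meetLE S H n ≤ (meetLE S H (n + 1)).comap (LinearMap.mulLeft S (X i)) := by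
    refine Submodule.span_le.mpr ?_
    rintro _ ⟨M, ⟨hM, j, hj, hjH⟩, rfl⟩
    change X i * monomial M (1 : S) ∈ meetLE S H (n + 1)
    rw [X_mul_monomial]
    refine monomial_mem_meetLE ?_ (i := j) ?_ hjH
    · rw [map_add, Finsupp.degree_single]
      exact (add_comm _ _).trans_le (Nat.succ_le_succ hM)
    · rw [Finsupp.mem_support_iff] at hj ⊢
      simp only [Finsupp.coe_add, Pi.add_apply]
      omega
  exact this hf

lemma constr_monomial {N : Type*} [AddCommGroup N] [Module S N] (f : (I →₀ ℕ) → N)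
    (M : I →₀ ℕ) : (basisMonomials I S).constr S f (monomial M 1) = f M := by
  have := (basisMonomials I S).constr_basis S f M
  rwa [coe_basisMonomials] at this

lemma polynomial_induction_monomial {p : MvPolynomial I S → Prop} (f : MvPolynomial I S)
    (hm : ∀ M, p (monomial M 1)) (ha : ∀ f g, p f → p g → p (f + g))
    (hs : ∀ (c : S) f, p f → p (c • f)) : p f := by
  induction f using MvPolynomial.induction_on' with
  | monomial M c =>
    have := hs c _ (hm M)
    rwa [smul_monomial, smul_eq_mul, mul_one] at this
  | add f g hf hg => exact ha _ _ hf hg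

lemma mem_degLE (f : MvPolynomial I S) : ∃ n, f ∈ degLE S I n := by
  refine polynomial_induction_monomial (p := fun f => ∃ n, f ∈ degLE S I n) f (fun M => ⟨_, monomial_mem_degLE le_rfl⟩)
    ?_ ?_
  · rintro f g ⟨m, hm⟩ ⟨n, hn⟩
    exact ⟨max m n, add_mem (degLE_mono (le_max_left _ _) hm) (degLE_mono (le_max_right _ _) hn)⟩
  · rintro c f ⟨n, hn⟩
    exact ⟨n, Submodule.smul_mem _ c hn⟩

end DegreeFiltration

lemma linearMap_apply_mem_of_basis {K L I N : Type*} [CommRing K] [AddCommGroup L] [Module K L]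
    [AddCommGroup N] [Module K N] (b : Module.Basis I K L) {p : Submodule K N}
    (f : L →ₗ[K] N) (h : ∀ i, f (b i) ∈ p) (x : L) : f x ∈ p := by
  have hx := b.mem_span x
  have : x ∈ p.comap f := by
    refine Submodule.span_le.mpr ?_ hx
    rintro _ ⟨i, rfl⟩
    exact h i
  exact this

/-! ### The Poincaré–Birkhoff–Witt action with scaled bracket and central term. -/

section PBW

open MvPolynomial

variable {K S L I : Type*} [CommRing K] [CommRing S] [Algebra K S] [LieRing L] [LieAlgebra K L]
  [LinearOrder I] (b : Module.Basis I K L) (s : S) (τ : L →ₗ[K] L →ₗ[K] S)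

open Classical in
/-- Truncations of the Poincaré–Birkhoff–Witt action `pbwOp`, correct in degrees at most `n`. -/
def pbwAux : ℕ → (L →ₗ[K] Module.End S (MvPolynomial I S))
  | 0 => b.constr K fun i => LinearMap.mulLeft S (X i)
  | n + 1 => b.constr K fun i => (basisMonomials I S).constr S fun M =>
      if M.degree ≤ n then pbwAux n (b i) (monomial M 1)
      else if h : ∃ j ∈ M.support, (∀ k ∈ M.support, j ≤ k) ∧ j < i then
        -- Write `M = X_j N`. This is `b_j b_i N + s [b_i, b_j] N + τ N`, where `b_i N` is split as
        -- `X_i N` plus lower order: on the first part `b_j` multiplies, giving `X_i M`, and on the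
        -- second the action is already known.
        X i * monomial M 1 +
          pbwAux n (b h.choose)
            (pbwAux n (b i) (monomial (M - Finsupp.single h.choose 1) 1) -
              X i * monomial (M - Finsupp.single h.choose 1) 1) +
          s • pbwAux n ⁅b i, b h.choose⁆ (monomial (M - Finsupp.single h.choose 1) 1) +
          τ (b i) (b h.choose) • monomial (M - Finsupp.single h.choose 1) 1
      else X i * monomial M 1

/-- The Poincaré–Birkhoff–Witt action of a Lie algebra with ordered basis `b`, bracket rescaled by
`s` and central term `τ`, on polynomials in the basis elements. -/
def pbwOp : L →ₗ[K] Module.End S (MvPolynomial I S) :=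
  b.constr K fun i => (basisMonomials I S).constr S fun M =>
    pbwAux b s τ M.degree (b i) (monomial M 1)

lemma pbwOp_basis_monomial (i : I) (M : I →₀ ℕ) :
    pbwOp b s τ (b i) (monomial M 1) = pbwAux b s τ M.degree (b i) (monomial M 1) := by
  rw [pbwOp, Module.Basis.constr_basis, constr_monomial]

/-- Each stage copies the previous one on the degrees already treated, so the truncations are
compatible and `pbwOp` is their union. -/
lemma pbwAux_eq (n : ℕ) (M : I →₀ ℕ) (h : M.degree ≤ n) (x : L) :
    pbwAux b s τ n x (monomial M 1) = pbwOp b s τ x (monomial M 1) := by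
  suffices H : ∀ i, pbwAux b s τ n (b i) (monomial M 1) = pbwOp b s τ (b i) (monomial M 1) by
    let f : L →ₗ[K] MvPolynomial I S :=
      (LinearMap.applyₗ (R := S) (monomial M (1 : S))).restrictScalars K ∘ₗ
        (pbwAux b s τ n - pbwOp b s τ)
    have := linearMap_apply_mem_of_basis b (p := ⊥) f
      (fun i => by simp [f, H i]) x
    simpa [f, sub_eq_zero] using this
  intro i
  rw [pbwOp_basis_monomial]
  induction n with
  | zero => rw [Nat.le_zero.mp h]
  | succ n ih =>
    rcases Nat.lt_or_ge n M.degree with h' | h'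
    · rw [show M.degree = n + 1 by omega]
    · rw [← ih h', pbwAux, Module.Basis.constr_basis, constr_monomial, if_pos h']

lemma pbwAux_eq_of_mem (n : ℕ) (x : L) {p : MvPolynomial I S} (hp : p ∈ degLE S I n) :
    pbwAux b s τ n x p = pbwOp b s τ x p := by
  induction hp using Submodule.span_induction with
  | mem p hp => obtain ⟨M, hM, rfl⟩ := hp; exact pbwAux_eq b s τ n M hM x
  | zero => simp
  | add p q _ _ hp hq => simp [hp, hq]
  | smul c p _ hp => simp [hp]

/-- A basis element acts by multiplication on monomials in larger variables. -/
lemma pbwOp_monomial_of_le (i : I) (M : I →₀ ℕ) (h : ∀ k ∈ M.support, i ≤ k) :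
    pbwOp b s τ (b i) (monomial M 1) = X i * monomial M 1 := by
  rw [pbwOp_basis_monomial]
  rcases hn : M.degree with _ | n
  · rw [pbwAux, Module.Basis.constr_basis, LinearMap.mulLeft_apply]
  · rw [pbwAux, Module.Basis.constr_basis, constr_monomial, if_neg (by omega), dif_neg]
    rintro ⟨j, hj, -, hji⟩
    exact absurd (h j hj) (not_le.mpr hji)

/-- The variable chosen in the definition is the least one of the monomial, hence is `j`. One
truncated operator remains; it can be replaced by `pbwOp` only once its argument is known to have
low degree. -/
lemma pbwOp_monomial_of_lt_aux {i j : I} (hji : j < i) (M : I →₀ ℕ) (h : ∀ k ∈ M.support, j ≤ k) :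
    pbwOp b s τ (b i) (monomial (Finsupp.single j 1 + M) 1) =
      X i * monomial (Finsupp.single j 1 + M) 1 +
      pbwAux b s τ M.degree (b j) (pbwOp b s τ (b i) (monomial M 1) - X i * monomial M 1) +
      s • pbwOp b s τ ⁅b i, b j⁆ (monomial M 1) + τ (b i) (b j) • monomial M 1 := by
  have hsup : ∀ k, k ∈ (Finsupp.single j 1 + M).support ↔ k = j ∨ k ∈ M.support := by
    intro k
    by_cases hk : k = j
    · subst hk; simp
    · simp [hk]
  have hex : ∃ j' ∈ (Finsupp.single j 1 + M).support,
      (∀ k ∈ (Finsupp.single j 1 + M).support, j' ≤ k) ∧ j' < i := by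
    refine ⟨j, (hsup j).mpr (Or.inl rfl), fun k hk => ?_, hji⟩
    rcases (hsup k).mp hk with rfl | hk
    exacts [le_rfl, h k hk]
  have hj : hex.choose = j := by
    obtain ⟨h1, h2, -⟩ := hex.choose_spec
    refine le_antisymm (h2 j ((hsup j).mpr (Or.inl rfl))) ?_
    rcases (hsup _).mp h1 with h1 | h1
    exacts [h1.ge, h _ h1]
  rw [pbwOp_basis_monomial]
  have hd : (Finsupp.single j 1 + M).degree = M.degree + 1 := by
    rw [map_add, Finsupp.degree_single, add_comm]
  rw [hd, pbwAux, Module.Basis.constr_basis, constr_monomial, if_neg (by omega), dif_pos hex, hj,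
    add_tsub_cancel_left, pbwAux_eq b s τ _ M le_rfl, pbwAux_eq b s τ _ M le_rfl]

lemma pbwOp_mem_of_basis {p : Submodule S (MvPolynomial I S)} (f : MvPolynomial I S)
    (h : ∀ i, pbwOp b s τ (b i) f ∈ p) (x : L) : pbwOp b s τ x f ∈ p :=
  linearMap_apply_mem_of_basis b (p := p.restrictScalars K)
    ((LinearMap.applyₗ (R := S) f).restrictScalars K ∘ₗ pbwOp b s τ) h x

/-- The monomials are built up from `1` by multiplication with their smallest variable. -/
lemma monomial_cases (M : I →₀ ℕ) :
    M = 0 ∨ ∃ (j : I) (N : I →₀ ℕ), M = Finsupp.single j 1 + N ∧ ∀ k ∈ N.support, j ≤ k := by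
  rcases eq_or_ne M 0 with hM | hM
  · exact Or.inl hM
  · right
    have hne : M.support.Nonempty := Finsupp.support_nonempty_iff.mpr hM
    refine ⟨M.support.min' hne, M - Finsupp.single (M.support.min' hne) 1, ?_, fun k hk => ?_⟩
    · rw [add_tsub_cancel_of_le]
      rw [Finsupp.single_le_iff]
      exact Nat.one_le_iff_ne_zero.mpr (Finsupp.mem_support_iff.mp (M.support.min'_mem hne))
    · refine M.support.min'_le k ?_
      rw [Finsupp.mem_support_iff, Finsupp.tsub_apply] at hk
      exact Finsupp.mem_support_iff.mpr (by omega)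

/-- To prove a property of all `(i, M)` it suffices to treat `i ≤ M`, and to derive it for
`(i, j + N)`, `j < i`, `j ≤ N`, from the property in the degrees up to that of `N`. -/
lemma pbw_induction {P : I → (I →₀ ℕ) → Prop}
    (hle : ∀ i M, (∀ k ∈ M.support, i ≤ k) → P i M)
    (hlt : ∀ i j N, j < i → (∀ k ∈ N.support, j ≤ k) →
      (∀ i' M, M.degree ≤ N.degree → P i' M) → P i (Finsupp.single j 1 + N)) (i : I)
    (M : I →₀ ℕ) : P i M := by
  induction hn : M.degree using Nat.strong_induction_on generalizing i M with
  | _ n ih =>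
    rcases monomial_cases M with rfl | ⟨j, N, rfl, hN⟩
    · exact hle i 0 (by simp)
    · rw [map_add, Finsupp.degree_single] at hn
      rcases lt_or_ge j i with hji | hij
      · exact hlt i j N hji hN fun i' M hM => ih M.degree (by omega) i' M rfl
      · refine hle i _ fun k hk => hij.trans ?_
        by_cases hkj : k = j
        · exact hkj.ge
        · refine hN k ?_
          simpa [Finsupp.single_apply, Ne.symm hkj] using hk

/-- If basis elements act on monomials by multiplication up to lower order terms, then the action
raises the degree by at most one. -/
lemma pbwOp_mem_degLE_of_sub_mem {n : ℕ}
    (h : ∀ i (M : I →₀ ℕ), M.degree ≤ n →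
      pbwOp b s τ (b i) (monomial M 1) - X i * monomial M 1 ∈ degLE S I M.degree)
    (x : L) {f : MvPolynomial I S} (hf : f ∈ degLE S I n) :
    pbwOp b s τ x f ∈ degLE S I (n + 1) := by
  refine pbwOp_mem_of_basis b s τ f (fun i => ?_) x
  have : degLE S I n ≤ (degLE S I (n + 1)).comap (pbwOp b s τ (b i)) := by
    refine Submodule.span_le.mpr ?_
    rintro _ ⟨M, hM, rfl⟩
    have h1 := degLE_mono (hM.trans n.le_succ) (h i M hM)
    have h2 := add_mem h1 (X_mul_mem_degLE i (monomial_mem_degLE hM))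
    rwa [sub_add_cancel] at h2
  exact this hf

/-- In the recursion every term after the leading one is an operator applied to something of degree
at most `deg N`, or a multiple of `N`. By induction operators raise the degree by at most one there,
so these terms stay within `deg N + 1`, the degree of the monomial. -/
lemma pbwOp_sub_mem_degLE (i : I) (M : I →₀ ℕ) :
    pbwOp b s τ (b i) (monomial M 1) - X i * monomial M 1 ∈ degLE S I M.degree := by
  induction i, M using pbw_induction with
  | hle i M h => rw [pbwOp_monomial_of_le b s τ i M h, sub_self]; exact zero_mem _
  | hlt i j N hji hN ih =>
    rw [pbwOp_monomial_of_lt_aux b s τ hji N hN, pbwAux_eq_of_mem b s τ _ _ (ih i N le_rfl),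
      map_add, Finsupp.degree_single, add_assoc, add_assoc, add_sub_cancel_left, add_comm 1]
    refine add_mem (pbwOp_mem_degLE_of_sub_mem b s τ ih _ (ih i N le_rfl)) (add_mem
      (Submodule.smul_mem _ _ (pbwOp_mem_degLE_of_sub_mem b s τ ih _ (monomial_mem_degLE le_rfl)))
      (Submodule.smul_mem _ _ (monomial_mem_degLE (Nat.le_succ _))))

/-- The recursion that determines the action. -/
lemma pbwOp_monomial_of_lt {i j : I} (hji : j < i) (M : I →₀ ℕ) (h : ∀ k ∈ M.support, j ≤ k) :
    pbwOp b s τ (b i) (monomial (Finsupp.single j 1 + M) 1) =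
      X i * monomial (Finsupp.single j 1 + M) 1 +
      pbwOp b s τ (b j) (pbwOp b s τ (b i) (monomial M 1) - X i * monomial M 1) +
      s • pbwOp b s τ ⁅b i, b j⁆ (monomial M 1) + τ (b i) (b j) • monomial M 1 := by
  rw [pbwOp_monomial_of_lt_aux b s τ hji M h,
    pbwAux_eq_of_mem b s τ _ _ (pbwOp_sub_mem_degLE b s τ i M)]

lemma le_of_mem_support_single_add {i j : I} (hji : j ≤ i) {M : I →₀ ℕ}
    (h : ∀ k ∈ M.support, j ≤ k) : ∀ k ∈ (Finsupp.single i 1 + M).support, j ≤ k := by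
  intro k hk
  by_cases hki : k = i
  · exact hki ▸ hji
  · refine h k ?_
    simpa [Finsupp.single_apply, Ne.symm hki] using hk

/-- On monomials in variables at least `j` the element `b j` multiplies, so the defining recursion
read backwards is the commutation relation. -/
lemma pbwOp_comm_of_lt {i j : I} (hji : j < i) (M : I →₀ ℕ) (h : ∀ k ∈ M.support, j ≤ k) :
    pbwOp b s τ (b i) (pbwOp b s τ (b j) (monomial M 1)) =
      pbwOp b s τ (b j) (pbwOp b s τ (b i) (monomial M 1)) +
      s • pbwOp b s τ ⁅b i, b j⁆ (monomial M 1) + τ (b i) (b j) • monomial M 1 := by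
  rw [pbwOp_monomial_of_le b s τ j M h, X_mul_monomial, pbwOp_monomial_of_lt b s τ hji M h,
    map_sub, X_mul_monomial i M,
    pbwOp_monomial_of_le b s τ j _ (le_of_mem_support_single_add hji.le h),
    X_mul_monomial, X_mul_monomial]
  rw [add_left_comm (Finsupp.single j 1)]
  abel

variable {τ}

/-- The commutation relations of the Poincaré–Birkhoff–Witt action. -/
theorem pbwOp_comm (hτ : ∀ x, τ x x = 0)
    (hτ' : ∀ x y z, τ x ⁅y, z⁆ + τ y ⁅z, x⁆ + τ z ⁅x, y⁆ = 0) (x y : L) (f : MvPolynomial I S) :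
    pbwOp b s τ x (pbwOp b s τ y f) =
      pbwOp b s τ y (pbwOp b s τ x f) + s • pbwOp b s τ ⁅x, y⁆ f + τ x y • f := by
  have hanti : ∀ x y, τ x y = -τ y x := fun x y => by
    have := hτ (x + y)
    simp only [map_add, LinearMap.add_apply, hτ, zero_add, add_zero] at this
    exact eq_neg_of_add_eq_zero_right this
  obtain ⟨n, hf⟩ := mem_degLE f
  induction n using Nat.strong_induction_on generalizing x y f with
  | _ n ih =>
  -- the defect of the commutation relation, as a function of all three arguments
  let D : L →ₗ[K] L →ₗ[K] Module.End S (MvPolynomial I S) := LinearMap.mk₂ K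
    (fun x y => pbwOp b s τ x * pbwOp b s τ y - pbwOp b s τ y * pbwOp b s τ x -
      s • pbwOp b s τ ⁅x, y⁆ - τ x y • 1)
    (fun x x' y => by simp only [map_add, add_mul, mul_add, add_lie, smul_add, add_smul,
        LinearMap.add_apply]; abel)
    (fun c x y => by simp only [map_smul, smul_mul_assoc, mul_smul_comm, smul_lie, smul_sub,
        LinearMap.smul_apply, smul_comm s c, smul_assoc])
    (fun x y y' => by simp only [map_add, add_mul, mul_add, lie_add, smul_add, add_smul]; abel)
    (fun c x y => by simp only [map_smul, smul_mul_assoc, mul_smul_comm, lie_smul, smul_sub,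
        smul_comm s c, smul_assoc])
  have hD : ∀ x y f, D x y f = 0 ↔ pbwOp b s τ x (pbwOp b s τ y f) =
      pbwOp b s τ y (pbwOp b s τ x f) + s • pbwOp b s τ ⁅x, y⁆ f + τ x y • f := by
    intro x y f
    simp only [D, LinearMap.mk₂_apply, LinearMap.sub_apply, LinearMap.smul_apply,
      Module.End.mul_apply, Module.End.one_apply]
    rw [sub_sub, sub_sub, sub_eq_zero, add_assoc]
  have hDs : ∀ x y f, D x y f = 0 → D y x f = 0 := by
    intro x y f h
    rw [hD] at h ⊢
    rw [h, hanti y x, ← lie_skew x y, map_neg, LinearMap.neg_apply, smul_neg, neg_smul]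
    abel
  -- The defect is bilinear in the Lie algebra arguments, linear in the polynomial, and its
  -- vanishing is symmetric under swapping; so ordered pairs of basis elements and monomials
  -- suffice.
  suffices H : ∀ M : I →₀ ℕ, M.degree ≤ n → ∀ i j, j < i → D (b i) (b j) (monomial M 1) = 0 by
    rw [← hD]
    have hb : ∀ i j, D (b i) (b j) f = 0 := by
      intro i j
      have : degLE S I n ≤ LinearMap.ker (D (b i) (b j)) := by
        refine Submodule.span_le.mpr ?_
        rintro _ ⟨M, hM, rfl⟩
        rcases lt_trichotomy i j with hij | rfl | hij
        · exact hDs _ _ _ (H M hM j i hij)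
        · exact (hD _ _ _).mpr (by simp [hτ])
        · exact H M hM i j hij
      exact this hf
    have hb' : ∀ i y, D (b i) y f = 0 := fun i y => by
      simpa using linearMap_apply_mem_of_basis b (p := ⊥)
        ((LinearMap.applyₗ (R := S) f).restrictScalars K ∘ₗ D (b i)) (by simpa using hb i) y
    simpa using linearMap_apply_mem_of_basis b (p := ⊥)
        ((LinearMap.applyₗ (R := S) f).restrictScalars K ∘ₗ D.flip y)
        (by simpa using fun i => hb' i y) x
  intro M hM i j hji
  -- If `j` is at most every variable this is the recursion itself. Otherwise the least variable `k`
  -- is below `j`, and the relation for `(i, j)` is deduced from those involving `k`.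
  by_cases hjM : ∀ k ∈ M.support, j ≤ k
  · exact (hD _ _ _).mpr (pbwOp_comm_of_lt b s τ hji M hjM)
  rcases monomial_cases M with rfl | ⟨k, N, rfl, hN⟩
  · simp at hjM
  have hkj : k < j := by
    by_contra hkj
    exact hjM (le_of_mem_support_single_add (not_lt.mp hkj) fun l hl =>
      (not_lt.mp hkj).trans (hN l hl))
  rw [map_add, Finsupp.degree_single] at hM
  have hlow : ∀ {f : MvPolynomial I S}, f ∈ degLE S I N.degree → ∀ x y,
      pbwOp b s τ x (pbwOp b s τ y f) =
        pbwOp b s τ y (pbwOp b s τ x f) + s • pbwOp b s τ ⁅x, y⁆ f + τ x y • f :=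
    fun {f} hf x y => ih N.degree (by omega) x y f hf
  have hz := hlow (monomial_mem_degLE (S := S) (le_refl N.degree))
  -- the relation with the smallest variable holds on `b l • N`
  have hk : ∀ i l, k < i → k < l → pbwOp b s τ (b i) (pbwOp b s τ (b k)
      (pbwOp b s τ (b l) (monomial N 1))) = pbwOp b s τ (b k) (pbwOp b s τ (b i)
      (pbwOp b s τ (b l) (monomial N 1))) + s • pbwOp b s τ ⁅b i, b k⁆
      (pbwOp b s τ (b l) (monomial N 1)) + τ (b i) (b k) • pbwOp b s τ (b l) (monomial N 1) := by
    intro i l hki hkl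
    -- Split `b l • N` into `X_l N`, all of whose variables are at least `k`, and a part of degree
    -- at most `deg N`, covered by the induction hypothesis.
    rw [← hD, ← sub_add_cancel (pbwOp b s τ (b l) (monomial N 1)) (X l * monomial N 1), map_add,
      (hD _ _ _).mpr (hlow (pbwOp_sub_mem_degLE b s τ l N) _ _), zero_add, X_mul_monomial, hD]
    exact pbwOp_comm_of_lt b s τ hki _ (le_of_mem_support_single_add hkl.le hN)
  have hki := hkj.trans hji
  rw [hD, ← X_mul_monomial, ← pbwOp_monomial_of_le b s τ k N hN]
  have e1 := congrArg (pbwOp b s τ (b i)) (hz (b j) (b k))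
  have e2 := congrArg (pbwOp b s τ (b j)) (hz (b i) (b k))
  have e3 := congrArg (pbwOp b s τ (b k)) (hz (b i) (b j))
  simp only [map_add, map_smul] at e1 e2 e3
  rw [hk i j hki hkj] at e1
  rw [hk j i hkj hki] at e2
  rw [e1, e2, e3, hz ⁅b i, b j⁆ (b k), hz (b i) ⁅b j, b k⁆, hz (b j) ⁅b i, b k⁆]
  -- After all the commutations only the Jacobi identity for the bracket and the cocycle identity
  -- for `τ` are left.
  have jac : pbwOp b s τ ⁅b i, ⁅b j, b k⁆⁆ = pbwOp b s τ ⁅⁅b i, b j⁆, b k⁆ +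
      pbwOp b s τ ⁅b j, ⁅b i, b k⁆⁆ := by rw [leibniz_lie, map_add]
  have coc : τ (b i) ⁅b j, b k⁆ = τ ⁅b i, b j⁆ (b k) + τ (b j) ⁅b i, b k⁆ := by
    have h1 := hτ' (b i) (b j) (b k)
    rw [hanti ⁅b i, b j⁆, ← lie_skew (b i) (b k), map_neg]
    linear_combination h1
  rw [jac, coc]
  simp only [smul_add, add_smul, LinearMap.add_apply, smul_smul]
  module

variable (τ)

/-- The action is natural in the coefficients. -/
lemma map_pbwOp {S' : Type*} [CommRing S'] [Algebra K S'] (φ : S →ₐ[K] S') (x : L)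
    (f : MvPolynomial I S) :
    MvPolynomial.map (φ : S →+* S') (pbwOp b s τ x f) =
      pbwOp b (φ s) (τ.compr₂ φ.toLinearMap) x (MvPolynomial.map (φ : S →+* S') f) := by
  set τ' := τ.compr₂ φ.toLinearMap with hτ'
  have hsm : ∀ (c : S) (p : MvPolynomial I S), MvPolynomial.map (φ : S →+* S') (c • p) =
      φ c • MvPolynomial.map (φ : S →+* S') p := fun c p => by
    rw [MvPolynomial.smul_eq_C_mul, map_mul, map_C, MvPolynomial.smul_eq_C_mul]; rfl
  have h1 : ∀ M : I →₀ ℕ, MvPolynomial.map (φ : S →+* S') (monomial M 1) = monomial M 1 :=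
    fun M => by rw [map_monomial, map_one (φ : S →+* S')]
  have lin : ∀ f : MvPolynomial I S, (∀ i, MvPolynomial.map (φ : S →+* S') (pbwOp b s τ (b i) f) =
      pbwOp b (φ s) τ' (b i) (MvPolynomial.map (φ : S →+* S') f)) → ∀ x,
      MvPolynomial.map (φ : S →+* S') (pbwOp b s τ x f) =
      pbwOp b (φ s) τ' x (MvPolynomial.map (φ : S →+* S') f) := by
    intro f hf x
    let G : L →ₗ[K] MvPolynomial I S' :=
      (MvPolynomial.mapAlgHom φ).toLinearMap ∘ₗ
        (LinearMap.applyₗ (R := S) f).restrictScalars K ∘ₗ pbwOp b s τ -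
      (LinearMap.applyₗ (R := S') (MvPolynomial.map (φ : S →+* S') f)).restrictScalars K ∘ₗ
        pbwOp b (φ s) τ'
    have := linearMap_apply_mem_of_basis b (p := ⊥) G (fun i => by
      simpa [G, sub_eq_zero] using hf i) x
    simpa [G, sub_eq_zero] using this
  have span : ∀ (n : ℕ), (∀ i (M : I →₀ ℕ), M.degree ≤ n →
      MvPolynomial.map (φ : S →+* S') (pbwOp b s τ (b i) (monomial M 1)) =
      pbwOp b (φ s) τ' (b i) (MvPolynomial.map (φ : S →+* S') (monomial M 1))) →
      ∀ f ∈ degLE S I n, ∀ x, MvPolynomial.map (φ : S →+* S') (pbwOp b s τ x f) =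
      pbwOp b (φ s) τ' x (MvPolynomial.map (φ : S →+* S') f) := by
    intro n hn f hf
    refine lin f fun i => ?_
    induction hf using Submodule.span_induction with
    | mem p hp => obtain ⟨M, hM, rfl⟩ := hp; exact hn i M hM
    | zero => simp
    | add p q _ _ hp hq => simp [hp, hq]
    | smul c p _ hp => rw [map_smul, hsm, hsm, map_smul, hp]
  have key : ∀ i (M : I →₀ ℕ), MvPolynomial.map (φ : S →+* S') (pbwOp b s τ (b i) (monomial M 1)) =
      pbwOp b (φ s) τ' (b i) (MvPolynomial.map (φ : S →+* S') (monomial M 1)) := by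
    intro i M
    induction i, M using pbw_induction with
    | hle i M h =>
      rw [pbwOp_monomial_of_le b s τ i M h, h1, pbwOp_monomial_of_le b _ τ' i M h, map_mul, map_X,
        h1]
    | hlt i j N hji hN ih =>
      rw [pbwOp_monomial_of_lt b s τ hji N hN, h1, pbwOp_monomial_of_lt b _ τ' hji N hN]
      simp only [map_add, map_mul, map_X, h1, hsm]
      rw [span _ ih _ (pbwOp_sub_mem_degLE b s τ i N), span _ ih _ (monomial_mem_degLE le_rfl),
        map_sub (MvPolynomial.map (φ : S →+* S')), ih i N le_rfl, map_mul, map_X, h1]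
      rfl
  obtain ⟨n, hn⟩ := mem_degLE f
  exact span n (fun i M _ => key i M) f hn x

/-- Without bracket and central term, the action is by multiplication. -/
lemma pbwOp_zero (i : I) (f : MvPolynomial I S) :
    pbwOp b (0 : S) (0 : L →ₗ[K] L →ₗ[K] S) (b i) f = X i * f := by
  refine polynomial_induction_monomial (p := fun f => pbwOp b (0 : S) (0 : L →ₗ[K] L →ₗ[K] S)
    (b i) f = X i * f) f (fun M => ?_)
    (fun f g hf hg => by simp [hf, hg, mul_add]) (fun c f hf => by simp [hf])
  induction i, M using pbw_induction with
  | hle i M h => exact pbwOp_monomial_of_le b _ _ i M h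
  | hlt i j N hji hN ih =>
    rw [pbwOp_monomial_of_lt b _ _ hji N hN, ih i N le_rfl]
    simp

/-- If `H` is an upper set of indices that spans a subalgebra on which the central term vanishes,
the span of the monomials that involve a variable from `H` is stable. -/
lemma pbwOp_mem_meetLE {H : Set I} (hup : IsUpperSet H)
    (hbr : ∀ i ∈ H, ∀ j ∈ H, ⁅b i, b j⁆ ∈ Submodule.span K (b '' H))
    (hτ : ∀ i ∈ H, ∀ j ∈ H, τ (b i) (b j) = 0) (x : L) {n : ℕ} {f : MvPolynomial I S}
    (hf : f ∈ meetLE S H n) : pbwOp b s τ x f ∈ meetLE S H (n + 1) := by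
  have span : ∀ (n : ℕ), (∀ i (M : I →₀ ℕ), M.degree ≤ n → (∃ i ∈ M.support, i ∈ H) →
      pbwOp b s τ (b i) (monomial M 1) - X i * monomial M 1 ∈ meetLE S H M.degree) →
      ∀ f ∈ meetLE S H n, ∀ x, pbwOp b s τ x f ∈ meetLE S H (n + 1) := by
    intro n hn f hf
    refine pbwOp_mem_of_basis b s τ f fun i => ?_
    have : meetLE S H n ≤ (meetLE S H (n + 1)).comap (pbwOp b s τ (b i)) := by
      refine Submodule.span_le.mpr ?_
      rintro _ ⟨M, ⟨hM, k, hk, hkH⟩, rfl⟩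
      have h1 := meetLE_mono H (hM.trans n.le_succ) (hn i M hM ⟨k, hk, hkH⟩)
      have h2 := add_mem h1 (X_mul_mem_meetLE i (monomial_mem_meetLE hM hk hkH))
      rwa [sub_add_cancel] at h2
    exact this hf
  suffices key : ∀ i (M : I →₀ ℕ), (∃ i ∈ M.support, i ∈ H) →
      pbwOp b s τ (b i) (monomial M 1) - X i * monomial M 1 ∈ meetLE S H M.degree from
    span n (fun i M _ hM => key i M hM) f hf x
  intro i M hM
  induction i, M using pbw_induction with
  | hle i M h => rw [pbwOp_monomial_of_le b s τ i M h, sub_self]; exact zero_mem _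
  | hlt i j N hji hN ih =>
    rw [pbwOp_monomial_of_lt b s τ hji N hN, 
      map_add, Finsupp.degree_single, add_assoc, add_assoc, add_sub_cancel_left, add_comm 1]
    by_cases hNH : ∃ k ∈ N.support, k ∈ H
    · obtain ⟨k, hk, hkH⟩ := hNH
      refine add_mem (span _ ih _ (ih i N le_rfl ⟨k, hk, hkH⟩) _) (add_mem
        (Submodule.smul_mem _ _ (span _ ih _ (monomial_mem_meetLE le_rfl hk hkH) _))
        (Submodule.smul_mem _ _ (monomial_mem_meetLE (Nat.le_succ _) hk hkH)))
    -- Here the only high variable is `j`, the least one. As `H` is an upper set, every variable of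
    -- `N` would be high, so `N = 0`. The recursion then leaves only the bracket of two elements of
    -- the subalgebra applied to `1`.
    · have hjH : j ∈ H := by
        obtain ⟨k, hk, hkH⟩ := hM
        by_cases hkj : k = j
        · exact hkj ▸ hkH
        · exact absurd ⟨k, by simpa [Finsupp.single_apply, Ne.symm hkj] using hk, hkH⟩ hNH
      have hN0 : N = 0 := by
        rcases eq_or_ne N 0 with h | h
        · exact h
        · obtain ⟨k, hk⟩ := Finsupp.support_nonempty_iff.mpr h
          exact absurd ⟨k, hk, hup (hN k hk) hjH⟩ hNH
      subst hN0
      have hiH := hup hji.le hjH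
      rw [pbwOp_monomial_of_le b s τ i 0 (by simp), sub_self, map_zero (pbwOp b s τ (b j)), zero_add,
        hτ i hiH j hjH, zero_smul, add_zero]
      refine Submodule.smul_mem _ _ ?_
      have : Submodule.span K (b '' H) ≤ ((meetLE S H (Finsupp.degree (0 : I →₀ ℕ) + 1)).restrictScalars K).comap
          ((LinearMap.applyₗ (R := S) (monomial (0 : I →₀ ℕ) (1 : S))).restrictScalars K ∘ₗ pbwOp b s τ) := by
        refine Submodule.span_le.mpr ?_
        rintro _ ⟨k, hk, rfl⟩
        change pbwOp b s τ (b k) (monomial 0 1) ∈ meetLE S H _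
        rw [pbwOp_monomial_of_le b s τ k 0 (by simp), X_mul_monomial]
        exact monomial_mem_meetLE (by simp) (i := k) (by simp) hk
      exact this (hbr i hiH j hjH)

end PBW

/-! ### Rational functions regular at infinity and their values there. -/

section RegularAtInfinity

lemma kap_ne_zero : kap ≠ 0 := RatFunc.X_ne_zero

lemma intDegree_mul_le {f f' : RatFunc ℂ} {m n : ℤ} (hf : f ≠ 0 → f.intDegree ≤ m)
    (hf' : f' ≠ 0 → f'.intDegree ≤ n) (h : f * f' ≠ 0) : (f * f').intDegree ≤ m + n := by
  rw [RatFunc.intDegree_mul (left_ne_zero_of_mul h) (right_ne_zero_of_mul h)]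
  exact add_le_add (hf (left_ne_zero_of_mul h)) (hf' (right_ne_zero_of_mul h))

/-- The rational functions that are regular at infinity. -/
def regularAtInfinity : Subalgebra ℂ (RatFunc ℂ) where
  carrier := {f | f.intDegree ≤ 0}
  mul_mem' {f f'} hf hf' := by
    rcases eq_or_ne (f * f') 0 with h | h
    · simp [h]
    · exact intDegree_mul_le (fun _ => hf) (fun _ => hf') h
  add_mem' {f f'} hf hf' := by
    rcases eq_or_ne f' 0 with h | h
    · simpa [h] using hf
    rcases eq_or_ne (f + f') 0 with h' | h'
    · simp [h']
    · exact (RatFunc.intDegree_add_le h h').trans (max_le hf hf')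
  algebraMap_mem' c := by
    change (algebraMap ℂ (RatFunc ℂ) c).intDegree ≤ 0
    rw [RatFunc.algebraMap_eq_C, RatFunc.intDegree_C]

lemma mem_regularAtInfinity {f : RatFunc ℂ} : f ∈ regularAtInfinity ↔ f.intDegree ≤ 0 := Iff.rfl

lemma kap_inv_mem : kap⁻¹ ∈ regularAtInfinity := by
  simp [mem_regularAtInfinity, kap, RatFunc.intDegree_inv]

/-- The ring of regular functions has residue field `ℂ` and maximal ideal generated by `κ⁻¹`; this
is what makes the limit an algebra with scalars `ℂ`. -/
lemma exists_eq_add_kap_inv_mul {f : RatFunc ℂ} (hf : f ∈ regularAtInfinity) :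
    ∃ (c : ℂ) (f' : RatFunc ℂ), f' ∈ regularAtInfinity ∧
      f = algebraMap ℂ (RatFunc ℂ) c + kap⁻¹ * f' := by
  have key : ∀ f : RatFunc ℂ, (f ≠ 0 → f.intDegree < 0) → kap * f ∈ regularAtInfinity := by
    intro f hf
    rcases eq_or_ne f 0 with rfl | h
    · simp [zero_mem]
    · rw [mem_regularAtInfinity, RatFunc.intDegree_mul kap_ne_zero h, kap, RatFunc.intDegree_X]
      have := hf h
      omega
  suffices H : ∃ c : ℂ, f - algebraMap ℂ (RatFunc ℂ) c ≠ 0 →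
      (f - algebraMap ℂ (RatFunc ℂ) c).intDegree < 0 by
    obtain ⟨c, hc⟩ := H
    refine ⟨c, _, key _ hc, ?_⟩
    rw [inv_mul_cancel_left₀ kap_ne_zero, add_sub_cancel]
  rcases lt_or_eq_of_le (mem_regularAtInfinity.mp hf) with hlt | heq
  · exact ⟨0, fun _ => by simpa using hlt⟩
  -- In degree zero the value is a ratio of leading coefficients, and the denominator is monic.
  · refine ⟨f.num.leadingCoeff, fun hne => ?_⟩
    rw [RatFunc.intDegree, sub_eq_zero] at heq
    have hdeg : f.num.natDegree = f.denom.natDegree := by exact_mod_cast heq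
    have hd : algebraMap (Polynomial ℂ) (RatFunc ℂ) f.denom ≠ 0 := by
      simpa using f.denom_ne_zero
    set p := f.num - Polynomial.C f.num.leadingCoeff * f.denom with hp
    have hfp : f - algebraMap ℂ (RatFunc ℂ) f.num.leadingCoeff =
        algebraMap _ _ p / algebraMap _ _ f.denom := by
      rw [eq_div_iff hd, hp, sub_mul, map_sub, map_mul, RatFunc.algebraMap_C,
        RatFunc.algebraMap_eq_C]
      congr 1
      exact (eq_div_iff hd).mp (RatFunc.num_div_denom f).symm
    rw [hfp] at hne ⊢
    have hp0 : algebraMap (Polynomial ℂ) (RatFunc ℂ) p ≠ 0 := fun h => hne (by simp [h])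
    have hp0' : p ≠ 0 := fun h => hp0 (by simp [h])
    rw [RatFunc.intDegree_div hp0 hd, RatFunc.intDegree_polynomial, RatFunc.intDegree_polynomial,
      sub_neg]
    have hc0 : f.num.leadingCoeff ≠ 0 := by
      intro h
      apply hp0'
      have h0 : f.num = 0 := Polynomial.leadingCoeff_eq_zero.mp h
      rw [hp, h0]; simp
    have hdl : p.degree < f.num.degree := by
      refine Polynomial.degree_sub_lt_left ?_ (Polynomial.leadingCoeff_ne_zero.mp hc0) ?_
      · rw [Polynomial.degree_C_mul hc0, Polynomial.degree_eq_natDegree f.denom_ne_zero,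
          Polynomial.degree_eq_natDegree (Polynomial.leadingCoeff_ne_zero.mp hc0), hdeg]
      · rw [Polynomial.leadingCoeff_mul, Polynomial.leadingCoeff_C,
          (RatFunc.monic_denom f).leadingCoeff, mul_one]
    rw [← hdeg]
    exact_mod_cast Polynomial.natDegree_lt_natDegree hp0' hdl

lemma eq_zero_of_add_kap_inv_mul_eq_zero {c : ℂ} {f : RatFunc ℂ} (hf : f ∈ regularAtInfinity)
    (h : algebraMap ℂ (RatFunc ℂ) c + kap⁻¹ * f = 0) : c = 0 := by
  by_contra hc
  have h1 : f = algebraMap ℂ (RatFunc ℂ) (-c) * kap := by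
    rw [map_neg]
    field_simp [kap_ne_zero] at h
    linear_combination h
  have hc' : algebraMap ℂ (RatFunc ℂ) (-c) ≠ 0 := by simpa using hc
  rw [mem_regularAtInfinity, h1, RatFunc.intDegree_mul hc' kap_ne_zero, RatFunc.algebraMap_eq_C,
    RatFunc.intDegree_C, kap, RatFunc.intDegree_X] at hf
  omega

lemma eq_of_eq_add_kap_inv_mul {f : RatFunc ℂ} {c c' : ℂ} {f₁ f₂ : RatFunc ℂ}
    (h₁ : f₁ ∈ regularAtInfinity) (h₂ : f₂ ∈ regularAtInfinity)
    (e₁ : f = algebraMap ℂ (RatFunc ℂ) c + kap⁻¹ * f₁)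
    (e₂ : f = algebraMap ℂ (RatFunc ℂ) c' + kap⁻¹ * f₂) : c = c' := by
  rw [← sub_eq_zero]
  refine eq_zero_of_add_kap_inv_mul_eq_zero (sub_mem h₁ h₂) ?_
  rw [map_sub]
  linear_combination e₂ - e₁

/-- The value at infinity of a regular rational function, as a function. -/
def valueFun (f : regularAtInfinity) : ℂ := (exists_eq_add_kap_inv_mul f.2).choose

lemma valueFun_eq {f : regularAtInfinity} {c : ℂ} {f₁ : RatFunc ℂ} (h₁ : f₁ ∈ regularAtInfinity)
    (e₁ : (f : RatFunc ℂ) = algebraMap ℂ (RatFunc ℂ) c + kap⁻¹ * f₁) : valueFun f = c := by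
  obtain ⟨f₂, h₂, e₂⟩ := (exists_eq_add_kap_inv_mul f.2).choose_spec
  exact eq_of_eq_add_kap_inv_mul h₂ h₁ e₂ e₁

lemma valueFun_spec (f : regularAtInfinity) : ∃ f' ∈ regularAtInfinity,
    (f : RatFunc ℂ) = algebraMap ℂ (RatFunc ℂ) (valueFun f) + kap⁻¹ * f' :=
  (exists_eq_add_kap_inv_mul f.2).choose_spec

/-- The value at infinity of a regular rational function. -/
def valueAtInfinity : regularAtInfinity →ₐ[ℂ] ℂ where
  toFun := valueFun
  map_one' := valueFun_eq (zero_mem _) (by simp)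
  map_mul' x y := by
    obtain ⟨x', hx', hx⟩ := valueFun_spec x
    obtain ⟨y', hy', hy⟩ := valueFun_spec y
    refine valueFun_eq (f₁ := algebraMap ℂ (RatFunc ℂ) (valueFun x) * y' +
      x' * algebraMap ℂ (RatFunc ℂ) (valueFun y) + kap⁻¹ * x' * y') ?_ ?_
    · exact add_mem (add_mem (mul_mem (algebraMap_mem _ _) hy')
        (mul_mem hx' (algebraMap_mem _ _))) (mul_mem (mul_mem kap_inv_mem hx') hy')
    · rw [map_mul]
      change (x : RatFunc ℂ) * y = _
      rw [hx, hy]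
      ring
  map_zero' := valueFun_eq (zero_mem _) (by simp)
  map_add' x y := by
    obtain ⟨x', hx', hx⟩ := valueFun_spec x
    obtain ⟨y', hy', hy⟩ := valueFun_spec y
    refine valueFun_eq (add_mem hx' hy') ?_
    rw [map_add]
    change (x : RatFunc ℂ) + y = _
    rw [hx, hy]
    ring
  commutes' t := valueFun_eq (zero_mem _) (by simp)

/-- The element `κ⁻¹` of the ring of functions regular at infinity. -/
def hbar : regularAtInfinity := ⟨kap⁻¹, kap_inv_mem⟩

lemma valueAtInfinity_hbar : valueAtInfinity hbar = 0 :=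
  valueFun_eq (one_mem _) (by simp [hbar])

end RegularAtInfinity

/-! ### The loop algebra and its residue cocycle. -/

section Loop

open LieAlgebra

variable {g : Type*} [LieRing g] [LieAlgebra ℂ g] (B : LinearMap.BilinForm ℂ g)

/-- The element `a ⊗ z ^ m` of the loop algebra. -/
def loopElt (a : g) (m : ℤ) : loopAlgebra ℂ ℤ g := AddMonoidAlgebra.single m (1 : ℂ) ⊗ₜ a

lemma loopElt_add (a b : g) (m : ℤ) : loopElt (a + b) m = loopElt a m + loopElt b m :=
  TensorProduct.tmul_add _ _ _

lemma loopElt_smul (c : ℂ) (a : g) (m : ℤ) : loopElt (c • a) m = c • loopElt a m :=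
  TensorProduct.tmul_smul _ _ _

lemma loopElt_lie (a b : g) (m n : ℤ) : ⁅loopElt a m, loopElt b n⁆ = loopElt ⁅a, b⁆ (m + n) := by
  rw [loopElt, loopElt, ExtendScalars.bracket_tmul, AddMonoidAlgebra.single_mul_single, mul_one,
    loopElt]

/-- The residue cocycle of the loop algebra. -/
def loopCocycle : loopAlgebra ℂ ℤ g →ₗ[ℂ] loopAlgebra ℂ ℤ g →ₗ[ℂ] ℂ :=
  LinearMap.flip (LoopAlgebra.residuePairing ℂ ℤ g B)

/-- The flip in the definition moves the degree factor from the second argument of the residue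
pairing to the first, matching the sign in the mode relations. -/
lemma loopCocycle_loopElt (hB : B.IsSymm) (a b : g) (m n : ℤ) :
    loopCocycle B (loopElt a m) (loopElt b n) = if m + n = 0 then m * B a b else 0 := by
  rw [loopCocycle, LinearMap.flip_apply, loopElt, loopElt]
  simp only [LoopAlgebra.residuePairing_apply_apply, LoopAlgebra.toFinsupp_single_tmul]
  rw [Finsupp.sum_single_index (by simp), Finsupp.single_apply]
  split_ifs with h1 h2 h2
  · rw [hB.eq, zsmul_eq_mul]
  · omega
  · omega
  · simp

lemma loopCocycle_self (hB : B.IsSymm) (x : loopAlgebra ℂ ℤ g) : loopCocycle B x x = 0 := by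
  exact (LoopAlgebra.twoCochainOfBilinear ℂ ℤ g B hB).2 x

lemma loopCocycle_lie (hB : B.IsSymm) (hB' : B.lieInvariant g) (x y z : loopAlgebra ℂ ℤ g) :
    loopCocycle B x ⁅y, z⁆ + loopCocycle B y ⁅z, x⁆ + loopCocycle B z ⁅x, y⁆ = 0 := by
  have h : ∀ x y z, LoopAlgebra.residuePairing ℂ ℤ g B x ⁅y, z⁆ =
      LoopAlgebra.residuePairing ℂ ℤ g B ⁅x, y⁆ z + LoopAlgebra.residuePairing ℂ ℤ g B y ⁅x, z⁆ :=
    (LieModule.Cohomology.mem_twoCocycle_iff_of_trivial _ _ _ _).mp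
      (LoopAlgebra.twoCocycleOfBilinear ℂ ℤ g B hB' hB).2
  have hs : ∀ x y, loopCocycle B x y = - LoopAlgebra.residuePairing ℂ ℤ g B x y := fun x y => by
    have := loopCocycle_self B hB (x + y)
    simp only [map_add, LinearMap.add_apply, loopCocycle_self B hB, zero_add, add_zero] at this
    exact eq_neg_of_add_eq_zero_right this
  have h2 : LoopAlgebra.residuePairing ℂ ℤ g B ⁅x, y⁆ z =
      - LoopAlgebra.residuePairing ℂ ℤ g B z ⁅x, y⁆ := hs z ⁅x, y⁆
  rw [hs, hs, hs, h x y z, h2, ← lie_skew x z, map_neg]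
  ring

/-- The basis `v i ⊗ z ^ m` of the loop algebra. -/
def loopBasis {ι : Type*} (v : Module.Basis ι ℂ g) :
    Module.Basis (ℤ ×ₗ ι) ℂ (loopAlgebra ℂ ℤ g) :=
  ((AddMonoidAlgebra.basis ℤ ℂ).tensorProduct v).reindex toLex

lemma loopBasis_apply {ι : Type*} (v : Module.Basis ι ℂ g) (m : ℤ) (i : ι) :
    loopBasis v (toLex (m, i)) = loopElt (v i) m := by
  simp [loopBasis, loopElt]

end Loop

/-! ### Generation of the mode algebra by its modes. -/

section ModeInduction

variable {S : Type*} [CommRing S] [Algebra ℂ S] {σ : Type*}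
  {g : Type*} [LieRing g] [LieAlgebra ℂ g] {B : LinearMap.BilinForm ℂ g} {k : σ → S}

lemma ModeAlgebra.lift_mode {C : Type*} [Ring C] [Algebra S C]
    (f : FreeAlgebra S (σ × g × ℤ) →ₐ[S] C) (hf : ∀ x y, ModeRel S B k x y → f x = f y)
    (s : σ) (a : g) (n : ℤ) :
    ModeAlgebra.lift f hf (mode S B k s a n) = f (FreeAlgebra.ι S (s, a, n)) :=
  RingQuot.liftAlgHom_mkAlgHom_apply (S := S) f hf _

lemma ModeAlgebra.lift_inclOne_mode (a : g) (n : ℤ) :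
    inclOne B (modeOne B a n) = ⟨modeY B a n, modeY_mem B a n⟩ := by
  rw [inclOne, modeOne, ModeAlgebra.lift_mode, FreeAlgebra.lift_ι_apply]

/-- Subalgebras of the mode algebra that contain the modes are everything. -/
lemma mode_induction (P : Subalgebra S (ModeAlgebra S B k)) (h : ∀ s a n, mode S B k s a n ∈ P)
    (u : ModeAlgebra S B k) : u ∈ P := by
  obtain ⟨x, rfl⟩ := RingQuot.mkAlgHom_surjective S (ModeRel S B k) u
  induction x using FreeAlgebra.induction with
  | grade0 r => rw [AlgHom.commutes]; exact P.algebraMap_mem r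
  | grade1 x => exact h x.1 x.2.1 x.2.2
  | mul x y hx hy => rw [map_mul]; exact P.mul_mem hx hy
  | add x y hx hy => rw [map_add]; exact P.add_mem hx hy

lemma mode_mul_of_ne {s t : σ} (hst : s ≠ t) (a b : g) (m n : ℤ) :
    mode S B k s a m * mode S B k t b n = mode S B k t b n * mode S B k s a m := by
  have h := ModeAlgebra.proj_rel (ModeRel.comm_of_ne (B := B) (k := k) s t hst a b m n)
  rwa [map_mul, map_mul] at h

end ModeInduction

/-! ### The lattice representation and its specialisation at a connection. -/

section Representation

open TensorProduct MvPolynomial LieAlgebra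

variable {g : Type*} [LieRing g] [LieAlgebra ℂ g] (B : LinearMap.BilinForm ℂ g)
  {ι : Type*} [LinearOrder ι] (v : Module.Basis ι ℂ g)
  (Q : Type*) [AddCommGroup Q] [Module ℂ Q] [Module (LevelOne B) Q] [IsScalarTower ℂ (LevelOne B) Q]

/-- The central term `(κ⁻¹ - κ⁻²) m δ ⟨a, b⟩` of the rescaled modes of level `κ - 1`. -/
def scaledCocycle : loopAlgebra ℂ ℤ g →ₗ[ℂ] loopAlgebra ℂ ℤ g →ₗ[ℂ] regularAtInfinity :=
  (loopCocycle B).compr₂ (LinearMap.toSpanSingleton ℂ regularAtInfinity (hbar - hbar ^ 2))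

/-- The action of the rescaled modes on the integral form. -/
def latticeOp : loopAlgebra ℂ ℤ g →ₗ[ℂ]
    Module.End regularAtInfinity (MvPolynomial (ℤ ×ₗ ι) regularAtInfinity) :=
  pbwOp (loopBasis v) hbar (scaledCocycle B)

/-- The action of the rescaled modes over the field of rational functions. -/
def genericOp : loopAlgebra ℂ ℤ g →ₗ[ℂ]
    Module.End (RatFunc ℂ) (MvPolynomial (ℤ ×ₗ ι) (RatFunc ℂ)) :=
  pbwOp (loopBasis v) (regularAtInfinity.val hbar)
    ((scaledCocycle B).compr₂ regularAtInfinity.val.toLinearMap)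

/-- The inclusion of the integral form. -/
def latticeIncl : MvPolynomial (ℤ ×ₗ ι) regularAtInfinity →ₐ[ℂ] MvPolynomial (ℤ ×ₗ ι) (RatFunc ℂ) :=
  mapAlgHom regularAtInfinity.val

/-- Naturality of the action under the inclusion of coefficients: the polynomials with regular
coefficients form a lattice stable under the rescaled modes. -/
lemma latticeIncl_latticeOp (x : loopAlgebra ℂ ℤ g)
    (f : MvPolynomial (ℤ ×ₗ ι) regularAtInfinity) :
    latticeIncl (latticeOp B v x f) = genericOp B v x (latticeIncl f) :=
  map_pbwOp (loopBasis v) hbar (scaledCocycle B) regularAtInfinity.val x f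

lemma scaledCocycle_loopElt (hB : B.IsSymm) (a b : g) (m n : ℤ) :
    ((scaledCocycle B).compr₂ regularAtInfinity.val.toLinearMap) (loopElt a m) (loopElt b n) =
      if m + n = 0 then algebraMap ℂ (RatFunc ℂ) (m * B a b) * (kap⁻¹ - kap⁻¹ ^ 2) else 0 := by
  rw [LinearMap.compr₂_apply, scaledCocycle, LinearMap.compr₂_apply, loopCocycle_loopElt B hB,
    LinearMap.toSpanSingleton_apply]
  split_ifs
  · rw [map_smul, Algebra.smul_def]
    rfl
  · simp

lemma genericOp_comm (hB : B.IsSymm) (hB' : B.lieInvariant g) (a b : g) (m n : ℤ)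
    (f : MvPolynomial (ℤ ×ₗ ι) (RatFunc ℂ)) :
    genericOp B v (loopElt a m) (genericOp B v (loopElt b n) f) =
      genericOp B v (loopElt b n) (genericOp B v (loopElt a m) f) +
      kap⁻¹ • genericOp B v (loopElt ⁅a, b⁆ (m + n)) f +
      (if m + n = 0 then algebraMap ℂ (RatFunc ℂ) (m * B a b) * (kap⁻¹ - kap⁻¹ ^ 2) else 0) • f := by
  rw [← scaledCocycle_loopElt B hB, ← loopElt_lie]
  refine pbwOp_comm (loopBasis v) _ (fun x => ?_) (fun x y z => ?_) _ _ f
  · simp [scaledCocycle, loopCocycle_self B hB]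
  · simp only [scaledCocycle, LinearMap.compr₂_apply, ← map_add, loopCocycle_lie B hB hB', map_zero]

/-- The action of a mode of the product on polynomials with coefficients in a module of level one. -/
def genericModeOp (s : Fin 2) (a : g) (n : ℤ) :
    Module.End (RatFunc ℂ) (MvPolynomial (ℤ ×ₗ ι) (RatFunc ℂ) ⊗[ℂ] Q) :=
  if s = 0 then kap • AlgebraTensorModule.map (genericOp B v (loopElt a n)) LinearMap.id
  else AlgebraTensorModule.map LinearMap.id (Algebra.lsmul ℂ ℂ Q (modeOne B a n))

lemma genericModeOp_zero_tmul (a : g) (n : ℤ) (f : MvPolynomial (ℤ ×ₗ ι) (RatFunc ℂ)) (q : Q) :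
    genericModeOp B v Q 0 a n (f ⊗ₜ q) = kap • (genericOp B v (loopElt a n) f ⊗ₜ[ℂ] q) := by
  simp [genericModeOp]

lemma genericModeOp_one_tmul (a : g) (n : ℤ) (f : MvPolynomial (ℤ ×ₗ ι) (RatFunc ℂ)) (q : Q) :
    genericModeOp B v Q 1 a n (f ⊗ₜ q) = f ⊗ₜ[ℂ] (modeOne B a n • q) := by
  simp [genericModeOp]

/-- Only additivity is required, so that maps which are linear over different rings can be compared
on pure tensors. -/
lemma ext_tmul {M N P : Type*} [AddCommGroup M] [AddCommGroup N] [AddCommGroup P]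
    [Module ℂ M] [Module ℂ N] {φ ψ : M ⊗[ℂ] N → P} (hφ : ∀ x y, φ (x + y) = φ x + φ y)
    (hψ : ∀ x y, ψ (x + y) = ψ x + ψ y) (h : ∀ m n, φ (m ⊗ₜ n) = ψ (m ⊗ₜ n)) (x : M ⊗[ℂ] N) :
    φ x = ψ x := by
  induction x with
  | zero => rw [← TensorProduct.tmul_zero N (0 : M), h]
  | tmul m n => exact h m n
  | add x y hx hy => rw [hφ, hψ, hx, hy]

/-- The action of the product algebra on polynomials with coefficients in a module of level one. -/
def genericRep (hB : B.IsSymm) (hB' : B.lieInvariant g) : Generic B →ₐ[RatFunc ℂ]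
    Module.End (RatFunc ℂ) (MvPolynomial (ℤ ×ₗ ι) (RatFunc ℂ) ⊗[ℂ] Q) :=
  ModeAlgebra.lift (FreeAlgebra.lift (RatFunc ℂ) fun p => genericModeOp B v Q p.1 p.2.1 p.2.2) <| by
    intro x y h
    refine LinearMap.ext fun z => ?_
    refine ext_tmul (map_add _) (map_add _) (fun f q => ?_) z
    induction h with
    | add s a b n =>
      simp only [map_add, FreeAlgebra.lift_ι_apply, LinearMap.add_apply]
      fin_cases s
      · simp only [Fin.zero_eta, genericModeOp_zero_tmul, loopElt_add, map_add, LinearMap.add_apply,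
          add_tmul, smul_add]
      · simp only [Fin.mk_one, genericModeOp_one_tmul, modeOne, mode_add, add_smul, tmul_add]
    | smul s c a n =>
      simp only [map_smul, FreeAlgebra.lift_ι_apply, LinearMap.smul_apply]
      fin_cases s
      · simp only [Fin.zero_eta, genericModeOp_zero_tmul, loopElt_smul, map_smul,
          LinearMap.smul_apply, algebraMap_smul]
        rw [← smul_tmul', smul_comm]
      · simp only [Fin.mk_one, genericModeOp_one_tmul, modeOne, mode_smul, Algebra.algebraMap_self,
          RingHom.id_apply, smul_assoc, algebraMap_smul, tmul_smul]
    | comm s a b m n =>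
      simp only [map_add, map_mul, FreeAlgebra.lift_ι_apply, LinearMap.add_apply,
        Module.End.mul_apply, AlgHom.commutes, Module.algebraMap_end_apply]
      fin_cases s
      · simp only [Fin.zero_eta, genericModeOp_zero_tmul, map_smul]
        -- Undoing the rescaling multiplies by `κ²`: the bracket keeps `κ² κ⁻¹ = κ`, which is one
        -- mode, and the central term becomes `κ² (κ⁻¹ - κ⁻²) = κ - 1`.
        rw [genericOp_comm B v hB hB', add_tmul, add_tmul, ← smul_tmul', ← smul_tmul']
        simp only [smul_add, smul_smul]
        rw [mul_inv_cancel₀ kap_ne_zero, mul_one]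
        congr 2
        split_ifs
        · rw [map_mul, Matrix.cons_val_zero]
          field_simp [kap_ne_zero]
        · simp
      · simp only [Fin.mk_one, genericModeOp_one_tmul]
        rw [← mul_smul, modeOne, modeOne, mode_mul, add_smul, add_smul, tmul_add, tmul_add,
          mul_smul, algebraMap_smul (R := ℂ) (LevelOne B), tmul_smul (R := ℂ) (R' := ℂ),
          ← algebraMap_smul (R := ℂ) (RatFunc ℂ)]
        congr 2
        split_ifs <;> simp
    | comm_of_ne s t hst a b m n =>
      simp only [map_mul, FreeAlgebra.lift_ι_apply, Module.End.mul_apply]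
      fin_cases s <;> fin_cases t
      · exact absurd rfl hst
      · simp only [Fin.zero_eta, Fin.mk_one, genericModeOp_one_tmul, genericModeOp_zero_tmul,
          map_smul]
      · simp only [Fin.zero_eta, Fin.mk_one, genericModeOp_one_tmul, genericModeOp_zero_tmul,
          map_smul]
      · exact absurd rfl hst

variable (hB : B.IsSymm) (hB' : B.lieInvariant g)

lemma genericRep_modeX (a : g) (n : ℤ) (f : MvPolynomial (ℤ ×ₗ ι) (RatFunc ℂ)) (q : Q) :
    genericRep B v Q hB hB' (modeX B a n) (f ⊗ₜ q) =
      kap • (genericOp B v (loopElt a n) f ⊗ₜ[ℂ] q) := by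
  rw [genericRep, modeX, ModeAlgebra.lift_mode, FreeAlgebra.lift_ι_apply, genericModeOp_zero_tmul]

lemma genericRep_modeY (a : g) (n : ℤ) (f : MvPolynomial (ℤ ×ₗ ι) (RatFunc ℂ)) (q : Q) :
    genericRep B v Q hB hB' (modeY B a n) (f ⊗ₜ q) = f ⊗ₜ[ℂ] (modeOne B a n • q) := by
  rw [genericRep, modeY, ModeAlgebra.lift_mode, FreeAlgebra.lift_ι_apply, genericModeOp_one_tmul]

/-- The inclusion of the integral form of the module. -/
def latticeInclQ : MvPolynomial (ℤ ×ₗ ι) regularAtInfinity ⊗[ℂ] Q →ₗ[ℂ]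
    MvPolynomial (ℤ ×ₗ ι) (RatFunc ℂ) ⊗[ℂ] Q :=
  LinearMap.rTensor Q latticeIncl.toLinearMap

lemma latticeInclQ_injective : Function.Injective (latticeInclQ (ι := ι) Q) := by
  refine Module.Flat.rTensor_preserves_injective_linearMap _ ?_
  exact MvPolynomial.map_injective _ Subtype.val_injective

variable (A : Connection g)

/-- The coordinates of a connection in the basis `v`. -/
def connCoord (p : ℤ ×ₗ ι) : ℂ := B (A.1 (ofLex p).1) (v (ofLex p).2)

/-- The value at `κ = ∞` and at the connection `d + A`. -/
def fibreEval : MvPolynomial (ℤ ×ₗ ι) regularAtInfinity →ₐ[ℂ] ℂ :=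
  (MvPolynomial.aeval (connCoord B v A)).comp (mapAlgHom valueAtInfinity)

/-- At infinity both the bracket scale and the cocycle vanish, so a basis mode multiplies by its
variable, and the variable evaluates to the coordinate of `A`. -/
lemma fibreEval_latticeOp (a : g) (n : ℤ) (f : MvPolynomial (ℤ ×ₗ ι) regularAtInfinity) :
    fibreEval B v A (latticeOp B v (loopElt a n) f) = B (A.1 n) a * fibreEval B v A f := by
  have h0 : (scaledCocycle B).compr₂ valueAtInfinity.toLinearMap = 0 := by
    ext x y
    simp [scaledCocycle, valueAtInfinity_hbar]
  have h1 : ∀ x, mapAlgHom valueAtInfinity (latticeOp B v x f) =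
      pbwOp (loopBasis v) 0 0 x (mapAlgHom valueAtInfinity f) := by
    intro x
    have := map_pbwOp (loopBasis v) hbar (scaledCocycle B) valueAtInfinity x f
    rw [h0, valueAtInfinity_hbar] at this
    exact this
  let G : g →ₗ[ℂ] ℂ :=
    { toFun := fun a => fibreEval B v A (latticeOp B v (loopElt a n) f)
      map_add' := fun a b => by simp [loopElt_add]
      map_smul' := fun c a => by simp [loopElt_smul] }
  let G' : g →ₗ[ℂ] ℂ := (fibreEval B v A f) • B (A.1 n)
  have : G = G' := by
    refine v.ext fun i => ?_
    change fibreEval B v A (latticeOp B v (loopElt (v i) n) f) = fibreEval B v A f * B (A.1 n) (v i)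
    rw [fibreEval, AlgHom.comp_apply, h1, ← loopBasis_apply, pbwOp_zero, map_mul, aeval_X,
      mul_comm]
    rfl
  have := LinearMap.congr_fun this a
  rw [mul_comm]
  exact this

/-- The value at `κ = ∞` and at the connection `d + A`, with coefficients. -/
def fibreEvalQ : MvPolynomial (ℤ ×ₗ ι) regularAtInfinity ⊗[ℂ] Q →ₗ[ℂ] Q :=
  (TensorProduct.lid ℂ Q).toLinearMap ∘ₗ LinearMap.rTensor Q (fibreEval B v A).toLinearMap

lemma fibreEvalQ_tmul (f : MvPolynomial (ℤ ×ₗ ι) regularAtInfinity) (q : Q) :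
    fibreEvalQ B v Q A (f ⊗ₜ q) = fibreEval B v A f • q := by
  simp [fibreEvalQ]

lemma latticeInclQ_tmul (f : MvPolynomial (ℤ ×ₗ ι) regularAtInfinity) (q : Q) :
    latticeInclQ Q (f ⊗ₜ q) = latticeIncl f ⊗ₜ q := by
  simp [latticeInclQ]

/-- The graph of the fibre of the action: pairs of an element that preserves the integral form and
the operator that it induces on the fibre. -/
def fibreGraph : Subalgebra ℂ (Generic B × Module.End ℂ Q) where
  carrier := {p | ∀ y, ∃ y', genericRep B v Q hB hB' p.1 (latticeInclQ Q y) = latticeInclQ Q y' ∧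
    fibreEvalQ B v Q A y' = p.2 (fibreEvalQ B v Q A y)}
  mul_mem' {p p'} hp hp' y := by
    obtain ⟨y₁, h₁, h₁'⟩ := hp' y
    obtain ⟨y₂, h₂, h₂'⟩ := hp y₁
    refine ⟨y₂, ?_, ?_⟩
    · rw [Prod.fst_mul, map_mul, Module.End.mul_apply, h₁, h₂]
    · rw [h₂', h₁', Prod.snd_mul, Module.End.mul_apply]
  add_mem' {p p'} hp hp' y := by
    obtain ⟨y₁, h₁, h₁'⟩ := hp y
    obtain ⟨y₂, h₂, h₂'⟩ := hp' y
    refine ⟨y₁ + y₂, ?_, ?_⟩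
    · rw [Prod.fst_add, map_add, LinearMap.add_apply, h₁, h₂, map_add]
    · rw [map_add, h₁', h₂', Prod.snd_add, LinearMap.add_apply]
  algebraMap_mem' c y := by
    refine ⟨c • y, ?_, ?_⟩
    · rw [map_smul]
      change genericRep B v Q hB hB' (algebraMap ℂ (Generic B) c) _ = _
      rw [IsScalarTower.algebraMap_apply ℂ (RatFunc ℂ) (Generic B), AlgHom.commutes,
        Module.algebraMap_end_apply, algebraMap_smul]
    · rw [map_smul]
      rfl

lemma mem_fibreGraph_of_tmul {u : Generic B} {χ : Module.End ℂ Q}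
    (h : ∀ f q, ∃ y', genericRep B v Q hB hB' u (latticeIncl f ⊗ₜ q) = latticeInclQ Q y' ∧
      fibreEvalQ B v Q A y' = χ (fibreEval B v A f • q)) :
    (u, χ) ∈ fibreGraph B v Q hB hB' A := by
  intro y
  induction y with
  | zero => exact ⟨0, by simp, by simp⟩
  | tmul f q =>
    rw [latticeInclQ_tmul, fibreEvalQ_tmul]
    exact h f q
  | add x y hx hy =>
    obtain ⟨y₁, h₁, h₁'⟩ := hx
    obtain ⟨y₂, h₂, h₂'⟩ := hy
    exact ⟨y₁ + y₂, by rw [map_add, map_add, h₁, h₂, map_add], by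
      rw [map_add, h₁', h₂', map_add, map_add]⟩

lemma modeX_mem_fibreGraph (a : g) (n : ℤ) :
    (kap⁻¹ • modeX B a n, B (A.1 n) a • 1) ∈ fibreGraph B v Q hB hB' A := by
  refine mem_fibreGraph_of_tmul B v Q hB hB' A fun f q =>
    ⟨latticeOp B v (loopElt a n) f ⊗ₜ q, ?_, ?_⟩
  · rw [map_smul, LinearMap.smul_apply, genericRep_modeX, smul_smul, inv_mul_cancel₀ kap_ne_zero,
      one_smul, latticeInclQ_tmul, latticeIncl_latticeOp]
  · rw [fibreEvalQ_tmul, fibreEval_latticeOp, mul_smul]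
    rfl

lemma modeY_mem_fibreGraph (a : g) (n : ℤ) :
    (modeY B a n, Algebra.lsmul ℂ ℂ Q (modeOne B a n)) ∈ fibreGraph B v Q hB hB' A := by
  refine mem_fibreGraph_of_tmul B v Q hB hB' A fun f q => ⟨f ⊗ₜ (modeOne B a n • q), ?_, ?_⟩
  · rw [genericRep_modeY, latticeInclQ_tmul]
  · rw [fibreEvalQ_tmul, map_smul]
    rfl

lemma algebraMap_mem_fibreGraph (f : regularAtInfinity) :
    (algebraMap (RatFunc ℂ) (Generic B) f, valueAtInfinity f • 1) ∈ fibreGraph B v Q hB hB' A := by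
  refine mem_fibreGraph_of_tmul B v Q hB hB' A fun p q => ⟨(f • p) ⊗ₜ q, ?_, ?_⟩
  · rw [AlgHom.commutes, Module.algebraMap_end_apply, latticeInclQ_tmul, smul_tmul',
      MvPolynomial.smul_eq_C_mul, MvPolynomial.smul_eq_C_mul, map_mul]
    simp [latticeIncl]
  · have hC : fibreEval B v A (C f) = valueAtInfinity f := by simp [fibreEval]
    rw [fibreEvalQ_tmul, MvPolynomial.smul_eq_C_mul, map_mul, mul_smul, hC]
    rfl

/-- The vectors `1 ⊗ q` evaluate to every `q`, and their images under the action have a unique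
preimage in the lattice. The graph is therefore that of a function. -/
lemma fibreGraph_unique {u : Generic B} {χ χ' : Module.End ℂ Q}
    (h : (u, χ) ∈ fibreGraph B v Q hB hB' A) (h' : (u, χ') ∈ fibreGraph B v Q hB hB' A) :
    χ = χ' := by
  refine LinearMap.ext fun q => ?_
  obtain ⟨y, hy, e⟩ := h (1 ⊗ₜ q)
  obtain ⟨y', hy', e'⟩ := h' (1 ⊗ₜ q)
  rw [fibreEvalQ_tmul, map_one, one_smul] at e e'
  rw [← e, ← e', latticeInclQ_injective Q (hy.symm.trans hy')]

/-- The graph is a subalgebra, so its projection contains the integral form as soon as it contains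
the three kinds of generators. -/
lemma exists_mem_fibreGraph (u : intForm B) : ∃ χ, ((u : Generic B), χ) ∈ fibreGraph B v Q hB hB' A := by
  suffices H : intForm B ≤ (fibreGraph B v Q hB hB' A).map (AlgHom.fst ℂ _ _) by
    obtain ⟨p, hp, e⟩ := H u.2
    exact ⟨p.2, by rw [← e]; exact hp⟩
  refine Algebra.adjoin_le ?_
  rintro _ ((⟨f, hf, rfl⟩ | ⟨a, n, rfl⟩) | ⟨a, n, rfl⟩)
  · exact ⟨_, algebraMap_mem_fibreGraph B v Q hB hB' A ⟨f, hf⟩, rfl⟩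
  · exact ⟨_, modeX_mem_fibreGraph B v Q hB hB' A a n, rfl⟩
  · exact ⟨_, modeY_mem_fibreGraph B v Q hB hB' A a n, rfl⟩

/-- The action of the integral form on the fibre at `d + A`. -/
def fibreHom : intForm B →ₐ[ℂ] Module.End ℂ Q := AlgHom.ofLinearMap
  { toFun := fun u => (exists_mem_fibreGraph B v Q hB hB' A u).choose
    map_add' := fun u u' => fibreGraph_unique B v Q hB hB' A
      (exists_mem_fibreGraph B v Q hB hB' A (u + u')).choose_spec
      (add_mem (exists_mem_fibreGraph B v Q hB hB' A u).choose_spec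
        (exists_mem_fibreGraph B v Q hB hB' A u').choose_spec)
    map_smul' := fun c u => fibreGraph_unique B v Q hB hB' A
      (exists_mem_fibreGraph B v Q hB hB' A (c • u)).choose_spec
      (Subalgebra.smul_mem _ (exists_mem_fibreGraph B v Q hB hB' A u).choose_spec c) }
  (fibreGraph_unique B v Q hB hB' A (exists_mem_fibreGraph B v Q hB hB' A 1).choose_spec
    (one_mem _))
  (fun u u' => fibreGraph_unique B v Q hB hB' A
    (exists_mem_fibreGraph B v Q hB hB' A (u * u')).choose_spec
    (mul_mem (exists_mem_fibreGraph B v Q hB hB' A u).choose_spec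
      (exists_mem_fibreGraph B v Q hB hB' A u').choose_spec))

lemma fibreHom_mem (u : intForm B) :
    ((u : Generic B), fibreHom B v Q hB hB' A u) ∈ fibreGraph B v Q hB hB' A :=
  (exists_mem_fibreGraph B v Q hB hB' A u).choose_spec

lemma fibreHom_eq {u : intForm B} {χ : Module.End ℂ Q}
    (h : ((u : Generic B), χ) ∈ fibreGraph B v Q hB hB' A) : fibreHom B v Q hB hB' A u = χ :=
  fibreGraph_unique B v Q hB hB' A (fibreHom_mem B v Q hB hB' A u) h

lemma fibreHom_kapInv : fibreHom B v Q hB hB' A (kapInv B) = 0 := by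
  refine fibreHom_eq B v Q hB hB' A ?_
  have := algebraMap_mem_fibreGraph B v Q hB hB' A hbar
  rw [valueAtInfinity_hbar, zero_smul] at this
  exact this

lemma fibreHom_inclOne (u : LevelOne B) (q : Q) :
    fibreHom B v Q hB hB' A (inclOne B u) q = u • q := by
  let P : Subalgebra ℂ (LevelOne B) := AlgHom.equalizer
    ((fibreHom B v Q hB hB' A).comp (inclOne B)) (Algebra.lsmul ℂ ℂ Q)
  have : u ∈ P := mode_induction P (fun s a n => by
    change fibreHom B v Q hB hB' A (inclOne B (modeOne B a n)) = _
    rw [ModeAlgebra.lift_inclOne_mode]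
    exact fibreHom_eq B v Q hB hB' A (modeY_mem_fibreGraph B v Q hB hB' A a n)) u
  exact LinearMap.congr_fun this q

/-- The rescaled diagonal mode differs from the rescaled first mode by `κ⁻¹` times a level one mode,
which acts as zero on the fibre. -/
lemma fibreHom_scaledDiag (a : g) (n : ℤ) :
    fibreHom B v Q hB hB' A (scaledDiag B a n) = B (A.1 n) a • 1 := by
  refine fibreHom_eq B v Q hB hB' A ?_
  have h1 := modeX_mem_fibreGraph B v Q hB hB' A a n
  have h2 := mul_mem (algebraMap_mem_fibreGraph B v Q hB hB' A hbar)
    (modeY_mem_fibreGraph B v Q hB hB' A a n)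
  have h3 := add_mem h1 h2
  rw [valueAtInfinity_hbar, zero_smul, Prod.mk_mul_mk, zero_mul, Prod.mk_add_mk, add_zero,
    ← Algebra.smul_def] at h3
  change (kap⁻¹ • modeDiag B a n, _) ∈ _
  rw [modeDiag, smul_add]
  exact h3

/-! ### The left ideal of high modes in the lattice representation. -/

open Classical in
/-- Setting the variables from `H` to zero. -/
def killVars {I : Type*} (S : Type*) [CommRing S] (H : Set I) :
    MvPolynomial I S →ₐ[S] MvPolynomial I S :=
  aeval fun i => if i ∈ H then 0 else X i

lemma killVars_of_mem_meetLE {I S : Type*} [CommRing S] {H : Set I} {n : ℕ} {f : MvPolynomial I S}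
    (hf : f ∈ meetLE S H n) : killVars S H f = 0 := by
  have : meetLE S H n ≤ LinearMap.ker (killVars S H).toLinearMap := by
    refine Submodule.span_le.mpr ?_
    rintro _ ⟨M, ⟨-, i, hi, hiH⟩, rfl⟩
    change killVars S H (monomial M 1) = 0
    rw [killVars, aeval_monomial, Finsupp.prod, Finset.prod_eq_zero hi, mul_zero]
    rw [if_pos hiH, zero_pow (Finsupp.mem_support_iff.mp hi)]
  exact this hf

lemma latticeIncl_killVars (H : Set (ℤ ×ₗ ι)) (f : MvPolynomial (ℤ ×ₗ ι) regularAtInfinity) :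
    latticeIncl (killVars regularAtInfinity H f) = killVars (RatFunc ℂ) H (latticeIncl f) := by
  induction f using MvPolynomial.induction_on with
  | C c => simp [latticeIncl, killVars, algebraMap_eq]
  | add f f' hf hf' => rw [map_add, map_add, hf, hf', map_add, map_add]
  | mul_X f i hf =>
    rw [map_mul, map_mul, hf, map_mul, map_mul]
    congr 1
    by_cases hi : i ∈ H <;> simp [latticeIncl, killVars, hi]

lemma fibreEval_killVars {H : Set (ℤ ×ₗ ι)} (hH : ∀ i ∈ H, connCoord B v A i = 0)
    (f : MvPolynomial (ℤ ×ₗ ι) regularAtInfinity) :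
    fibreEval B v A (killVars regularAtInfinity H f) = fibreEval B v A f := by
  induction f using MvPolynomial.induction_on with
  | C c => simp [fibreEval, killVars, algebraMap_eq]
  | add f f' hf hf' => rw [map_add, map_add, hf, hf', map_add]
  | mul_X f i hf =>
    rw [map_mul, map_mul, hf, map_mul]
    congr 1
    by_cases hi : i ∈ H <;> simp [fibreEval, killVars, hi, hH]

/-- The indices of the modes of degree at least `N`. -/
def highIndices (ι : Type*) (N : ℕ) : Set (ℤ ×ₗ ι) := {p | (N : ℤ) ≤ (ofLex p).1}

/-- This is why the basis of the loop algebra is ordered lexicographically with the degree first: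
high modes must come last for `pbwOp_mem_meetLE` to apply. -/
lemma isUpperSet_highIndices (N : ℕ) : IsUpperSet (highIndices ι N) :=
  fun _ _ hpq hp => le_trans hp (Prod.Lex.monotone_fst _ _ hpq)

lemma loopElt_mem_span (N : ℕ) (a : g) {n : ℤ} (hn : (N : ℤ) ≤ n) :
    loopElt a n ∈ Submodule.span ℂ (loopBasis v '' highIndices ι N) := by
  let G : g →ₗ[ℂ] loopAlgebra ℂ ℤ g :=
    { toFun := fun a => loopElt a n
      map_add' := fun a b => loopElt_add a b n
      map_smul' := fun c a => loopElt_smul c a n }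
  refine linearMap_apply_mem_of_basis v G (fun i => ?_) a
  change loopElt (v i) n ∈ _
  rw [← loopBasis_apply]
  exact Submodule.subset_span ⟨_, hn, rfl⟩

/-- Since `N ≥ 0`, high modes are closed under brackets, and two high degrees can only cancel when
both are zero, where the cocycle has the factor `0`. -/
lemma genericOp_mem_meetLE (hB : B.IsSymm) (N : ℕ) (x : loopAlgebra ℂ ℤ g) {n : ℕ}
    {f : MvPolynomial (ℤ ×ₗ ι) (RatFunc ℂ)} (hf : f ∈ meetLE (RatFunc ℂ) (highIndices ι N) n) :
    genericOp B v x f ∈ meetLE (RatFunc ℂ) (highIndices ι N) (n + 1) := by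
  refine pbwOp_mem_meetLE (loopBasis v) _ _ (isUpperSet_highIndices N) ?_ ?_ x hf
  · intro p hp q hq
    rw [← toLex_ofLex p, ← toLex_ofLex q, loopBasis_apply, loopBasis_apply, loopElt_lie]
    refine loopElt_mem_span v N _ ?_
    have h1 : (N : ℤ) ≤ (ofLex p).1 := hp
    have h2 : (N : ℤ) ≤ (ofLex q).1 := hq
    omega
  · intro p hp q hq
    rw [← toLex_ofLex p, ← toLex_ofLex q, loopBasis_apply, loopBasis_apply,
      scaledCocycle_loopElt B hB]
    have h1 : (N : ℤ) ≤ (ofLex p).1 := hp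
    have h2 : (N : ℤ) ≤ (ofLex q).1 := hq
    split_ifs with h
    · rw [show (ofLex p).1 = 0 by omega]
      simp
    · rfl

/-- The part of the module spanned by monomials that involve high modes. -/
def highPart (ι : Type*) (Q : Type*) [AddCommGroup Q] [Module ℂ Q] (N : ℕ) :
    Submodule (RatFunc ℂ) (MvPolynomial (ℤ ×ₗ ι) (RatFunc ℂ) ⊗[ℂ] Q) :=
  Submodule.span _ {z | ∃ n, ∃ f ∈ meetLE (RatFunc ℂ) (highIndices ι N) n, ∃ q : Q, z = f ⊗ₜ q}

lemma genericRep_mem_highPart (N : ℕ) (u : Generic B) :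
    highPart ι Q N ≤ (highPart ι Q N).comap (genericRep B v Q hB hB' u) := by
  let P : Subalgebra (RatFunc ℂ) (Generic B) :=
    { carrier := {u | highPart ι Q N ≤ (highPart ι Q N).comap (genericRep B v Q hB hB' u)}
      mul_mem' := fun {u u'} hu hu' z hz => by
        rw [Submodule.mem_comap, map_mul, Module.End.mul_apply]
        exact hu (hu' hz)
      add_mem' := fun {u u'} hu hu' z hz => by
        rw [Submodule.mem_comap, map_add, LinearMap.add_apply]
        exact add_mem (hu hz) (hu' hz)
      algebraMap_mem' := fun c z hz => by
        rw [Submodule.mem_comap, AlgHom.commutes, Module.algebraMap_end_apply]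
        exact Submodule.smul_mem _ _ hz }
  refine mode_induction P (fun s a n => ?_) u
  refine Submodule.span_le.mpr ?_
  rintro _ ⟨k, f, hf, q, rfl⟩
  fin_cases s
  · change genericRep B v Q hB hB' (modeX B a n) _ ∈ highPart ι Q N
    rw [genericRep_modeX]
    exact Submodule.smul_mem _ _
      (Submodule.subset_span ⟨k + 1, _, genericOp_mem_meetLE B v hB N _ hf, q, rfl⟩)
  · change genericRep B v Q hB hB' (modeY B a n) _ ∈ highPart ι Q N
    rw [genericRep_modeY]
    exact Submodule.subset_span ⟨k, f, hf, _, rfl⟩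

/-- A high mode of the first factor applied to `1` is a combination of high variables, while one of
the second factor kills `q`; the span is stable under the whole algebra. -/
lemma genericRep_mem_highPart_of_mem_highModes {N : ℕ} {q : Q}
    (hq : ∀ (a : g) (n : ℤ), (N : ℤ) ≤ n → modeOne B a n • q = 0) {u : Generic B}
    (hu : u ∈ highModes (RatFunc ℂ) B (![kap - 1, 1] : Fin 2 → RatFunc ℂ) N) :
    genericRep B v Q hB hB' u (1 ⊗ₜ q) ∈ highPart ι Q N := by
  induction hu using Submodule.span_induction with
  | mem u hu =>
    obtain ⟨s, a, n, hn, rfl⟩ := hu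
    fin_cases s
    · change genericRep B v Q hB hB' (modeX B a n) _ ∈ highPart ι Q N
      rw [genericRep_modeX]
      refine Submodule.smul_mem _ _ (Submodule.subset_span ⟨1, _, ?_, q, rfl⟩)
      have : Submodule.span ℂ (loopBasis v '' highIndices ι N) ≤
          ((meetLE (RatFunc ℂ) (highIndices ι N) 1).restrictScalars ℂ).comap
          ((LinearMap.applyₗ (R := RatFunc ℂ)
            (1 : MvPolynomial (ℤ ×ₗ ι) (RatFunc ℂ))).restrictScalars ℂ ∘ₗ genericOp B v) := by
        refine Submodule.span_le.mpr ?_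
        rintro _ ⟨p, hp, rfl⟩
        change pbwOp (loopBasis v) _ _ (loopBasis v p) (monomial 0 1) ∈ meetLE (RatFunc ℂ) _ 1
        rw [pbwOp_monomial_of_le _ _ _ _ _ (by simp), X_mul_monomial]
        exact monomial_mem_meetLE (by simp) (i := p) (by simp) hp
      exact this (loopElt_mem_span v N a hn)
    · change genericRep B v Q hB hB' (modeY B a n) _ ∈ highPart ι Q N
      rw [genericRep_modeY, hq a n hn, tmul_zero]
      exact zero_mem _
  | zero => rw [map_zero]; exact zero_mem _
  | add x y _ _ hx hy => rw [map_add]; exact add_mem hx hy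
  | smul c x _ hx =>
    rw [smul_eq_mul, map_mul]
    exact genericRep_mem_highPart B v Q hB hB' N c hx

/-- Setting the high variables to zero annihilates the high part, commutes with the lattice
inclusion, and does not change the value at `A`, whose high coordinates vanish. As the inclusion is
injective, the lattice vector representing `u (1 ⊗ q)` becomes zero, hence so does its value. -/
lemma fibreHom_of_mem_highModes {N : ℕ} (hA : ∀ n : ℤ, N ≤ n → A.1 n = 0) {q : Q}
    (hq : ∀ (a : g) (n : ℤ), (N : ℤ) ≤ n → modeOne B a n • q = 0) {u : intForm B}
    (hu : (u : Generic B) ∈ highModes (RatFunc ℂ) B (![kap - 1, 1] : Fin 2 → RatFunc ℂ) N) :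
    fibreHom B v Q hB hB' A u q = 0 := by
  obtain ⟨y, hy, hy'⟩ := fibreHom_mem B v Q hB hB' A u (1 ⊗ₜ q)
  rw [fibreEvalQ_tmul, map_one, one_smul] at hy'
  rw [← hy']
  have hmem := genericRep_mem_highPart_of_mem_highModes B v Q hB hB' hq hu
  rw [latticeInclQ_tmul, map_one] at hy
  rw [hy] at hmem
  set kR := LinearMap.rTensor Q ((killVars regularAtInfinity (highIndices ι N)).restrictScalars
    ℂ).toLinearMap with hkR
  set kK := LinearMap.rTensor Q ((killVars (RatFunc ℂ) (highIndices ι N)).restrictScalars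
    ℂ).toLinearMap with hkK
  have h1 : ∀ z ∈ highPart ι Q N, kK z = 0 := by
    intro z hz
    induction hz using Submodule.span_induction with
    | mem z hz =>
      obtain ⟨n, f, hf, q, rfl⟩ := hz
      rw [hkK, LinearMap.rTensor_tmul]
      change killVars _ _ f ⊗ₜ q = 0
      rw [killVars_of_mem_meetLE hf, zero_tmul]
    | zero => exact map_zero _
    | add x y _ _ hx hy => rw [map_add, hx, hy, add_zero]
    | smul c x _ hx =>
      have : ∀ w, kK (c • w) = c • kK w := ext_tmul (fun x y => by rw [smul_add, map_add])
        (fun x y => by rw [map_add, smul_add]) fun f q => by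
          rw [smul_tmul', hkK, LinearMap.rTensor_tmul, LinearMap.rTensor_tmul, smul_tmul']
          congr 1
          exact map_smul (killVars (RatFunc ℂ) (highIndices ι N)) c f
      rw [this, hx, smul_zero]
  have h2 : ∀ z, kK (latticeInclQ Q z) = latticeInclQ Q (kR z) :=
    ext_tmul (fun x y => by rw [map_add, map_add]) (fun x y => by rw [map_add, map_add])
      fun f q => by
        rw [latticeInclQ_tmul, hkK, hkR, LinearMap.rTensor_tmul, LinearMap.rTensor_tmul,
          latticeInclQ_tmul]
        congr 1
        exact (latticeIncl_killVars _ f).symm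
  have h3 : ∀ z, fibreEvalQ B v Q A (kR z) = fibreEvalQ B v Q A z :=
    ext_tmul (fun x y => by rw [map_add, map_add]) (map_add _) fun f q => by
        rw [hkR, LinearMap.rTensor_tmul, fibreEvalQ_tmul, fibreEvalQ_tmul]
        congr 1
        refine fibreEval_killVars B v A (fun i hi => ?_) f
        rw [connCoord, hA _ hi, map_zero, LinearMap.zero_apply]
  have h4 : kR y = 0 := latticeInclQ_injective Q (by rw [← h2, h1 _ hmem, map_zero])
  rw [← h3, h4, map_zero]

end Representation

/-! ### Commutation relations in the integral form and in the limit. -/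

section IntegralForm

variable {g : Type*} [LieRing g] [LieAlgebra ℂ g] (B : LinearMap.BilinForm ℂ g)

lemma modeX_mul_modeY (a b : g) (m n : ℤ) :
    modeX B a m * modeY B b n = modeY B b n * modeX B a m :=
  mode_mul_of_ne (by decide) a b m n

lemma modeX_mul (a b : g) (m n : ℤ) :
    modeX B a m * modeX B b n = modeX B b n * modeX B a m + modeX B ⁅a, b⁆ (m + n) +
      algebraMap (RatFunc ℂ) _
        (if m + n = 0 then algebraMap ℂ (RatFunc ℂ) (m * B a b) * (kap - 1) else 0) :=
  mode_mul (RatFunc ℂ) B (![kap - 1, 1] : Fin 2 → RatFunc ℂ) 0 a b m n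

lemma modeY_mul (a b : g) (m n : ℤ) :
    modeY B a m * modeY B b n = modeY B b n * modeY B a m + modeY B ⁅a, b⁆ (m + n) +
      algebraMap (RatFunc ℂ) _
        (if m + n = 0 then algebraMap ℂ (RatFunc ℂ) (m * B a b) else 0) := by
  have := mode_mul (RatFunc ℂ) B (![kap - 1, 1] : Fin 2 → RatFunc ℂ) 1 a b m n
  simp only [Matrix.cons_val_one, Matrix.cons_val_fin_one, mul_one] at this
  exact this

lemma modeDiag_mul_modeY (a b : g) (m n : ℤ) :
    modeDiag B a m * modeY B b n = modeY B b n * modeDiag B a m + modeY B ⁅a, b⁆ (m + n) +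
      algebraMap (RatFunc ℂ) _
        (if m + n = 0 then algebraMap ℂ (RatFunc ℂ) (m * B a b) else 0) := by
  rw [modeDiag, add_mul, modeX_mul_modeY, modeY_mul, mul_add]
  abel

lemma modeDiag_mul (a b : g) (m n : ℤ) :
    modeDiag B a m * modeDiag B b n = modeDiag B b n * modeDiag B a m +
      modeDiag B ⁅a, b⁆ (m + n) + algebraMap (RatFunc ℂ) _
        (if m + n = 0 then algebraMap ℂ (RatFunc ℂ) (m * B a b) * kap else 0) := by
  have h : (if m + n = 0 then algebraMap ℂ (RatFunc ℂ) (m * B a b) * kap else 0) =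
      (if m + n = 0 then algebraMap ℂ (RatFunc ℂ) (m * B a b) * (kap - 1) else 0) +
      (if m + n = 0 then algebraMap ℂ (RatFunc ℂ) (m * B a b) else 0) := by
    split_ifs <;> ring
  rw [h, map_add]
  simp only [modeDiag, add_mul, mul_add, modeX_mul B a b, modeY_mul B a b, modeX_mul_modeY]
  abel

/-- A function that is regular at infinity, as an element of the integral form. -/
def regularElt (f : RatFunc ℂ) (hf : f ∈ regularAtInfinity) : intForm B :=
  ⟨algebraMap (RatFunc ℂ) _ f, Algebra.subset_adjoin (Or.inl (Or.inl ⟨f, hf, rfl⟩))⟩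

lemma regularElt_eq {f : RatFunc ℂ} (hf : f ∈ regularAtInfinity) : ∃ (c : ℂ) (u : intForm B),
    regularElt B f hf = algebraMap ℂ _ c + kapInv B * u := by
  obtain ⟨c, f', hf', e⟩ := exists_eq_add_kap_inv_mul hf
  refine ⟨c, regularElt B f' hf', Subtype.ext ?_⟩
  change algebraMap (RatFunc ℂ) (Generic B) f = algebraMap ℂ (Generic B) c +
    algebraMap _ _ kap⁻¹ * algebraMap _ _ f'
  rw [IsScalarTower.algebraMap_apply ℂ (RatFunc ℂ) (Generic B), ← map_mul, ← map_add, ← e]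

lemma inclOne_modeOne_coe (a : g) (n : ℤ) :
    (inclOne B (modeOne B a n) : Generic B) = modeY B a n := by
  rw [ModeAlgebra.lift_inclOne_mode]

/-- Elements of the integral form: it suffices to treat functions regular at infinity, the diagonal
modes and the modes of level one. -/
lemma intForm_induction (P : Subalgebra ℂ (intForm B))
    (hf : ∀ f hf, regularElt B f hf ∈ P) (hD : ∀ a n, scaledDiag B a n ∈ P)
    (hY : ∀ a n, inclOne B (modeOne B a n) ∈ P) (u : intForm B) : u ∈ P := by
  suffices H : intForm B ≤ P.map (intForm B).val by
    obtain ⟨x, hx, e⟩ := H u.2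
    rwa [← Subtype.ext (a1 := x) (a2 := u) e]
  refine Algebra.adjoin_le ?_
  rintro _ ((⟨f, hf', rfl⟩ | ⟨a, n, rfl⟩) | ⟨a, n, rfl⟩)
  · exact ⟨_, hf f hf', rfl⟩
  · refine ⟨_, P.sub_mem (hD a n) (P.mul_mem (hf _ kap_inv_mem) (hY a n)), ?_⟩
    change kap⁻¹ • modeDiag B a n - algebraMap (RatFunc ℂ) _ kap⁻¹ *
      (inclOne B (modeOne B a n) : Generic B) = _
    rw [inclOne_modeOne_coe, ← Algebra.smul_def, modeDiag, smul_add, add_sub_cancel_right]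
  · exact ⟨_, hY a n, inclOne_modeOne_coe B a n⟩

lemma algebraMap_intForm_coe (c : ℂ) : ((algebraMap ℂ (intForm B) c : intForm B) : Generic B) =
    algebraMap (RatFunc ℂ) _ (algebraMap ℂ (RatFunc ℂ) c) := by
  rw [← IsScalarTower.algebraMap_apply ℂ (RatFunc ℂ) (Generic B)]
  rfl

/-- The commutator carries `κ⁻²`; one factor rescales the bracket mode and the other stays, while
the level `κ` of the diagonal cancels one factor in the central term. Everything is thus divisible
by `κ⁻¹` inside the integral form. -/
lemma scaledDiag_mul (a b : g) (m n : ℤ) :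
    scaledDiag B a m * scaledDiag B b n = scaledDiag B b n * scaledDiag B a m +
      kapInv B * (scaledDiag B ⁅a, b⁆ (m + n) +
        algebraMap ℂ _ (if m + n = 0 then m * B a b else 0)) := by
  refine Subtype.ext ?_
  change (kap⁻¹ • modeDiag B a m) * (kap⁻¹ • modeDiag B b n) =
    (kap⁻¹ • modeDiag B b n) * (kap⁻¹ • modeDiag B a m) + algebraMap (RatFunc ℂ) _ kap⁻¹ *
      (kap⁻¹ • modeDiag B ⁅a, b⁆ (m + n) + ((algebraMap ℂ (intForm B) _ : intForm B) : Generic B))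
  rw [algebraMap_intForm_coe, ← Algebra.smul_def, smul_mul_smul_comm, modeDiag_mul,
    smul_mul_smul_comm, smul_add, smul_add, smul_add, smul_smul kap⁻¹ kap⁻¹, add_assoc]
  congr 2
  rw [Algebra.smul_def, Algebra.smul_def, ← map_mul, ← map_mul]
  congr 1
  split_ifs
  · field_simp [kap_ne_zero]
  · simp

lemma scaledDiag_mul_inclOne (a b : g) (m n : ℤ) :
    scaledDiag B a m * inclOne B (modeOne B b n) = inclOne B (modeOne B b n) * scaledDiag B a m +
      kapInv B * (inclOne B (modeOne B ⁅a, b⁆ (m + n)) +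
        algebraMap ℂ _ (if m + n = 0 then m * B a b else 0)) := by
  refine Subtype.ext ?_
  change (kap⁻¹ • modeDiag B a m) * (inclOne B (modeOne B b n) : Generic B) =
    (inclOne B (modeOne B b n) : Generic B) * (kap⁻¹ • modeDiag B a m) +
    algebraMap (RatFunc ℂ) _ kap⁻¹ * ((inclOne B (modeOne B ⁅a, b⁆ (m + n)) : Generic B) +
      ((algebraMap ℂ (intForm B) _ : intForm B) : Generic B))
  rw [algebraMap_intForm_coe, inclOne_modeOne_coe, inclOne_modeOne_coe, ← Algebra.smul_def,
    smul_mul_assoc, modeDiag_mul_modeY, mul_smul_comm, smul_add, smul_add, smul_add, add_assoc]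
  congr 4
  split_ifs <;> simp

lemma toLimit_kapInv : toLimit B (kapInv B) = 0 := by
  rw [toLimit, RingQuot.mkAlgHom_rel ℂ (s := fun x y : intForm B => x = kapInv B ∧ y = 0)
    ⟨rfl, rfl⟩, map_zero]

lemma toLimit_scaledDiag_comm (a b : g) (m n : ℤ) :
    toLimit B (scaledDiag B a m) * toLimit B (scaledDiag B b n) =
      toLimit B (scaledDiag B b n) * toLimit B (scaledDiag B a m) := by
  rw [← map_mul, scaledDiag_mul, map_add, map_mul, map_mul, toLimit_kapInv, zero_mul, add_zero]

lemma toLimit_scaledDiag_comm_inclOne (a : g) (m : ℤ) (u : LevelOne B) :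
    toLimit B (scaledDiag B a m) * toLimit B (inclOne B u) =
      toLimit B (inclOne B u) * toLimit B (scaledDiag B a m) := by
  let P : Subalgebra ℂ (LevelOne B) :=
    (Subalgebra.centralizer ℂ {toLimit B (scaledDiag B a m)}).comap ((toLimit B).comp (inclOne B))
  have : u ∈ P := mode_induction P (fun s b n => by
    change toLimit B (inclOne B (modeOne B b n)) ∈ Subalgebra.centralizer ℂ {toLimit B (scaledDiag B a m)}
    rw [Subalgebra.mem_centralizer_iff]
    rintro _ rfl
    rw [← map_mul, scaledDiag_mul_inclOne, map_add, map_mul, map_mul, toLimit_kapInv, zero_mul,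
      add_zero]) u
  exact (Subalgebra.mem_centralizer_iff ℂ).mp this _ rfl

end IntegralForm

/-! ### Functions on connections form a polynomial ring. -/

section Functions

open MvPolynomial

variable {g : Type*} [LieRing g] [LieAlgebra ℂ g] (B : LinearMap.BilinForm ℂ g)
  {ι : Type*} [Fintype ι] [DecidableEq ι] (v w : Module.Basis ι ℂ g)

/-- Polynomials in the coordinates as functions on the space of connections. -/
def polyToFun : MvPolynomial (ℤ × ι) ℂ →ₐ[ℂ] functionRing B :=
  aeval fun p => coord B (v p.2) p.1

lemma coord_add (a b : g) (n : ℤ) : coord B (a + b) n = coord B a n + coord B b n :=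
  Subtype.ext (funext fun A => map_add (B (A.1 n)) a b)

lemma coord_smul (c : ℂ) (a : g) (n : ℤ) : coord B (c • a) n = c • coord B a n :=
  Subtype.ext (funext fun A => map_smul (B (A.1 n)) c a)

/-- `coord` as a linear map. -/
def coordLin (n : ℤ) : g →ₗ[ℂ] functionRing B where
  toFun a := coord B a n
  map_add' a b := coord_add B a b n
  map_smul' c a := coord_smul B c a n

lemma functionRing_induction (P : Subalgebra ℂ (functionRing B)) (h : ∀ a n, coord B a n ∈ P)
    (f : functionRing B) : f ∈ P := by
  suffices H : functionRing B ≤ P.map (functionRing B).val by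
    obtain ⟨x, hx, e⟩ := H f.2
    rwa [← Subtype.ext (a1 := x) (a2 := f) e]
  refine Algebra.adjoin_le ?_
  rintro _ ⟨a, n, rfl⟩
  exact ⟨_, h a n, rfl⟩

lemma polyToFun_surjective : Function.Surjective (polyToFun B v) := by
  intro f
  refine functionRing_induction B (polyToFun B v).range (fun a n => ?_) f
  refine linearMap_apply_mem_of_basis v (p := (polyToFun B v).range.toSubmodule) (coordLin B n)
    (fun i => ?_) a
  exact ⟨X (n, i), by simp [polyToFun, coordLin]⟩

lemma polyToFun_apply (p : MvPolynomial (ℤ × ι) ℂ) (A : Connection g) :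
    (polyToFun B v p).1 A = eval (fun q => B (A.1 q.1) (v q.2)) p := by
  induction p using MvPolynomial.induction_on with
  | C c => simp [polyToFun]
  | add p q hp hq =>
    rw [map_add, map_add, ← hp, ← hq]
    rfl
  | mul_X p i hp =>
    rw [map_mul, map_mul, ← hp, eval_X, polyToFun, aeval_X]
    rfl

/-- A polynomial uses finitely many coordinates, so any values of them are realised by an actual
connection, and a polynomial vanishing at all complex points is zero. -/
lemma polyToFun_injective (hvw : ∀ i j, B (w i) (v j) = if i = j then 1 else 0) :
    Function.Injective (polyToFun B v) := by
  rw [injective_iff_map_eq_zero]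
  intro p hp
  refine MvPolynomial.funext fun c => ?_
  rw [map_zero]
  obtain ⟨N, hN⟩ : ∃ N : ℤ, ∀ q ∈ p.vars, q.1 < N := by
    obtain ⟨N, hN⟩ := (p.vars.image Prod.fst).exists_le
    exact ⟨N + 1, fun q hq => Int.lt_add_one_of_le (hN _ (Finset.mem_image_of_mem _ hq))⟩
  -- Expansion in the basis dual to `v` prescribes the coordinates; the cut at `N` lies beyond every
  -- variable of `p` and ensures `A_n = 0` for large `n`.
  let A : Connection g := ⟨fun n => if n < N then ∑ i, c (n, i) • w i else 0,
    N, fun n hn => if_neg (not_lt.mpr hn)⟩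
  have h1 := polyToFun_apply B v p A
  rw [hp] at h1
  rw [show (0 : ℂ) = eval (fun q => B (A.1 q.1) (v q.2)) p from h1]
  refine MvPolynomial.eval₂Hom_congr' rfl (fun q hq _ => ?_) rfl
  have : A.1 q.1 = ∑ i, c (q.1, i) • w i := if_pos (hN q hq)
  rw [this]
  simp [hvw, LinearMap.sum_apply]

/-- The ring of functions on the space of connections is a polynomial ring. -/
def polyEquivFun (hvw : ∀ i j, B (w i) (v j) = if i = j then 1 else 0) :
    MvPolynomial (ℤ × ι) ℂ ≃ₐ[ℂ] functionRing B :=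
  AlgEquiv.ofBijective (polyToFun B v) ⟨polyToFun_injective B v w hvw, polyToFun_surjective B v⟩

/-- Functions form a free commutative algebra on the coordinates, so commuting images suffice to
define the map; linearity in `a` extends the formula from the basis to all coordinates. -/
lemma exists_functionRing_hom (hvw : ∀ i j, B (w i) (v j) = if i = j then 1 else 0) :
    ∃ F : functionRing B →ₐ[ℂ] Limit B, ∀ a n, F (coord B a n) = toLimit B (scaledDiag B a n) := by
  let s : Set (Limit B) := {x | ∃ a n, x = toLimit B (scaledDiag B a n)}
  -- Evaluation of polynomials needs a commutative target, so it takes place in the subalgebra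
  -- generated by the rescaled diagonal modes.
  have hs : IsMulCommutative (Algebra.adjoin ℂ s) := Algebra.isMulCommutative_adjoin ℂ (by
    rintro _ ⟨a, m, rfl⟩ _ ⟨b, n, rfl⟩
    exact toLimit_scaledDiag_comm B a b m n)
  let _ : CommRing (Algebra.adjoin ℂ s) :=
    { (inferInstance : Ring (Algebra.adjoin ℂ s)) with mul_comm := hs.is_comm.comm }
  let F₀ : MvPolynomial (ℤ × ι) ℂ →ₐ[ℂ] Algebra.adjoin ℂ s :=
    aeval fun p => ⟨toLimit B (scaledDiag B (v p.2) p.1), Algebra.subset_adjoin ⟨_, _, rfl⟩⟩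
  let F : functionRing B →ₐ[ℂ] Limit B :=
    (Algebra.adjoin ℂ s).val.comp (F₀.comp (polyEquivFun B v w hvw).symm.toAlgHom)
  refine ⟨F, fun a n => ?_⟩
  have hlin : ∀ n, F.toLinearMap ∘ₗ coordLin B n = (toLimit B).toLinearMap ∘ₗ
      { toFun := fun a => scaledDiag B a n
        map_add' := fun a b => Subtype.ext (by
          change kap⁻¹ • modeDiag B (a + b) n = kap⁻¹ • modeDiag B a n + kap⁻¹ • modeDiag B b n
          rw [← smul_add, modeDiag, modeX, modeY, mode_add, mode_add, modeDiag, modeDiag, modeX,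
            modeY, modeX, modeY]
          congr 1
          abel)
        map_smul' := fun c a => Subtype.ext (by
          change kap⁻¹ • modeDiag B (c • a) n = c • (kap⁻¹ • modeDiag B a n)
          rw [modeDiag, modeX, modeY, mode_smul, mode_smul, ← smul_add, algebraMap_smul, smul_comm]
          rfl) } := by
    intro n
    refine v.ext fun i => ?_
    change F (coord B (v i) n) = toLimit B (scaledDiag B (v i) n)
    have : coord B (v i) n = polyEquivFun B v w hvw (X (n, i)) := by
      simp [polyEquivFun, polyToFun]
    rw [this]
    change ((F₀ ((polyEquivFun B v w hvw).symm (polyEquivFun B v w hvw (X (n, i)))) :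
      Algebra.adjoin ℂ s) : Limit B) = _
    rw [AlgEquiv.symm_apply_apply, aeval_X]
  exact LinearMap.congr_fun (hlin n) a

end Functions

/-! ### The limit as a trivial bundle of algebras. -/

section Bundle

variable {g : Type*} [LieRing g] [LieAlgebra ℂ g] (B : LinearMap.BilinForm ℂ g)
  {ι : Type*} [Fintype ι] [DecidableEq ι] (v w : Module.Basis ι ℂ g)

/-- The action of the integral form on the fibre factors through the limit. -/
lemma exists_limit_hom (hB : B.IsSymm) (hB' : B.lieInvariant g) {κ : Type*} [LinearOrder κ]
    (b : Module.Basis κ ℂ g) (A : Connection g) :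
    ∃ χ : Limit B →ₐ[ℂ] Module.End ℂ (LevelOne B),
      (∀ a n, χ (toLimit B (scaledDiag B a n)) = B (A.1 n) a • 1) ∧
      ∀ u x, χ (toLimit B (inclOne B u)) x = u * x := by
  let χ : Limit B →ₐ[ℂ] Module.End ℂ (LevelOne B) :=
    RingQuot.liftAlgHom ℂ ⟨fibreHom B b (LevelOne B) hB hB' A, by
      rintro _ _ ⟨rfl, rfl⟩
      rw [fibreHom_kapInv, map_zero]⟩
  have hχ : ∀ u, χ (toLimit B u) = fibreHom B b (LevelOne B) hB hB' A u := fun u =>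
    RingQuot.liftAlgHom_mkAlgHom_apply (S := ℂ) _ _ u
  refine ⟨χ, fun a n => ?_, fun u x => ?_⟩
  · rw [hχ, fibreHom_scaledDiag]
  · rw [hχ, fibreHom_inclOne, smul_eq_mul]

lemma toLimit_surjective : Function.Surjective (toLimit B) :=
  RingQuot.mkAlgHom_surjective ℂ _

/-- The limit is a trivial bundle over the space of connections. -/
theorem exists_bundle_equiv (hB : B.IsSymm) (hB' : B.lieInvariant g)
    (hvw : ∀ i j, B (w i) (v j) = if i = j then 1 else 0)
    {κ : Type*} [LinearOrder κ] (b : Module.Basis κ ℂ g) :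
    ∃ e : functionRing B ⊗[ℂ] LevelOne B ≃ₐ[ℂ] Limit B,
      (∀ a n, e (coord B a n ⊗ₜ 1) = toLimit B (scaledDiag B a n)) ∧
      ∀ u, e (1 ⊗ₜ u) = toLimit B (inclOne B u) := by
  obtain ⟨F, hF⟩ := exists_functionRing_hom B v w hvw
  have hcomm : ∀ f u, Commute (F f) ((toLimit B).comp (inclOne B) u) := by
    intro f u
    let P : Subalgebra ℂ (functionRing B) :=
      (Subalgebra.centralizer ℂ {toLimit B (inclOne B u)}).comap F
    have : f ∈ P := functionRing_induction B P (fun a n => by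
      change F (coord B a n) ∈ Subalgebra.centralizer ℂ {toLimit B (inclOne B u)}
      rw [Subalgebra.mem_centralizer_iff]
      rintro _ rfl
      rw [hF, toLimit_scaledDiag_comm_inclOne]) f
    exact ((Subalgebra.mem_centralizer_iff ℂ).mp this _ rfl).symm
  let E : functionRing B ⊗[ℂ] LevelOne B →ₐ[ℂ] Limit B :=
    Algebra.TensorProduct.lift F ((toLimit B).comp (inclOne B)) hcomm
  have hE1 : ∀ f, E (f ⊗ₜ 1) = F f := fun f => by simp [E]
  have hE2 : ∀ u, E (1 ⊗ₜ u) = toLimit B (inclOne B u) := fun u => by simp [E]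
  have hEtmul : ∀ f u, E (f ⊗ₜ u) = F f * toLimit B (inclOne B u) := fun f u => by simp [E]
  have hsurj : Function.Surjective E := by
    intro x
    obtain ⟨u, rfl⟩ := toLimit_surjective B x
    refine intForm_induction B (E.range.comap (toLimit B)) (fun f hf => ?_) (fun a n => ?_)
      (fun a n => ?_) u
    · obtain ⟨c, u, e⟩ := regularElt_eq B hf
      refine ⟨algebraMap ℂ _ c, ?_⟩
      change E (algebraMap ℂ _ c) = toLimit B (regularElt B f hf)
      rw [e, AlgHom.commutes, map_add, map_mul, toLimit_kapInv, zero_mul, add_zero,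
        AlgHom.commutes]
    · exact ⟨coord B a n ⊗ₜ 1, (hE1 _).trans (hF a n)⟩
    · exact ⟨1 ⊗ₜ modeOne B a n, hE2 _⟩
  have hinj : Function.Injective E := by
    rw [injective_iff_map_eq_zero]
    intro t ht
    -- Acting with `E t` on the vector `1` of the fibre representation at `A` returns the value of
    -- `t` at `A` in the level one algebra.
    have heval : ∀ A : Connection g, ∀ t : functionRing B ⊗[ℂ] LevelOne B, E t = 0 →
        (TensorProduct.lid ℂ (LevelOne B)) (LinearMap.rTensor (LevelOne B)
          ((LinearMap.proj A : (Connection g → ℂ) →ₗ[ℂ] ℂ) ∘ₗ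
            (functionRing B).val.toLinearMap) t) = 0 := by
      intro A t ht
      obtain ⟨χ, h1, h2⟩ := exists_limit_hom B hB hB' b A
      have hf : ∀ f : functionRing B, χ (F f) = f.1 A • 1 := by
        intro f
        let ev : functionRing B →ₐ[ℂ] Module.End ℂ (LevelOne B) :=
          (Algebra.ofId ℂ _).comp ((Pi.evalAlgHom ℂ (fun _ : Connection g => ℂ) A).comp
            (functionRing B).val)
        have hev : ∀ f, ev f = f.1 A • 1 := fun f =>
          Algebra.algebraMap_eq_smul_one (R := ℂ) (A := Module.End ℂ (LevelOne B)) (f.1 A)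
        rw [← hev]
        refine functionRing_induction B (AlgHom.equalizer (χ.comp F) ev) (fun a n => ?_) f
        change χ (F (coord B a n)) = ev (coord B a n)
        rw [hF, h1, hev]
        rfl
      have key : ∀ t, (TensorProduct.lid ℂ (LevelOne B)) (LinearMap.rTensor (LevelOne B)
          ((LinearMap.proj A : (Connection g → ℂ) →ₗ[ℂ] ℂ) ∘ₗ
            (functionRing B).val.toLinearMap) t) = χ (E t) 1 := by
        refine ext_tmul (fun x y => by rw [map_add, map_add])
          (fun x y => by rw [map_add, map_add, LinearMap.add_apply]) fun f u => ?_
        rw [hEtmul, map_mul, hf, Module.End.mul_apply, h2, mul_one, LinearMap.rTensor_tmul,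
          TensorProduct.lid_tmul]
        rfl
      rw [key, ht, map_zero, LinearMap.zero_apply]
    let bas := Module.Basis.ofVectorSpace ℂ (LevelOne B)
    classical
    -- Along a basis of the level one algebra the coefficients of `t` are functions on connections;
    -- they vanish at every point, hence are zero.
    refine (TensorProduct.equivFinsuppOfBasisRight bas).injective ?_
    rw [map_zero]
    refine Finsupp.ext fun i => Subtype.ext (funext fun A => ?_)
    have h1 := congrArg (fun x => bas.repr x i) (heval A t ht)
    simp only [map_zero, Finsupp.coe_zero, Pi.zero_apply] at h1
    rw [Finsupp.coe_zero, Pi.zero_apply]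
    refine Eq.trans ?_ h1
    clear h1 ht
    refine ext_tmul (φ := fun t => ((TensorProduct.equivFinsuppOfBasisRight bas t) i).1 A)
      (ψ := fun t => bas.repr ((TensorProduct.lid ℂ (LevelOne B)) (LinearMap.rTensor (LevelOne B)
          ((LinearMap.proj A : (Connection g → ℂ) →ₗ[ℂ] ℂ) ∘ₗ
            (functionRing B).val.toLinearMap) t)) i)
      (fun x y => by rw [map_add]; rfl) (fun x y => by simp only [map_add, Finsupp.add_apply])
      (fun f u => ?_) t
    rw [TensorProduct.equivFinsuppOfBasisRight_apply_tmul_apply, LinearMap.rTensor_tmul,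
      TensorProduct.lid_tmul, map_smul]
    simp [mul_comm]
  exact ⟨AlgEquiv.ofBijective E ⟨hinj, hsurj⟩, fun a n => (hE1 _).trans (hF a n), hE2⟩

end Bundle

/-! ### Fibres of cyclic modules. -/

section Fibres

variable {g : Type*} [LieRing g] [LieAlgebra ℂ g] (B : LinearMap.BilinForm ℂ g)
  (A : Connection g) (M : Type*) [AddCommGroup M] [Module (intForm B) M]

variable {M}

lemma Coinv.mk_surjective : Function.Surjective (Coinv.mk B A : M → Coinv B A M) :=
  Submodule.mkQ_surjective _

lemma Coinv.mk_smul (u : intForm B) (x : M) : Coinv.mk B A (u • x) = u • Coinv.mk B A x := rfl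

lemma Coinv.kapInv_smul (y : Coinv B A M) : kapInv B • y = 0 := by
  obtain ⟨x, rfl⟩ := Coinv.mk_surjective B A y
  exact (Submodule.Quotient.mk_eq_zero _).mpr (Submodule.subset_span (Or.inl ⟨x, rfl⟩))

lemma Coinv.scaledDiag_smul (a : g) (n : ℤ) (y : Coinv B A M) :
    scaledDiag B a n • y = algebraMap ℂ (intForm B) (B (A.1 n) a) • y := by
  obtain ⟨x, rfl⟩ := Coinv.mk_surjective B A y
  rw [← sub_eq_zero, ← sub_smul]
  exact (Submodule.Quotient.mk_eq_zero _).mpr (Submodule.subset_span (Or.inr ⟨a, n, x, rfl⟩))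

lemma Coinv.levelOne_smul (u : LevelOne B) (y : Coinv B A M) : u • y = inclOne B u • y := rfl

lemma Coinv.algebraMap_smul (c : ℂ) (y : Coinv B A M) :
    algebraMap ℂ (intForm B) c • y = algebraMap ℂ (LevelOne B) c • y := by
  rw [Coinv.levelOne_smul, AlgHom.commutes]

/-- The integral form acts on a fibre through the algebra of level one. -/
lemma Coinv.exists_smul_eq (u : intForm B) (y : Coinv B A M) : ∃ x : LevelOne B, u • y = x • y := by
  let P : Subalgebra ℂ (intForm B) :=
    { carrier := {u | ∀ y : Coinv B A M, ∃ x : LevelOne B, u • y = x • y}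
      mul_mem' := fun {u u'} hu hu' y => by
        obtain ⟨x', e'⟩ := hu' y
        obtain ⟨x, e⟩ := hu (x' • y)
        exact ⟨x * x', by rw [mul_smul, e', e, mul_smul]⟩
      add_mem' := fun {u u'} hu hu' y => by
        obtain ⟨x, e⟩ := hu y
        obtain ⟨x', e'⟩ := hu' y
        exact ⟨x + x', by rw [add_smul, e, e', add_smul]⟩
      algebraMap_mem' := fun c y => ⟨algebraMap ℂ _ c, Coinv.algebraMap_smul B A c y⟩ }
  refine intForm_induction B P (fun f hf y => ?_) (fun a n y => ?_) (fun a n y => ?_) u y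
  · obtain ⟨c, u, e⟩ := regularElt_eq B hf
    exact ⟨algebraMap ℂ _ c, by
      rw [e, add_smul, mul_smul, Coinv.kapInv_smul, add_zero, Coinv.algebraMap_smul]⟩
  · exact ⟨algebraMap ℂ _ (B (A.1 n) a), by
      rw [Coinv.scaledDiag_smul, Coinv.algebraMap_smul]⟩
  · exact ⟨modeOne B a n, rfl⟩

/-- The fibre of a cyclic module: it is determined by the annihilator of the generator. -/
lemma exists_cyclic_fibre_equiv (hB : B.IsSymm) (hB' : B.lieInvariant g) {κ : Type*} [LinearOrder κ]
    (b : Module.Basis κ ℂ g)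
    (x₀ : M) (hx₀ : ∀ x : M, ∃ u : intForm B, x = u • x₀)
    (I : Submodule (LevelOne B) (LevelOne B)) (hI : ∀ u ∈ I, inclOne B u • x₀ = 0)
    (hann : ∀ u : intForm B, u • x₀ = 0 →
      fibreHom B b (LevelOne B ⧸ I) hB hB' A u (Submodule.Quotient.mk 1) = 0) :
    ∃ e : (LevelOne B ⧸ I) ≃ₗ[LevelOne B] Coinv B A M,
      e (Submodule.Quotient.mk 1) = Coinv.mk B A x₀ := by
  let f : LevelOne B →ₗ[LevelOne B] Coinv B A M :=
    LinearMap.toSpanSingleton _ _ (Coinv.mk B A x₀)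
  have hf : ∀ u, f u = inclOne B u • Coinv.mk B A x₀ := fun u => rfl
  have hfI : I ≤ LinearMap.ker f := fun u hu => by
    rw [LinearMap.mem_ker, hf, ← Coinv.mk_smul, hI u hu]
    rfl
  let e := I.liftQ f hfI
  have he : ∀ u, e (Submodule.Quotient.mk u) = f u := fun u => Submodule.liftQ_apply _ _ _
  have hsurj : Function.Surjective e := by
    intro y
    obtain ⟨x, rfl⟩ := Coinv.mk_surjective B A y
    obtain ⟨u, rfl⟩ := hx₀ x
    obtain ⟨x, hx⟩ := Coinv.exists_smul_eq B A u (Coinv.mk B A x₀)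
    exact ⟨Submodule.Quotient.mk x, by rw [he, Coinv.mk_smul, hx]; rfl⟩
  -- `fibreHom` vanishes on `κ⁻¹` and on `a_n^{(κ)} / κ - ⟨A_n, a⟩`. By `hann` the vector `fibreHom
  -- u [1]` depends only on `u • x₀`, so it gives a function on the fibre that inverts `e`.
  have hker : ∀ x ∈ coinvKer B A M, ∃ u : intForm B, x = u • x₀ ∧
      fibreHom B b (LevelOne B ⧸ I) hB hB' A u (Submodule.Quotient.mk 1) = 0 := by
    intro x hx
    induction hx using Submodule.span_induction with
    | mem x hx =>
      rcases hx with ⟨x, rfl⟩ | ⟨a, n, x, rfl⟩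
      · obtain ⟨u, rfl⟩ := hx₀ x
        refine ⟨kapInv B * u, (mul_smul _ _ _).symm, ?_⟩
        rw [map_mul, fibreHom_kapInv, zero_mul, LinearMap.zero_apply]
      · obtain ⟨u, rfl⟩ := hx₀ x
        refine ⟨_ * u, (mul_smul _ _ _).symm, ?_⟩
        rw [map_mul, map_sub, fibreHom_scaledDiag, AlgHom.commutes, Algebra.algebraMap_eq_smul_one,
          sub_self, zero_mul, LinearMap.zero_apply]
    | zero => exact ⟨0, (zero_smul _ _).symm, by rw [map_zero, LinearMap.zero_apply]⟩
    | add x y _ _ hx hy =>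
      obtain ⟨u, e, h⟩ := hx
      obtain ⟨u', e', h'⟩ := hy
      exact ⟨u + u', by rw [e, e', add_smul], by rw [map_add, LinearMap.add_apply, h, h', add_zero]⟩
    | smul c x _ hx =>
      obtain ⟨u, e, h⟩ := hx
      exact ⟨c * u, by rw [e, mul_smul], by rw [map_mul, Module.End.mul_apply, h, map_zero]⟩
  have hinj : Function.Injective e := by
    rw [injective_iff_map_eq_zero]
    intro q hq
    obtain ⟨u, rfl⟩ := Submodule.Quotient.mk_surjective _ q
    rw [he, hf, ← Coinv.mk_smul] at hq
    obtain ⟨u', e', h'⟩ := hker _ ((Submodule.Quotient.mk_eq_zero _).mp hq)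
    have h := hann (inclOne B u - u') (by rw [sub_smul, e', sub_self])
    rw [map_sub, LinearMap.sub_apply, h', sub_zero, fibreHom_inclOne, ← Submodule.Quotient.mk_smul,
      smul_eq_mul, mul_one] at h
    exact h
  exact ⟨LinearEquiv.ofBijective e ⟨hinj, hsurj⟩,
    (he 1).trans (by rw [hf, map_one, one_smul])⟩

/-- The fibre of the integral form is the algebra of level one. -/
theorem exists_fibre_equiv (hB : B.IsSymm) (hB' : B.lieInvariant g) {κ : Type*} [LinearOrder κ]
    (b : Module.Basis κ ℂ g) :
    ∃ e : LevelOne B ≃ₗ[LevelOne B] Coinv B A (intForm B), e 1 = Coinv.mk B A 1 := by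
  obtain ⟨e, he⟩ := exists_cyclic_fibre_equiv B A hB hB' b (1 : intForm B)
    (fun x => ⟨x, by rw [smul_eq_mul, mul_one]⟩) ⊥
    (fun u hu => by rw [(Submodule.mem_bot _).mp hu, map_zero, zero_smul])
    (fun u hu => by
      rw [smul_eq_mul, mul_one] at hu
      rw [hu, map_zero, LinearMap.zero_apply])
  exact ⟨(Submodule.quotEquivOfEqBot ⊥ rfl).symm.trans e, he⟩

lemma univVec_smul_eq_zero_iff (N : ℕ) (u : Generic B) : u • univVec B N = 0 ↔
    u ∈ highModes (RatFunc ℂ) B (![kap - 1, 1] : Fin 2 → RatFunc ℂ) N := by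
  rw [univVec, ← Submodule.Quotient.mk_smul, smul_eq_mul, mul_one, Submodule.Quotient.mk_eq_zero]

/-- The fibre of the universal smooth module is the universal smooth module of level one. -/
theorem exists_univ_fibre_equiv (hB : B.IsSymm) (hB' : B.lieInvariant g) {κ : Type*} [LinearOrder κ]
    (b : Module.Basis κ ℂ g) (N : ℕ)
    (hA : ∀ n : ℤ, N ≤ n → A.1 n = 0) :
    ∃ e : (LevelOne B ⧸ highModes ℂ B (fun _ : Unit => (1 : ℂ)) N) ≃ₗ[LevelOne B]
        Coinv B A (univLattice B N),
      e (Submodule.Quotient.mk 1) = Coinv.mk B A (univLatticeVec B N) := by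
  have hcoe : ∀ u : intForm B, ((u • univLatticeVec B N : univLattice B N) : UnivSmooth B N) =
    (u : Generic B) • univVec B N := fun u => rfl
  have hzero : ∀ u : intForm B, u • univLatticeVec B N = 0 ↔ (u : Generic B) • univVec B N = 0 :=
    fun u => by rw [← hcoe, Submodule.coe_eq_zero]
  refine exists_cyclic_fibre_equiv B A hB hB' b (univLatticeVec B N) (fun x => ?_) _ (fun u hu => ?_)
    (fun u hu => ?_)
  · obtain ⟨u, hu⟩ := Submodule.mem_span_singleton.mp x.2
    exact ⟨u, Subtype.ext hu.symm⟩
  · rw [hzero]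
    induction hu using Submodule.span_induction with
    | mem u hu =>
      obtain ⟨s, a, n, hn, rfl⟩ := hu
      rw [univVec_smul_eq_zero_iff]
      change (inclOne B (modeOne B a n) : Generic B) ∈ _
      rw [inclOne_modeOne_coe]
      exact Submodule.subset_span ⟨1, a, n, hn, rfl⟩
    | zero => rw [map_zero]; exact zero_smul _ _
    | add x y _ _ hx hy =>
      rw [map_add]
      exact (add_smul _ _ _).trans (by rw [hx, hy, add_zero])
    | smul c x _ hx =>
      rw [smul_eq_mul, map_mul]
      exact (mul_smul _ _ _).trans (by rw [hx, smul_zero])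
  · refine fibreHom_of_mem_highModes B b _ hB hB' A hA (fun a n hn => ?_)
      ((univVec_smul_eq_zero_iff B N u).mp ((hzero u).mp hu))
    rw [← Submodule.Quotient.mk_smul, smul_eq_mul, mul_one, Submodule.Quotient.mk_eq_zero]
    exact Submodule.subset_span ⟨(), a, n, hn, rfl⟩

end Fibres

/-! ### Smooth vectors and smooth modules. -/

section Smooth

variable {S : Type*} [CommRing S] [Algebra ℂ S] {σ : Type*}
  {g : Type*} [LieRing g] [LieAlgebra ℂ g] {B : LinearMap.BilinForm ℂ g} {k : σ → S}
  {V : Type*} [AddCommGroup V] [Module (ModeAlgebra S B k) V]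

variable (S B k) in
/-- Vectors that are killed by all modes of sufficiently large degree. -/
def IsSmoothVector (x : V) : Prop :=
  ∃ N : ℤ, ∀ n ≥ N, ∀ (s : σ) (a : g), mode S B k s a n • x = 0

lemma IsSmoothVector.add {x y : V} (hx : IsSmoothVector S B k x) (hy : IsSmoothVector S B k y) :
    IsSmoothVector S B k (x + y) := by
  obtain ⟨N, hN⟩ := hx
  obtain ⟨N', hN'⟩ := hy
  refine ⟨max N N', fun n hn s a => ?_⟩
  rw [smul_add, hN n (le_trans (le_max_left _ _) hn), hN' n (le_trans (le_max_right _ _) hn),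
    add_zero]

lemma IsSmoothVector.mode_smul {x : V} (hx : IsSmoothVector S B k x) (t : σ) (b : g) (m : ℤ) :
    IsSmoothVector S B k (mode S B k t b m • x) := by
  obtain ⟨N, hN⟩ := hx
  -- The bound `N - m` makes the bracket mode kill `x`, and `1 - m` forces `n + m > 0`, which
  -- removes the central term.
  refine ⟨max N (max (N - m) (1 - m)), fun n hn s a => ?_⟩
  have h1 : N ≤ n := le_trans (le_max_left _ _) hn
  have h2 : N - m ≤ n := le_trans (le_trans (le_max_left _ _) (le_max_right _ _)) hn
  have h3 : 1 - m ≤ n := le_trans (le_trans (le_max_right _ _) (le_max_right _ _)) hn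
  rw [← mul_smul]
  by_cases hst : s = t
  · subst hst
    rw [mode_mul, if_neg (by omega), map_zero, add_zero, add_smul, mul_smul, hN n h1, smul_zero,
      hN (n + m) (by omega), add_zero]
  · rw [mode_mul_of_ne hst, mul_smul, hN n h1, smul_zero]

lemma IsSmoothVector.smul {x : V} (hx : IsSmoothVector S B k x) (u : ModeAlgebra S B k) :
    IsSmoothVector S B k (u • x) := by
  let P : Subalgebra S (ModeAlgebra S B k) :=
    { carrier := {u | ∀ x : V, IsSmoothVector S B k x → IsSmoothVector S B k (u • x)}
      mul_mem' := fun {u u'} hu hu' x hx => by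
        rw [mul_smul]
        exact hu _ (hu' x hx)
      add_mem' := fun {u u'} hu hu' x hx => by
        rw [add_smul]
        exact (hu x hx).add (hu' x hx)
      algebraMap_mem' := fun c x hx => by
        obtain ⟨N, hN⟩ := hx
        refine ⟨N, fun n hn s a => ?_⟩
        rw [← mul_smul, ← Algebra.commutes, mul_smul, hN n hn, smul_zero] }
  exact mode_induction P (fun s a n x hx => hx.mode_smul s a n) u x hx

end Smooth

section SmoothModules

variable {g : Type*} [LieRing g] [LieAlgebra ℂ g] (B : LinearMap.BilinForm ℂ g)

theorem isSmooth_univSmooth (N : ℕ) : IsSmooth (RatFunc ℂ) B ![kap - 1, 1] (UnivSmooth B N) := by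
  intro x
  obtain ⟨u, rfl⟩ := Submodule.Quotient.mk_surjective _ x
  have h : IsSmoothVector (RatFunc ℂ) B (![kap - 1, 1] : Fin 2 → RatFunc ℂ) (univVec B N) :=
    ⟨N, fun n hn s a => (univVec_smul_eq_zero_iff B N _).mpr
      (Submodule.subset_span ⟨s, a, n, hn, rfl⟩)⟩
  have h' := h.smul u
  rw [univVec, ← Submodule.Quotient.mk_smul, smul_eq_mul, mul_one] at h'
  exact h'

lemma isSmooth_coinv (A : Connection g) {V : Type*} [AddCommGroup V] [Module (Generic B) V]
    (hV : IsSmooth (RatFunc ℂ) B ![kap - 1, 1] V) (M : Submodule (intForm B) V) :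
    IsSmooth ℂ B (fun _ : Unit => (1 : ℂ)) (Coinv B A M) := by
  intro y
  obtain ⟨z, rfl⟩ := Coinv.mk_surjective B A y
  obtain ⟨N, hN⟩ := hV (z : V)
  refine ⟨N, fun n hn s a => ?_⟩
  rw [Coinv.levelOne_smul, ← Coinv.mk_smul]
  have : inclOne B (mode ℂ B (fun _ : Unit => (1 : ℂ)) s a n) • z = 0 := by
    refine Subtype.ext ?_
    change (inclOne B (modeOne B a n) : Generic B) • (z : V) = 0
    rw [inclOne_modeOne_coe]
    exact hN n hn 1 a
  rw [this]
  rfl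

end SmoothModules

/-! ### Normally ordered sums on a smooth vector are finite. -/

section FiniteWindow

variable {F : Type*} [Field F] {U : Type*} [Ring U] [Algebra F U] {W : Type*} [AddCommGroup W]
  [Module U W] {g ι : Type*} [Fintype ι]

lemma finsum_eq_sum_Icc {W : Type*} [AddCommGroup W] {f : ℤ → W} {K : ℤ}
    (h1 : ∀ m, m < -K → f m = 0) (h2 : ∀ m, K < m → f m = 0) :
    ∑ᶠ m, f m = ∑ m ∈ Finset.Icc (-K) K, f m := by
  refine finsum_eq_sum_of_support_subset _ fun m hm => ?_
  rw [Function.mem_support] at hm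
  rw [Finset.coe_Icc, Set.mem_Icc]
  constructor
  · by_contra h
    exact hm (h1 m (not_le.mp h))
  · by_contra h
    exact hm (h2 m (not_le.mp h))

/-- Normal ordering places on the right the factor whose degree is large: `n - m` when `m` is very
negative, `m` when it is very positive. -/
lemma normalOrdered_smul_eq_zero {J : g → ℤ → U} {x : W} {N K n : ℤ}
    (hx : ∀ a, ∀ k ≥ N, J a k • x = 0) (hNK : N ≤ K) (h0 : 0 ≤ K) (hn : N - n ≤ K) (a b : g) {m : ℤ}
    (hm : m < -K ∨ K < m) : normalOrdered J a b m (n - m) • x = 0 := by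
  rcases hm with hm | hm
  · rw [normalOrdered, if_pos (by omega), mul_smul, hx b _ (by omega), smul_zero]
  · rw [normalOrdered, if_neg (by omega), mul_smul, hx a _ (by omega), smul_zero]

lemma sugawara_eq_sum {J : g → ℤ → U} {x : W} {N K n : ℤ}
    (hx : ∀ a, ∀ k ≥ N, J a k • x = 0) (hNK : N ≤ K) (h0 : 0 ≤ K) (hn : N - n ≤ K) (k h : F)
    (v w : ι → g) : sugawara J k h v w n x = algebraMap F U (2 * (k + h))⁻¹ •
      ∑ m ∈ Finset.Icc (-K) K, ∑ i, normalOrdered J (v i) (w i) m (n - m) • x := by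
  rw [sugawara, finsum_eq_sum_Icc (K := K)]
  · exact fun m hm => Finset.sum_eq_zero fun i _ =>
      normalOrdered_smul_eq_zero hx hNK h0 hn _ _ (Or.inl hm)
  · exact fun m hm => Finset.sum_eq_zero fun i _ =>
      normalOrdered_smul_eq_zero hx hNK h0 hn _ _ (Or.inr hm)

end FiniteWindow

/-! ### Expansions in dual bases. -/

section DualBases

variable {g : Type*} [LieRing g] [LieAlgebra ℂ g] {B : LinearMap.BilinForm ℂ g}
  {ι : Type*} [Fintype ι] [DecidableEq ι] {v w : Module.Basis ι ℂ g}

lemma sum_dual_smul (hvw : ∀ i j, B (w i) (v j) = if i = j then 1 else 0) (x : g) :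
    ∑ i, B x (v i) • w i = x := by
  conv_rhs => rw [← w.sum_repr x]
  refine Finset.sum_congr rfl fun i _ => ?_
  have := congrArg (fun y => B y (v i)) (w.sum_repr x)
  simp only [map_sum, LinearMap.sum_apply, map_smul, LinearMap.smul_apply, hvw, smul_eq_mul,
    mul_ite, mul_one, mul_zero, Finset.sum_ite_eq', Finset.mem_univ, if_true] at this
  rw [this]

lemma modeOne_add (a b : g) (n : ℤ) : modeOne B (a + b) n = modeOne B a n + modeOne B b n :=
  mode_add _ _ _ _ _ _ _

lemma modeOne_smul (c : ℂ) (a : g) (n : ℤ) : modeOne B (c • a) n = c • modeOne B a n :=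
  mode_smul _ _ _ _ _ _ _

/-- The modes of level one of degree `n`, as a linear map. -/
def modeOneLin (B : LinearMap.BilinForm ℂ g) (n : ℤ) : g →ₗ[ℂ] LevelOne B where
  toFun a := modeOne B a n
  map_add' a b := modeOne_add a b n
  map_smul' c a := modeOne_smul c a n

lemma modeOne_zero (n : ℤ) : modeOne B 0 n = 0 := map_zero (modeOneLin B n)

lemma modeOne_sum_smul {κ : Type*} (s : Finset κ) (c : κ → ℂ) (a : κ → g) (n : ℤ) :
    modeOne B (∑ i ∈ s, c i • a i) n = ∑ i ∈ s, c i • modeOne B (a i) n := by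
  change modeOneLin B n _ = ∑ i ∈ s, c i • modeOneLin B n (a i)
  rw [map_sum]
  simp only [map_smul]

lemma sum_dual_modeOne_smul {W : Type*} [AddCommGroup W] [Module (LevelOne B) W]
    (hvw : ∀ i j, B (w i) (v j) = if i = j then 1 else 0) (x : g) (n : ℤ) (y : W) :
    ∑ i, (B x (v i) • modeOne B (w i) n) • y = modeOne B x n • y := by
  rw [← Finset.sum_smul, ← modeOne_sum_smul, sum_dual_smul hvw]

lemma sum_dual_mul (hvw : ∀ i j, B (w i) (v j) = if i = j then 1 else 0) (x y : g) :
    ∑ i, B x (w i) * B y (v i) = B x y := by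
  conv_rhs => rw [← sum_dual_smul hvw y, map_sum]
  refine Finset.sum_congr rfl fun i _ => ?_
  rw [map_smul, smul_eq_mul, mul_comm]

end DualBases

/-! ### The coset operators on integral forms and on fibres. -/

section CosetOperators

lemma kap_add_eq (c : ℂ) : kap + algebraMap ℂ (RatFunc ℂ) c =
    algebraMap (Polynomial ℂ) (RatFunc ℂ) (Polynomial.X + Polynomial.C c) := by
  rw [map_add, RatFunc.algebraMap_X, RatFunc.algebraMap_C, RatFunc.algebraMap_eq_C, kap]

lemma kap_add_ne_zero (c : ℂ) : kap + algebraMap ℂ (RatFunc ℂ) c ≠ 0 := by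
  rw [kap_add_eq]
  exact RatFunc.algebraMap_ne_zero (Polynomial.X_add_C_ne_zero c)

/-- The function `κ / (κ + c)`. -/
def shiftRatio (c : ℂ) : regularAtInfinity :=
  ⟨kap * (kap + algebraMap ℂ (RatFunc ℂ) c)⁻¹, by
    rw [mem_regularAtInfinity, RatFunc.intDegree_mul kap_ne_zero (inv_ne_zero (kap_add_ne_zero c)),
      RatFunc.intDegree_inv, kap_add_eq, RatFunc.intDegree_polynomial,
      Polynomial.natDegree_X_add_C, kap, RatFunc.intDegree_X]
    simp⟩

lemma valueAtInfinity_shiftRatio (c : ℂ) : valueAtInfinity (shiftRatio c) = 1 := by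
  refine valueFun_eq (f₁ := algebraMap ℂ (RatFunc ℂ) (-c) * shiftRatio c)
    (mul_mem (algebraMap_mem _ _) (shiftRatio c).2) ?_
  have := kap_add_ne_zero c
  change kap * (kap + algebraMap ℂ (RatFunc ℂ) c)⁻¹ = algebraMap ℂ (RatFunc ℂ) 1 + kap⁻¹ *
    (algebraMap ℂ (RatFunc ℂ) (-c) * (kap * (kap + algebraMap ℂ (RatFunc ℂ) c)⁻¹))
  rw [map_one, map_neg]
  field_simp [kap_ne_zero]
  ring

variable {g : Type*} [LieRing g] [LieAlgebra ℂ g] (B : LinearMap.BilinForm ℂ g)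

/-- Functions regular at infinity in the integral form. -/
def reg (f : regularAtInfinity) : intForm B := regularElt B f f.2

lemma Coinv.reg_smul (A : Connection g) {M : Type*} [AddCommGroup M] [Module (intForm B) M]
    (f : regularAtInfinity) (y : Coinv B A M) :
    reg B f • y = algebraMap ℂ (LevelOne B) (valueAtInfinity f) • y := by
  obtain ⟨f', hf', e⟩ := valueFun_spec f
  have : reg B f = algebraMap ℂ _ (valueFun f) + kapInv B * regularElt B f' hf' := by
    refine Subtype.ext ?_
    change algebraMap (RatFunc ℂ) (Generic B) f = algebraMap ℂ (Generic B) _ +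
      algebraMap _ _ kap⁻¹ * algebraMap _ _ f'
    rw [IsScalarTower.algebraMap_apply ℂ (RatFunc ℂ) (Generic B), ← map_mul, ← map_add, ← e]
  rw [this, add_smul, mul_smul, Coinv.kapInv_smul, add_zero, Coinv.algebraMap_smul]
  rfl

lemma coset_combination {F V : Type*} [Field F] [AddCommGroup V] [Module F V]
    {a₁ a₂ a₃ c₁ c₂ c₃ : F} (h₁ : a₁ = c₁ - c₃) (h₂ : a₂ = c₁) (h₃ : a₃ = c₁) (x y z t : V) :
    a₁ • x - a₂ • (y + z) + a₃ • t + c₂ • t = c₁ • (x - y - (z - t)) + c₂ • t - c₃ • x := by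
  subst h₁ h₂ h₃
  module

/-- The contribution of a pair of modes to the coset Virasoro operators. -/
def cosetTerm (h : ℂ) (a b : g) (p q : ℤ) : intForm B :=
  reg B ((1 / 2 : ℂ) • (shiftRatio (h - 1) * shiftRatio h)) * (scaledDiag B a p * scaledDiag B b q) -
  reg B ((1 / 2 : ℂ) • shiftRatio (h - 1)) * (scaledDiag B a p * inclOne B (modeOne B b q) +
    inclOne B (modeOne B a p) * scaledDiag B b q) +
  reg B ((1 / 2 : ℂ) • (hbar * shiftRatio (h - 1))) *
    (inclOne B (modeOne B a p) * inclOne B (modeOne B b q)) +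
  algebraMap ℂ _ (2 * (1 + h))⁻¹ * (inclOne B (modeOne B a p) * inclOne B (modeOne B b q))

/-- Substitute `X = D - Y`. The coefficient of `D D` is `1/(2(κ-1+h)) - 1/(2(κ+h)) =
1/(2(κ-1+h)(κ+h))`, of order `κ⁻²`, just enough for two rescaled modes; the mixed coefficient is of
order `κ⁻¹`, enough for one. This difference is why the coset combination preserves integral forms
although its third summand alone has a pole. -/
lemma cosetTerm_coe (h : ℂ) (a b : g) (p q : ℤ) : (cosetTerm B h a b p q : Generic B) =
    (2 * (kap - 1 + algebraMap ℂ (RatFunc ℂ) h))⁻¹ • (modeX B a p * modeX B b q) +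
    (2 * (1 + algebraMap ℂ (RatFunc ℂ) h))⁻¹ • (modeY B a p * modeY B b q) -
    (2 * (kap + algebraMap ℂ (RatFunc ℂ) h))⁻¹ • (modeDiag B a p * modeDiag B b q) := by
  have hX : ∀ a n, modeX B a n = modeDiag B a n - modeY B a n := fun a n => by
    rw [modeDiag, add_sub_cancel_right]
  have h1 : kap - 1 + algebraMap ℂ (RatFunc ℂ) h ≠ 0 := by
    have := kap_add_ne_zero (h - 1)
    rwa [map_sub, map_one, add_sub_assoc', add_sub_right_comm] at this
  have h2 := kap_add_ne_zero h
  have e1 : (shiftRatio (h - 1) : RatFunc ℂ) = kap * (kap - 1 + algebraMap ℂ (RatFunc ℂ) h)⁻¹ := by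
    change kap * (kap + algebraMap ℂ (RatFunc ℂ) (h - 1))⁻¹ = _
    rw [map_sub, map_one, add_sub_assoc', add_sub_right_comm]
  have e2 : (shiftRatio h : RatFunc ℂ) = kap * (kap + algebraMap ℂ (RatFunc ℂ) h)⁻¹ := rfl
  have hhalf : algebraMap ℂ (RatFunc ℂ) (1 / 2) = 2⁻¹ := by
    rw [one_div, map_inv₀, map_ofNat]
  have hc : algebraMap ℂ (RatFunc ℂ) (2 * (1 + h))⁻¹ =
      (2 * (1 + algebraMap ℂ (RatFunc ℂ) h))⁻¹ := by
    rw [map_inv₀, map_mul, map_add, map_one, map_ofNat]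
  have hcoe : (cosetTerm B h a b p q : Generic B) =
    algebraMap (RatFunc ℂ) _ ((1 / 2 : ℂ) • ((shiftRatio (h - 1) : RatFunc ℂ) * shiftRatio h)) *
      ((kap⁻¹ • modeDiag B a p) * (kap⁻¹ • modeDiag B b q)) -
    algebraMap (RatFunc ℂ) _ ((1 / 2 : ℂ) • (shiftRatio (h - 1) : RatFunc ℂ)) *
      ((kap⁻¹ • modeDiag B a p) * modeY B b q + modeY B a p * (kap⁻¹ • modeDiag B b q)) +
    algebraMap (RatFunc ℂ) _ ((1 / 2 : ℂ) • (kap⁻¹ * (shiftRatio (h - 1) : RatFunc ℂ))) *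
      (modeY B a p * modeY B b q) +
    algebraMap (RatFunc ℂ) _ (algebraMap ℂ (RatFunc ℂ) (2 * (1 + h))⁻¹) *
      (modeY B a p * modeY B b q) := by
    rw [← inclOne_modeOne_coe, ← inclOne_modeOne_coe, ← algebraMap_intForm_coe]
    rfl
  rw [hcoe, hX, hX, hc, e1, e2]
  rw [← Algebra.smul_def, ← Algebra.smul_def, ← Algebra.smul_def, ← Algebra.smul_def,
    smul_mul_smul_comm, smul_mul_assoc kap⁻¹, mul_smul_comm kap⁻¹, ← smul_add kap⁻¹, smul_smul,
    smul_smul, sub_mul, mul_sub, mul_sub]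
  simp only [Algebra.smul_def (R := ℂ), hhalf]
  refine coset_combination ?_ ?_ ?_ _ _ _ _ <;> field_simp [kap_ne_zero]
  ring

/-- In the limit both ratios `κ / (κ + c)` become `1`, the extra `κ⁻¹` on the product of level one
modes becomes `0`, and the rescaled diagonal modes become the scalars given by `A`. -/
lemma Coinv.cosetTerm_smul (h : ℂ) (a b : g) (p q : ℤ) (A : Connection g) {M : Type*}
    [AddCommGroup M] [Module (intForm B) M] (y : Coinv B A M) :
    cosetTerm B h a b p q • y =
      algebraMap ℂ (LevelOne B) (2 * (1 + h))⁻¹ • (modeOne B a p * modeOne B b q) • y -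
      algebraMap ℂ (LevelOne B) (1 / 2) •
        ((B (A.1 p) a • modeOne B b q) • y + (B (A.1 q) b • modeOne B a p) • y) +
      algebraMap ℂ (LevelOne B) (1 / 2 * (B (A.1 p) a * B (A.1 q) b)) • y := by
  rw [cosetTerm, add_smul, add_smul, sub_smul, mul_smul, mul_smul, mul_smul, mul_smul,
    Coinv.reg_smul, Coinv.reg_smul, Coinv.reg_smul, add_smul, mul_smul, mul_smul, mul_smul,
    mul_smul, Coinv.scaledDiag_smul, Coinv.scaledDiag_smul, Coinv.scaledDiag_smul,
    Coinv.algebraMap_smul, Coinv.algebraMap_smul, Coinv.algebraMap_smul]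
  simp only [map_mul, valueAtInfinity_shiftRatio, valueAtInfinity_hbar, ← Coinv.levelOne_smul,
    mul_one, mul_zero, map_zero, zero_smul, add_zero, Algebra.smul_def, mul_smul, AlgHom.commutes,
    Algebra.algebraMap_self, RingHom.id_apply]
  rw [Coinv.algebraMap_smul, ← mul_smul (modeOne B a p) (algebraMap ℂ (LevelOne B) _),
    ← Algebra.commutes, mul_smul]
  abel

lemma sum_window {U W κ : Type*} [Ring U] [Algebra ℂ U] [AddCommGroup W] [Module U W]
    (s : Finset κ) (c d : ℂ) (f p q : κ → W) (t : κ → ℂ) (Z : W) :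
    ∑ m ∈ s, (algebraMap ℂ U c • f m - algebraMap ℂ U d • (p m + q m) +
      algebraMap ℂ U (d * t m) • Z) = algebraMap ℂ U c • ∑ m ∈ s, f m -
      algebraMap ℂ U d • (∑ m ∈ s, p m + ∑ m ∈ s, q m) + algebraMap ℂ U (d * ∑ m ∈ s, t m) • Z := by
  rw [Finset.sum_add_distrib, Finset.sum_sub_distrib, ← Finset.smul_sum, ← Finset.smul_sum,
    Finset.sum_add_distrib, ← Finset.sum_smul, ← map_sum, ← Finset.mul_sum]

variable {ι : Type*} [Fintype ι] [DecidableEq ι] (v w : Module.Basis ι ℂ g)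

/-- The substitution `m ↦ n - m` identifies the two linear sums, so half of each makes up the single
linear term; all sums fit in one common window. -/
lemma deformedL_eq_sum (h : ℂ) {A : Connection g} {W : Type*} [AddCommGroup W]
    [Module (LevelOne B) W] {Z : W} {N K n : ℤ} (hO : ∀ a, ∀ k ≥ N, modeOne B a k • Z = 0)
    (hA : ∀ k ≥ N, A.1 k = 0) (hNK : N ≤ K) (h0 : 0 ≤ K) (hn : N - n ≤ K) :
    deformedL B h v w A n Z =
      algebraMap ℂ (LevelOne B) (2 * (1 + h))⁻¹ • ∑ m ∈ Finset.Icc (-K) K,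
        ∑ i, normalOrdered (modeOne B) (v i) (w i) m (n - m) • Z -
      algebraMap ℂ (LevelOne B) (1 / 2) • (∑ m ∈ Finset.Icc (-K) K, modeOne B (A.1 m) (n - m) • Z +
        ∑ m ∈ Finset.Icc (-K) K, modeOne B (A.1 (n - m)) m • Z) +
      algebraMap ℂ (LevelOne B) (1 / 2 * ∑ m ∈ Finset.Icc (-K) K, B (A.1 m) (A.1 (n - m))) • Z := by
  rw [deformedL, sugawara_eq_sum hO hNK h0 hn]
  have f1 : ∑ᶠ m, modeOne B (A.1 (n - m)) m • Z =
      ∑ m ∈ Finset.Icc (-K) K, modeOne B (A.1 (n - m)) m • Z :=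
    finsum_eq_sum_Icc (fun m hm => by rw [hA (n - m) (by omega), modeOne_zero, zero_smul])
      (fun m hm => hO _ m (by omega))
  have f2 : ∑ᶠ m, modeOne B (A.1 m) (n - m) • Z =
      ∑ m ∈ Finset.Icc (-K) K, modeOne B (A.1 m) (n - m) • Z :=
    finsum_eq_sum_Icc (fun m hm => hO _ (n - m) (by omega))
      (fun m hm => by rw [hA m (by omega), modeOne_zero, zero_smul])
  have f3 : ∑ᶠ m, modeOne B (A.1 m) (n - m) • Z = ∑ᶠ m, modeOne B (A.1 (n - m)) m • Z := by
    rw [← finsum_comp_equiv (Equiv.subLeft n)]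
    simp
  have f4 : ∑ᶠ m, B (A.1 m) (A.1 (n - m)) = ∑ m ∈ Finset.Icc (-K) K, B (A.1 m) (A.1 (n - m)) :=
    finsum_eq_sum_Icc (fun m hm => by rw [hA (n - m) (by omega), map_zero])
      (fun m hm => by rw [hA m (by omega), map_zero, LinearMap.zero_apply])
  rw [← f1, ← f2, f3, ← f4, ← two_smul ℕ, ← Nat.cast_smul_eq_nsmul (LevelOne B), ← mul_smul]
  have : algebraMap ℂ (LevelOne B) (1 / 2) * ((2 : ℕ) : LevelOne B) = 1 := by
    rw [← map_natCast (algebraMap ℂ (LevelOne B)), ← map_mul]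
    norm_num
  rw [this, one_smul]

/-- On a fixed vector the three Sugawara sums share a finite window and the same normal ordering, so
they combine term by term into elements of the integral form. Summing over dual bases then turns
`⟨A_m, v i⟩ (w i)` into `A_m`. -/
theorem cosetL_descends (h : ℂ) (hwv : ∀ i j, B (w i) (v j) = if i = j then 1 else 0)
    (hvw : ∀ i j, B (v i) (w j) = if i = j then 1 else 0)
    (A : Connection g) {V : Type*} [AddCommGroup V] [Module (Generic B) V]
    (hV : IsSmooth (RatFunc ℂ) B ![kap - 1, 1] V) (M : Submodule (intForm B) V) (n : ℤ) (z : M) :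
    ∃ hz : cosetL B h v w n (z : V) ∈ M,
      Coinv.mk B A (⟨cosetL B h v w n (z : V), hz⟩ : M) =
        deformedL B h v w A n (Coinv.mk B A z) := by
  obtain ⟨N₁, hN₁⟩ := hV (z : V)
  obtain ⟨N₂, hN₂⟩ := A.2
  obtain ⟨N, hN1, hN2⟩ : ∃ N, N₁ ≤ N ∧ N₂ ≤ N := ⟨max N₁ N₂, le_max_left _ _, le_max_right _ _⟩
  have hX : ∀ a, ∀ k ≥ N, modeX B a k • (z : V) = 0 := fun a k hk => hN₁ k (hN1.trans hk) 0 a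
  have hY : ∀ a, ∀ k ≥ N, modeY B a k • (z : V) = 0 := fun a k hk => hN₁ k (hN1.trans hk) 1 a
  have hD : ∀ a, ∀ k ≥ N, modeDiag B a k • (z : V) = 0 := fun a k hk => by
    rw [modeDiag, add_smul, hX a k hk, hY a k hk, add_zero]
  have hA : ∀ k ≥ N, A.1 k = 0 := fun k hk => hN₂ k (hN2.trans hk)
  have hO : ∀ a, ∀ k ≥ N, modeOne B a k • Coinv.mk B A z = 0 := fun a k hk => by
    rw [Coinv.levelOne_smul, ← Coinv.mk_smul]
    have : inclOne B (modeOne B a k) • z = 0 := Subtype.ext (by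
      change (inclOne B (modeOne B a k) : Generic B) • (z : V) = 0
      rw [inclOne_modeOne_coe, hY a k hk])
    rw [this]
    rfl
  -- One window must cut off the sums at all three levels as well as those involving `A`.
  obtain ⟨K, hK1, hK2, hK3⟩ : ∃ K, N ≤ K ∧ 0 ≤ K ∧ N - n ≤ K :=
    ⟨max N (max 0 (N - n)), le_max_left _ _, le_trans (le_max_left _ _) (le_max_right _ _),
      le_trans (le_max_right _ _) (le_max_right _ _)⟩
  -- the coset operator as a finite sum of elements of the integral form
  let T : ℤ → ι → intForm B := fun m i =>
    if m < 0 then cosetTerm B h (v i) (w i) m (n - m) else cosetTerm B h (w i) (v i) (n - m) m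
  have hcos : cosetL B h v w n (z : V) =
      ((∑ m ∈ Finset.Icc (-K) K, ∑ i, T m i • z : M) : V) := by
    rw [cosetL, sugawara_eq_sum hX hK1 hK2 hK3, sugawara_eq_sum hY hK1 hK2 hK3,
      sugawara_eq_sum hD hK1 hK2 hK3]
    simp only [Finset.smul_sum]
    rw [← Finset.sum_add_distrib, ← Finset.sum_sub_distrib, AddSubmonoidClass.coe_finsetSum]
    refine Finset.sum_congr rfl fun m _ => ?_
    rw [← Finset.sum_add_distrib, ← Finset.sum_sub_distrib, AddSubmonoidClass.coe_finsetSum]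
    refine Finset.sum_congr rfl fun i _ => ?_
    change _ = (T m i : Generic B) • (z : V)
    simp only [T, normalOrdered]
    split_ifs
    all_goals
      rw [cosetTerm_coe, sub_smul, add_smul, Algebra.smul_def, Algebra.smul_def, Algebra.smul_def,
        mul_smul (algebraMap _ _ _) (modeX B _ _ * _), mul_smul (algebraMap _ _ _) (modeY B _ _ * _),
        mul_smul (algebraMap _ _ _) (modeDiag B _ _ * _)]
  have hmem : cosetL B h v w n (z : V) ∈ M := by
    rw [hcos]
    exact SetLike.coe_mem _
  refine ⟨hmem, ?_⟩
  have e1 : (⟨cosetL B h v w n (z : V), hmem⟩ : M) = ∑ m ∈ Finset.Icc (-K) K, ∑ i, T m i • z :=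
    Subtype.ext hcos
  have hmk : Coinv.mk B A (∑ m ∈ Finset.Icc (-K) K, ∑ i, T m i • z) =
      ∑ m ∈ Finset.Icc (-K) K, ∑ i, T m i • Coinv.mk B A z := by
    change (coinvKer B A M).mkQ _ = _
    simp only [map_sum, map_smul]
    rfl
  rw [e1, hmk]
  set Z := Coinv.mk B A z with hZ
  have hT : ∀ m i, T m i • Z =
      algebraMap ℂ (LevelOne B) (2 * (1 + h))⁻¹ •
        normalOrdered (modeOne B) (v i) (w i) m (n - m) • Z -
      algebraMap ℂ (LevelOne B) (1 / 2) • ((B (A.1 m) (v i) • modeOne B (w i) (n - m)) • Z +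
        (B (A.1 (n - m)) (w i) • modeOne B (v i) m) • Z) +
      algebraMap ℂ (LevelOne B) (1 / 2 * (B (A.1 m) (v i) * B (A.1 (n - m)) (w i))) • Z := by
    intro m i
    simp only [T, normalOrdered]
    split_ifs
    · rw [Coinv.cosetTerm_smul]
    · rw [Coinv.cosetTerm_smul, mul_comm (B (A.1 (n - m)) (w i)),
        add_comm ((B (A.1 (n - m)) (w i) • modeOne B (v i) m) • Z)]
  have hinner : ∀ m, ∑ i, T m i • Z =
      algebraMap ℂ (LevelOne B) (2 * (1 + h))⁻¹ •
        ∑ i, normalOrdered (modeOne B) (v i) (w i) m (n - m) • Z -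
      algebraMap ℂ (LevelOne B) (1 / 2) • (modeOne B (A.1 m) (n - m) • Z +
        modeOne B (A.1 (n - m)) m • Z) +
      algebraMap ℂ (LevelOne B) (1 / 2 * B (A.1 m) (A.1 (n - m))) • Z := by
    intro m
    simp only [hT]
    rw [sum_window, sum_dual_modeOne_smul hwv, sum_dual_modeOne_smul hvw, sum_dual_mul hvw]
  simp only [hinner]
  rw [sum_window, deformedL_eq_sum B v w h hO hA hK1 hK2 hK3]

end CosetOperators

/-! ### Sums of finite support, with finiteness recorded next to the value. -/

section HasFinSum

variable {κ κ' W W' : Type*} [AddCommGroup W] [AddCommGroup W']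

/-- A family of finite support with sum `y`. -/
def HasFinSum (f : κ → W) (y : W) : Prop := f.support.Finite ∧ ∑ᶠ i, f i = y

lemma HasFinSum.add {f f' : κ → W} {y y' : W} (hf : HasFinSum f y) (hf' : HasFinSum f' y') :
    HasFinSum (fun i => f i + f' i) (y + y') :=
  ⟨(hf.1.union hf'.1).subset (Function.support_add f f'), by
    rw [finsum_add_distrib hf.1 hf'.1, hf.2, hf'.2]⟩

lemma HasFinSum.map {f : κ → W} {y : W} (hf : HasFinSum f y) (T : W →+ W') :
    HasFinSum (fun i => T (f i)) (T y) :=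
  ⟨hf.1.subset (Function.support_comp_subset (map_zero T) f), by rw [← hf.2, T.map_finsum hf.1]⟩

lemma HasFinSum.neg {f : κ → W} {y : W} (hf : HasFinSum f y) : HasFinSum (fun i => -f i) (-y) :=
  hf.map (negAddMonoidHom : W →+ W)

lemma HasFinSum.sub {f f' : κ → W} {y y' : W} (hf : HasFinSum f y) (hf' : HasFinSum f' y') :
    HasFinSum (fun i => f i - f' i) (y - y') := by
  simpa only [sub_eq_add_neg] using hf.add hf'.neg

lemma HasFinSum.comp_equiv {f : κ → W} {y : W} (hf : HasFinSum f y) (e : κ' ≃ κ) :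
    HasFinSum (fun i => f (e i)) y :=
  ⟨hf.1.preimage e.injective.injOn, by rw [← hf.2, ← finsum_comp_equiv e]⟩

lemma HasFinSum.comp_add {f : ℤ → W} {y : W} (hf : HasFinSum f y) (n : ℤ) :
    HasFinSum (fun i => f (i + n)) y :=
  hf.comp_equiv (Equiv.addRight n)

lemma HasFinSum.unique {f : κ → W} {y y' : W} (hf : HasFinSum f y) (hf' : HasFinSum f y') :
    y = y' := hf.2.symm.trans hf'.2

lemma HasFinSum.congr {f f' : κ → W} {y y' : W} (hf : HasFinSum f y) (h : ∀ i, f' i = f i)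
    (hy : y = y') : HasFinSum f' y' := by
  obtain rfl : f' = f := funext h
  exact hy ▸ hf

lemma hasFinSum_zero : HasFinSum (fun _ : κ => (0 : W)) 0 := by
  refine ⟨?_, finsum_zero⟩
  simp

lemma hasFinSum_single (i₀ : κ) {f : κ → W} (hf : ∀ i, i ≠ i₀ → f i = 0) :
    HasFinSum f (f i₀) :=
  ⟨(Set.finite_singleton i₀).subset fun i hi => by
    by_contra h
    exact hi (hf i h), finsum_eq_single f i₀ hf⟩

lemma hasFinSum_finsum {f : κ → W} (hf : f.support.Finite) : HasFinSum f (∑ᶠ i, f i) := ⟨hf, rfl⟩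

lemma finite_support_of_window {f : ℤ → W} {a b : ℤ} (h1 : ∀ m, m < a → f m = 0)
    (h2 : ∀ m, b < m → f m = 0) : f.support.Finite :=
  (Set.finite_Icc a b).subset fun m hm => by
    constructor
    · by_contra h
      exact hm (h1 m (not_le.mp h))
    · by_contra h
      exact hm (h2 m (not_le.mp h))

/-- Only the limits at the two ends matter, `0` on the left and `c` on the right. A nonzero right
limit is the source of both the Casimir shift and the central charge. -/
lemma hasFinSum_telescope_one {f : ℤ → W} {a b : ℤ} {c : W} (h1 : ∀ p, p < a → f p = 0)
    (h2 : ∀ p, b < p → f p = c) : HasFinSum (fun p => f p - f (p + 1)) (-c) := by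
  obtain ⟨k, hk⟩ : ∃ k : ℕ, b < a - 1 + k := ⟨(b - (a - 1) + 1).toNat, by omega⟩
  have hsub : (fun p => f p - f (p + 1)).support ⊆
      ((Finset.range k).map ⟨fun j : ℕ => a - 1 + j, fun i j h => by simpa using h⟩ : Finset ℤ) := by
    intro p hp
    rw [Finset.mem_coe, Finset.mem_map]
    have hp1 : a - 1 ≤ p := by
      by_contra h
      exact hp (by simp only [h1 p (by omega), h1 (p + 1) (by omega), sub_zero])
    have hp2 : p < a - 1 + k := by
      by_contra h
      exact hp (by simp only [h2 p (by omega), h2 (p + 1) (by omega), sub_self])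
    exact ⟨(p - (a - 1)).toNat, Finset.mem_range.mpr (by omega), by
      change a - 1 + (((p - (a - 1)).toNat : ℕ) : ℤ) = p
      omega⟩
  refine ⟨(Finset.finite_toSet _).subset hsub, ?_⟩
  rw [finsum_eq_sum_of_support_subset _ hsub, Finset.sum_map]
  have := Finset.sum_range_sub' (fun j : ℕ => f (a - 1 + j)) k
  simp only [Nat.cast_add, Nat.cast_one, ← add_assoc, Nat.cast_zero, add_zero] at this
  refine this.trans ?_
  rw [h1 _ (by omega), h2 _ hk, zero_sub]

lemma hasFinSum_telescope {f : ℤ → W} {a b : ℤ} {c : W} (h1 : ∀ p, p < a → f p = 0)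
    (h2 : ∀ p, b < p → f p = c) (n : ℤ) : HasFinSum (fun p => f p - f (p + n)) (-(n • c)) := by
  have hone := hasFinSum_telescope_one h1 h2
  induction n using Int.induction_on with
  | zero => simpa using hasFinSum_zero (κ := ℤ) (W := W)
  | succ n ih =>
    refine (ih.add (hone.comp_add n)).congr (fun p => ?_) ?_
    · rw [sub_add_sub_cancel, add_assoc]
    · rw [add_smul, one_smul]
      abel
  | pred n ih =>
    refine (ih.sub (hone.comp_add (-n - 1))).congr (fun p => ?_) ?_
    · have : p + (-n - 1) + 1 = p + -(n : ℤ) := by ring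
      rw [this]
      abel
    · rw [sub_smul, one_smul]
      abel

/-- Swapping the indices is a legitimate reordering of a finite sum, and it changes the sign of the
total. -/
lemma HasFinSum.eq_zero_of_antisymm [Module ℂ W] {f : κ × κ → W} {y : W}
    (hf : HasFinSum f y) (h : ∀ i j, f (i, j) = -f (j, i)) : y = 0 := by
  have e := hf.unique (((hf.comp_equiv (Equiv.prodComm κ κ)).neg).congr (y' := -y)
    (fun i => h i.1 i.2) rfl)
  have : (2 : ℂ) • y = 0 := by
    rw [two_smul]
    nth_rewrite 1 [e]
    exact neg_add_cancel y
  exact (smul_eq_zero.mp this).resolve_left two_ne_zero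

/-- Lets a single sum along the antidiagonal be compared with a double sum over all pairs of
indices. -/
lemma HasFinSum.graph {c : ℤ → W} {y : W} (hc : HasFinSum c y) (M : ℤ) :
    HasFinSum (fun i : ℤ × ℤ => if i.1 + i.2 = M then c i.1 else 0) y := by
  have hfin : (fun i : ℤ × ℤ => if i.1 + i.2 = M then c i.1 else 0).support.Finite := by
    refine (hc.1.image fun r => (r, M - r)).subset ?_
    rintro ⟨r, s⟩ hrs
    rw [Function.mem_support] at hrs
    by_cases h : r + s = M
    · rw [if_pos h] at hrs
      exact ⟨r, hrs, Prod.ext rfl (by rw [← h]; exact add_sub_cancel_left r s)⟩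
    · exact absurd (if_neg h) hrs
  refine ⟨hfin, ?_⟩
  rw [finsum_curry _ hfin, ← hc.2]
  refine finsum_congr fun r => ?_
  rw [finsum_eq_single _ (M - r) fun s hs => if_neg (by
    intro h
    exact hs (by rw [← h, add_sub_cancel_left])), if_pos (add_sub_cancel r M)]

end HasFinSum

/-! ### Operators given by locally finite sums. -/

section LocallyFinite

variable {κ κ' W : Type*} [AddCommGroup W] [Module ℂ W]

/-- The sum of a locally finite family of operators. -/
def locSum (F : κ → Module.End ℂ W) (hF : ∀ x, (fun i => F i x).support.Finite) :
    Module.End ℂ W where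
  toFun x := ∑ᶠ i, F i x
  map_add' x y := by
    simp only [map_add]
    exact finsum_add_distrib (hF x) (hF y)
  map_smul' c x := by
    simp only [map_smul, RingHom.id_apply]
    exact (smul_finsum' c (hF x)).symm

lemma hasFinSum_locSum {F : κ → Module.End ℂ W} (hF : ∀ x, (fun i => F i x).support.Finite)
    (x : W) : HasFinSum (fun i => F i x) (locSum F hF x) := ⟨hF x, rfl⟩

lemma hasFinSum_bracket {F : κ → Module.End ℂ W} {T : Module.End ℂ W}
    (hF : ∀ x, HasFinSum (fun i => F i x) (T x)) (X : Module.End ℂ W) (x : W) :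
    HasFinSum (fun i => (F i * X - X * F i) x) ((T * X - X * T) x) :=
  (hF (X x)).sub ((hF x).map X.toAddMonoidHom)

/-- Local finiteness of `F` is used at each of the finitely many nonzero vectors `F' j x`, so the
double family again has finite support. -/
lemma hasFinSum_mul {F : κ → Module.End ℂ W} {T : Module.End ℂ W}
    {F' : κ' → Module.End ℂ W} {T' : Module.End ℂ W}
    (hF : ∀ x, HasFinSum (fun i => F i x) (T x)) (hF' : ∀ x, HasFinSum (fun i => F' i x) (T' x))
    (x : W) : HasFinSum (fun i : κ' × κ => (F i.2 * F' i.1) x) ((T * T') x) := by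
  have hfin : (fun i : κ' × κ => (F i.2 * F' i.1) x).support.Finite := by
    refine ((hF' x).1.biUnion fun j _ => ((hF (F' j x)).1.image (Prod.mk j))).subset ?_
    rintro ⟨j, i⟩ hij
    refine Set.mem_biUnion (x := j) ?_ ⟨i, hij, rfl⟩
    intro h
    apply hij
    change F i (F' j x) = 0
    have h : F' j x = 0 := h
    rw [h, map_zero]
  refine ⟨hfin, ?_⟩
  rw [finsum_curry _ hfin]
  refine Eq.trans ?_ ((hF' x).map T.toAddMonoidHom).2
  exact finsum_congr fun j => (hF (F' j x)).2

lemma hasFinSum_bracket_prod {F : κ → Module.End ℂ W} {T : Module.End ℂ W}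
    {F' : κ' → Module.End ℂ W} {T' : Module.End ℂ W}
    (hF : ∀ x, HasFinSum (fun i => F i x) (T x)) (hF' : ∀ x, HasFinSum (fun i => F' i x) (T' x))
    (x : W) : HasFinSum (fun i : κ × κ' => (F i.1 * F' i.2 - F' i.2 * F i.1) x)
      ((T * T' - T' * T) x) :=
  ((hasFinSum_mul hF hF' x).comp_equiv (Equiv.prodComm κ κ')).sub (hasFinSum_mul hF' hF x)

end LocallyFinite

/-! ### The canonical tensor of a pair of dual bases. -/

section DualTensor

variable {g : Type*} [LieRing g] [LieAlgebra ℂ g] {B : LinearMap.BilinForm ℂ g}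
  {ι : Type*} [Fintype ι] [DecidableEq ι] {v w : Module.Basis ι ℂ g}
  {E : Type*} [AddCommGroup E] [Module ℂ E]

/-- The tensor `∑ v i ⊗ w i` represents the form, so an operator on one leg can be moved to its
adjoint on the other. -/
lemma sum_dual_adjoint (hs : ∀ x y, B x y = B y x)
    (hvw : ∀ i j, B (v i) (w j) = if i = j then 1 else 0)
    (hwv : ∀ i j, B (w i) (v j) = if i = j then 1 else 0) (β : g →ₗ[ℂ] g →ₗ[ℂ] E)
    {T T' : g → g} (hT : ∀ x y, B (T x) y = B x (T' y)) :
    ∑ i, β (T (v i)) (w i) = ∑ i, β (v i) (T' (w i)) := by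
  have e1 : ∀ i, β (T (v i)) (w i) = ∑ j, B (T (v i)) (w j) • β (v j) (w i) := fun i => by
    conv_lhs => rw [← sum_dual_smul hvw (T (v i))]
    simp only [map_sum, map_smul, LinearMap.sum_apply, LinearMap.smul_apply]
  have e2 : ∀ j, β (v j) (T' (w j)) = ∑ i, B (T (v i)) (w j) • β (v j) (w i) := fun j => by
    conv_lhs => rw [← sum_dual_smul hwv (T' (w j))]
    simp only [map_sum, map_smul]
    exact Finset.sum_congr rfl fun i _ => by rw [hT, hs]
  simp only [e1, e2]
  exact Finset.sum_comm

lemma sum_dual_symm (hs : ∀ x y, B x y = B y x)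
    (hwv : ∀ i j, B (w i) (v j) = if i = j then 1 else 0) (β : g →ₗ[ℂ] g →ₗ[ℂ] E) :
    ∑ i, β (v i) (w i) = ∑ i, β (w i) (v i) := by
  have e1 : ∀ i, β (v i) (w i) = ∑ j, B (v i) (v j) • β (w j) (w i) := fun i => by
    conv_lhs => rw [← sum_dual_smul hwv (v i)]
    simp only [map_sum, map_smul, LinearMap.sum_apply, LinearMap.smul_apply]
  have e2 : ∀ j, β (w j) (v j) = ∑ i, B (v i) (v j) • β (w j) (w i) := fun j => by
    conv_lhs => rw [← sum_dual_smul hwv (v j)]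
    simp only [map_sum, map_smul]
    exact Finset.sum_congr rfl fun i _ => by rw [hs]
  simp only [e1, e2]
  exact Finset.sum_comm

lemma sum_dual_lie (hs : ∀ x y, B x y = B y x)
    (hwv : ∀ i j, B (w i) (v j) = if i = j then 1 else 0) : ∑ i, ⁅v i, w i⁆ = 0 := by
  have h := sum_dual_symm (v := v) (w := w) hs hwv (LieModule.toEnd ℂ g g : g →ₗ[ℂ] g →ₗ[ℂ] g)
  have h' : ∑ i, ⁅v i, w i⁆ = ∑ i, ⁅w i, v i⁆ := h
  have h'' : ∑ i, ⁅w i, v i⁆ = -∑ i, ⁅v i, w i⁆ := by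
    rw [← Finset.sum_neg_distrib]
    exact Finset.sum_congr rfl fun i _ => (lie_skew _ _).symm
  rw [h''] at h'
  have : (2 : ℂ) • ∑ i, ⁅v i, w i⁆ = 0 := by
    rw [two_smul]
    nth_rewrite 1 [h']
    exact neg_add_cancel _
  exact (smul_eq_zero.mp this).resolve_left two_ne_zero

end DualTensor

/-! ### Quadratic Casimir expressions in the modes. -/

section Virasoro

variable {g : Type*} [LieRing g] [LieAlgebra ℂ g]
  {ι : Type*} [Fintype ι] [DecidableEq ι]
  {W : Type*} [AddCommGroup W] [Module ℂ W]

/-- Operators `a_n = J n a` that satisfy the relations of level one and are smooth. -/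
structure IsSmoothRep (B : LinearMap.BilinForm ℂ g) (J : ℤ → g →ₗ[ℂ] Module.End ℂ W) : Prop where
  comm : ∀ a b m n, J m a * J n b =
    J n b * J m a + J (m + n) ⁅a, b⁆ + (if m + n = 0 then (m : ℂ) * B a b else 0) • 1
  smooth : ∀ x, ∃ N : ℤ, ∀ n ≥ N, ∀ a, J n a x = 0

/-- Dual bases for a symmetric invariant form for which the Casimir element of the adjoint
representation is `2 h`. -/
structure IsCasimirPair (B : LinearMap.BilinForm ℂ g) (h : ℂ) (v w : Module.Basis ι ℂ g) :
    Prop where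
  symm : ∀ x y, B x y = B y x
  invariant : ∀ x a y : g, B ⁅x, a⁆ y = B x ⁅a, y⁆
  dual : ∀ i j, B (v i) (w j) = if i = j then 1 else 0
  casimir : ∀ a : g, ∑ i, ⁅v i, ⁅w i, a⁆⁆ = (2 * h) • a

variable {B : LinearMap.BilinForm ℂ g} {h : ℂ} {v w : Module.Basis ι ℂ g}
  {J : ℤ → g →ₗ[ℂ] Module.End ℂ W}

lemma IsCasimirPair.dual' (hC : IsCasimirPair B h v w) (i j : ι) :
    B (w i) (v j) = if i = j then 1 else 0 := by
  rw [hC.symm, hC.dual]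
  simp only [eq_comm]

/-- The operator `∑ i, (v i)_p (w i)_q`. -/
def casimirTerm (J : ℤ → g →ₗ[ℂ] Module.End ℂ W) (v w : ι → g) (p q : ℤ) : Module.End ℂ W :=
  ∑ i, J p (v i) * J q (w i)

/-- The operator `∑ i, (v i)_p ⁅w i, a⁆_q`. -/
def casimirLie (J : ℤ → g →ₗ[ℂ] Module.End ℂ W) (v w : ι → g) (a : g) (p q : ℤ) :
    Module.End ℂ W :=
  ∑ i, J p (v i) * J q ⁅w i, a⁆

/-- The operator `∑ i, :(v i)_p (w i)_(n - p):`. -/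
def normalTerm (J : ℤ → g →ₗ[ℂ] Module.End ℂ W) (v w : ι → g) (n p : ℤ) : Module.End ℂ W :=
  ∑ i, normalOrdered (fun a k => J k a) (v i) (w i) p (n - p)

/-- The product of two modes as a bilinear map. -/
def modeProd (J : ℤ → g →ₗ[ℂ] Module.End ℂ W) (p q : ℤ) : g →ₗ[ℂ] g →ₗ[ℂ] Module.End ℂ W :=
  (LinearMap.mul ℂ (Module.End ℂ W)).compl₁₂ (J p) (J q)

lemma modeProd_apply (p q : ℤ) (a b : g) : modeProd J p q a b = J p a * J q b := rfl

lemma casimirTerm_symm (hC : IsCasimirPair B h v w) (p q : ℤ) :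
    ∑ i, J p (w i) * J q (v i) = casimirTerm J v w p q :=
  (sum_dual_symm hC.symm hC.dual' (modeProd J p q)).symm

/-- The bracket terms sum to `∑ [v i, w i] = 0`, and each dual pair contributes one central term,
giving the dimension. -/
lemma casimirTerm_swap (hJ : IsSmoothRep B J) (hC : IsCasimirPair B h v w) (p q : ℤ) :
    casimirTerm J v w p q = casimirTerm J v w q p +
      (if p + q = 0 then (p : ℂ) * Fintype.card ι else 0) • 1 := by
  rw [← casimirTerm_symm hC q p, casimirTerm]
  simp only [hJ.comm _ _ p q, hC.dual, Finset.sum_add_distrib, if_true, mul_one]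
  rw [← map_sum, sum_dual_lie hC.symm hC.dual', map_zero, add_zero, Finset.sum_const,
    Finset.card_univ, ← Nat.cast_smul_eq_nsmul ℂ, smul_smul, mul_ite, mul_zero, mul_comm]

/-- Normal ordering changes each term only by a scalar. It is therefore irrelevant inside
commutators, and the scalars resurface solely in the central charge. -/
lemma normalTerm_eq (hJ : IsSmoothRep B J) (hC : IsCasimirPair B h v w) (n p : ℤ) :
    normalTerm J v w n p = casimirTerm J v w p (n - p) -
      (if n = 0 then (if 0 ≤ p then (p : ℂ) * Fintype.card ι else 0) else 0) • 1 := by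
  rw [normalTerm]
  simp only [normalOrdered]
  by_cases hp : p < 0
  · simp only [if_pos hp, if_neg (not_le.mpr hp), ite_self, zero_smul, sub_zero]
    rfl
  · simp only [if_neg hp, if_pos (not_lt.mp hp)]
    rw [casimirTerm_symm hC, casimirTerm_swap hJ hC p, add_sub_cancel, add_sub_cancel_right]

lemma casimirLie_eq (hC : IsCasimirPair B h v w) (a : g) (p q : ℤ) :
    ∑ i, J p ⁅v i, a⁆ * J q (w i) = -casimirLie J v w a p q := by
  have := sum_dual_adjoint hC.symm hC.dual hC.dual' (modeProd J p q) (T := fun x => ⁅x, a⁆)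
    (T' := fun y => ⁅a, y⁆) (fun x y => hC.invariant x a y)
  simp only [modeProd_apply] at this
  rw [this, casimirLie, ← Finset.sum_neg_distrib]
  exact Finset.sum_congr rfl fun i _ => by rw [← lie_skew, map_neg, mul_neg]

lemma sum_dual_map (hC : IsCasimirPair B h v w) (p : ℤ) (a : g) :
    ∑ i, B (v i) a • J p (w i) = J p a := by
  conv_rhs => rw [← sum_dual_smul hC.dual' a]
  simp only [map_sum, map_smul]
  exact Finset.sum_congr rfl fun i _ => by rw [hC.symm]

lemma sum_dual_map' (hC : IsCasimirPair B h v w) (p : ℤ) (a : g) :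
    ∑ i, B (w i) a • J p (v i) = J p a := by
  conv_rhs => rw [← sum_dual_smul hC.dual a]
  simp only [map_sum, map_smul]
  exact Finset.sum_congr rfl fun i _ => by rw [hC.symm]

/-- By the Leibniz rule each factor yields a central term and a bracket term. Invariance moves the
second bracket onto `w i` with a sign, so the bracket terms form a difference shifted by `n`, ready
to telescope. -/
lemma casimirTerm_bracket (hJ : IsSmoothRep B J) (hC : IsCasimirPair B h v w) (a : g)
    (p q n : ℤ) : casimirTerm J v w p q * J n a - J n a * casimirTerm J v w p q =
      (if q + n = 0 then (q : ℂ) else 0) • J p a + (if p + n = 0 then (p : ℂ) else 0) • J q a +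
      (casimirLie J v w a p (q + n) - casimirLie J v w a (p + n) q) := by
  have e : ∀ i, J p (v i) * J q (w i) * J n a - J n a * (J p (v i) * J q (w i)) =
      (if q + n = 0 then (q : ℂ) else 0) • B (w i) a • J p (v i) +
      (if p + n = 0 then (p : ℂ) else 0) • B (v i) a • J q (w i) +
      (J p (v i) * J (q + n) ⁅w i, a⁆ + J (p + n) ⁅v i, a⁆ * J q (w i)) := by
    intro i
    rw [mul_assoc, hJ.comm (w i) a q n, ← mul_assoc (J n a), mul_add, mul_add, ← mul_assoc,
      hJ.comm (v i) a p n, add_mul, add_mul, mul_smul_comm, smul_mul_assoc, mul_one, one_mul,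
      smul_smul, smul_smul, ite_mul, ite_mul, zero_mul, zero_mul]
    abel
  rw [casimirTerm, Finset.sum_mul, Finset.mul_sum, ← Finset.sum_sub_distrib]
  simp only [e, Finset.sum_add_distrib]
  rw [← Finset.smul_sum, ← Finset.smul_sum, sum_dual_map hC, sum_dual_map' hC, casimirLie_eq hC,
    ← sub_eq_add_neg]
  rfl

/-- Reordering the two factors costs `∑ [v i, [w i, a]] = 2h a`; the central terms cancel by
invariance. -/
lemma casimirLie_add_swap (hJ : IsSmoothRep B J) (hC : IsCasimirPair B h v w) (a : g) (p q : ℤ) :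
    casimirLie J v w a p q = (2 * h) • J (p + q) a - casimirLie J v w a q p := by
  have e : casimirLie J v w a q p = -∑ i, J q ⁅w i, a⁆ * J p (v i) := by
    rw [← neg_eq_iff_eq_neg, ← casimirLie_eq hC]
    have := sum_dual_symm (v := v) (w := w) hC.symm hC.dual'
      ((modeProd J q p).comp (LieModule.toEnd ℂ g g a : g →ₗ[ℂ] g))
    simp only [LinearMap.comp_apply, LieModule.toEnd_apply_apply, modeProd_apply] at this
    simp only [← lie_skew _ a, map_neg, neg_mul, Finset.sum_neg_distrib, this]
  rw [e, sub_neg_eq_add, casimirLie]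
  simp only [hJ.comm (v _) _ p q, Finset.sum_add_distrib]
  rw [← map_sum, hC.casimir, map_smul, ← Finset.sum_smul]
  have : ∑ i, (if p + q = 0 then (p : ℂ) * B (v i) ⁅w i, a⁆ else 0) = 0 := by
    split_ifs
    · simp only [← hC.invariant]
      rw [← Finset.mul_sum, ← LinearMap.sum_apply, ← map_sum, sum_dual_lie hC.symm hC.dual',
        map_zero, LinearMap.zero_apply, mul_zero]
    · simp
  rw [this, zero_smul, add_zero, add_comm]

end Virasoro

/-! ### The Sugawara operators and their Virasoro relations. -/

section Virasoro

variable {g : Type*} [LieRing g] [LieAlgebra ℂ g]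
  {ι : Type*} [Fintype ι] [DecidableEq ι]
  {W : Type*} [AddCommGroup W] [Module ℂ W]
  {B : LinearMap.BilinForm ℂ g} {h : ℂ} {v w : Module.Basis ι ℂ g}
  {J : ℤ → g →ₗ[ℂ] Module.End ℂ W}

lemma finite_support_smul {κ : Type*} (c : κ → ℂ) {f : κ → W} (hf : f.support.Finite) :
    (fun p => c p • f p).support.Finite :=
  hf.subset (Function.support_smul_subset_right c f)

lemma finite_support_normalTerm (hJ : IsSmoothRep B J) (v w : ι → g) (n : ℤ) (x : W) :
    (fun p => normalTerm J v w n p x).support.Finite := by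
  obtain ⟨N, hN⟩ := hJ.smooth x
  refine finite_support_of_window (a := min 0 (n - N)) (b := max 0 N) (fun p hp => ?_)
    (fun p hp => ?_)
  · have h1 : p < 0 := lt_of_lt_of_le hp (min_le_left _ _)
    have h2 : p < n - N := lt_of_lt_of_le hp (min_le_right _ _)
    simp only [normalTerm, normalOrdered, if_pos h1, LinearMap.sum_apply]
    refine Finset.sum_eq_zero fun i _ => ?_
    rw [Module.End.mul_apply, hN _ (by omega), map_zero]
  · have h1 : ¬ p < 0 := not_lt.mpr (lt_of_le_of_lt (le_max_left _ _) hp).le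
    have h2 : N < p := lt_of_le_of_lt (le_max_right _ _) hp
    simp only [normalTerm, normalOrdered, if_neg h1, LinearMap.sum_apply]
    refine Finset.sum_eq_zero fun i _ => ?_
    rw [Module.End.mul_apply, hN _ (by omega), map_zero]

/-- The Sugawara operators of a smooth representation, without the normalizing factor. -/
def sugawaraSum (hJ : IsSmoothRep B J) (v w : ι → g) (n : ℤ) : Module.End ℂ W :=
  locSum (normalTerm J v w n) (finite_support_normalTerm hJ v w n)

lemma hasFinSum_sugawaraSum (hJ : IsSmoothRep B J) (v w : ι → g) (n : ℤ) (x : W) :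
    HasFinSum (fun p => normalTerm J v w n p x) (sugawaraSum hJ v w n x) :=
  hasFinSum_locSum _ x

lemma normalTerm_bracket (hJ : IsSmoothRep B J) (hC : IsCasimirPair B h v w) (n p : ℤ)
    (X : Module.End ℂ W) : normalTerm J v w n p * X - X * normalTerm J v w n p =
      casimirTerm J v w p (n - p) * X - X * casimirTerm J v w p (n - p) := by
  rw [normalTerm_eq hJ hC, sub_mul, mul_sub, smul_mul_assoc, mul_smul_comm, mul_one, one_mul]
  abel

/-- The two families of central terms contribute `-n` each. The bracket terms telescope from `0` on
the left to `2h a_{m+n}` on the right, contributing `-2hn`. Together this is `-2(1 + h) n`, whence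
the shift of the level by `h`. -/
lemma sugawaraSum_bracket (hJ : IsSmoothRep B J) (hC : IsCasimirPair B h v w) (a : g) (m n : ℤ) :
    sugawaraSum hJ v w m * J n a - J n a * sugawaraSum hJ v w m =
      (-(2 * (1 + h) * n) : ℂ) • J (m + n) a := by
  ext x
  refine (hasFinSum_bracket (hasFinSum_sugawaraSum hJ v w m) (J n a) x).unique ?_
  obtain ⟨N, hN⟩ := hJ.smooth x
  have hL : ∀ p q : ℤ, N ≤ q → casimirLie J v w a p q x = 0 := fun p q hq => by
    rw [casimirLie, LinearMap.sum_apply]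
    exact Finset.sum_eq_zero fun i _ => by rw [Module.End.mul_apply, hN q hq, map_zero]
  have s1 : HasFinSum (fun p : ℤ => ((if m - p + n = 0 then ((m - p : ℤ) : ℂ) else 0) • J p a) x)
      ((-(n : ℂ)) • J (m + n) a x) := by
    refine (hasFinSum_single (m + n) fun p hp => ?_).congr (fun _ => rfl) ?_
    · rw [if_neg (by omega), zero_smul, LinearMap.zero_apply]
    · rw [if_pos (by omega), LinearMap.smul_apply]
      congr 1
      push_cast
      ring
  have s2 : HasFinSum (fun p : ℤ => ((if p + n = 0 then (p : ℂ) else 0) • J (m - p) a) x)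
      ((-(n : ℂ)) • J (m + n) a x) := by
    refine (hasFinSum_single (-n) fun p hp => ?_).congr (fun _ => rfl) ?_
    · rw [if_neg (by omega), zero_smul, LinearMap.zero_apply]
    · rw [if_pos (by omega), LinearMap.smul_apply, sub_neg_eq_add]
      push_cast
      rfl
  have s3 := hasFinSum_telescope (f := fun p => casimirLie J v w a p (m + n - p) x)
    (a := m + n - N) (b := N) (c := (2 * h) • J (m + n) a x) (fun p hp => hL _ _ (by omega))
    (fun p hp => by
      rw [casimirLie_add_swap hJ hC, LinearMap.sub_apply, hL _ _ hp.le, sub_zero, add_sub_cancel,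
        LinearMap.smul_apply]) n
  refine ((s1.add s2).add s3).congr (fun p => ?_) ?_
  · rw [normalTerm_bracket hJ hC, casimirTerm_bracket hJ hC, LinearMap.add_apply,
      LinearMap.add_apply, LinearMap.sub_apply]
    congr 3
    · rw [show m - p + n = m + n - p by ring]
    · rw [show m - p = m + n - (p + n) by ring]
  · rw [LinearMap.smul_apply, ← Int.cast_smul_eq_zsmul ℂ]
    module

/-- The Sugawara operators of a smooth representation of level one. -/
def sugawaraOp (hJ : IsSmoothRep B J) (h : ℂ) (v w : ι → g) (n : ℤ) : Module.End ℂ W :=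
  (2 * (1 + h))⁻¹ • sugawaraSum hJ v w n

lemma sugawaraOp_bracket (hJ : IsSmoothRep B J) (hC : IsCasimirPair B h v w) (h1 : 1 + h ≠ 0)
    (a : g) (m n : ℤ) : sugawaraOp hJ h v w m * J n a =
      J n a * sugawaraOp hJ h v w m + (-n : ℂ) • J (m + n) a := by
  rw [← sub_eq_iff_eq_add', sugawaraOp, smul_mul_assoc, mul_smul_comm, ← smul_sub,
    sugawaraSum_bracket hJ hC, smul_smul]
  congr 1
  field_simp

lemma sugawaraOp_casimirTerm (hJ : IsSmoothRep B J) (hC : IsCasimirPair B h v w) (h1 : 1 + h ≠ 0)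
    (m p q : ℤ) : sugawaraOp hJ h v w m * casimirTerm J v w p q -
      casimirTerm J v w p q * sugawaraOp hJ h v w m =
      (-p : ℂ) • casimirTerm J v w (p + m) q + (-q : ℂ) • casimirTerm J v w p (q + m) := by
  simp only [casimirTerm]
  rw [Finset.mul_sum, Finset.sum_mul, ← Finset.sum_sub_distrib, Finset.smul_sum, Finset.smul_sum,
    ← Finset.sum_add_distrib]
  refine Finset.sum_congr rfl fun i _ => ?_
  rw [← mul_assoc, sugawaraOp_bracket hJ hC h1, add_mul, mul_assoc, sugawaraOp_bracket hJ hC h1,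
    mul_add, mul_smul_comm, smul_mul_assoc, add_comm m p, add_comm m q, mul_assoc]
  abel

lemma hasFinSum_central (m : ℤ) : HasFinSum (fun p : ℤ => (p : ℂ) * (p + m) *
    ((if 0 ≤ p then 1 else 0) - (if 0 ≤ p + m then 1 else 0))) (((m : ℂ) ^ 3 - m) / 6) := by
  -- A discrete antiderivative of `p (p + m)`, normalised by `G 0 = 0`.
  let G : ℤ → ℂ := fun p => ((p : ℂ) - 1) * p * (2 * p - 1) / 6 + m * p * (p - 1) / 2
  have hG : ∀ p, G (p + 1) = G p + p * (p + m) := fun p => by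
    simp only [G]
    push_cast
    ring
  have hG0 : G 0 = 0 := by simp [G]
  -- Each cut-off multiplies an antiderivative that vanishes at its wall, `p = 0` or `p = -m`, so
  -- shifting `p` by one creates no boundary term. The limit on the right is `G (-m) = (m³ - m) /
  -- 6`.
  have key := (hasFinSum_telescope (f := fun p : ℤ =>
    (if 0 ≤ p then G p else 0) - (if 0 ≤ p + m then G p - G (-m) else 0)) (a := min 0 (-m))
    (b := max 0 (-m)) (c := G (-m)) (fun p hp => ?_) (fun p hp => ?_) 1).neg
  · refine key.congr (fun p => ?_) ?_
    · simp only [hG]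
      have c1 : 0 ≤ p + 1 ↔ 0 ≤ p ∨ p = -1 := by omega
      have c2 : 0 ≤ p + 1 + m ↔ 0 ≤ p + m ∨ p = -m - 1 := by omega
      have e1 : (if 0 ≤ p + 1 then G p + p * (p + m) else 0) =
          (if 0 ≤ p then G p + p * (p + m) else 0) := by
        by_cases hp : p = -1
        · have := hG p
          rw [hp, neg_add_cancel, hG0] at this
          subst hp
          rw [← this]
          simp
        · simp only [c1, hp, or_false]
      have e2 : (if 0 ≤ p + 1 + m then G p + p * (p + m) - G (-m) else 0) =
          (if 0 ≤ p + m then G p + p * (p + m) - G (-m) else 0) := by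
        by_cases hp : p = -m - 1
        · have := hG p
          rw [hp, sub_add_cancel] at this
          subst hp
          rw [← this]
          simp
        · simp only [c2, hp, or_false]
      rw [e1, e2]
      split_ifs <;> ring
    · simp only [G, one_smul, neg_neg]
      push_cast
      ring
  · have h1 : p < 0 := lt_of_lt_of_le hp (min_le_left _ _)
    have h2 : p < -m := lt_of_lt_of_le hp (min_le_right _ _)
    rw [if_neg (by omega), if_neg (by omega), sub_zero]
  · have h1 : 0 < p := lt_of_le_of_lt (le_max_left _ _) hp
    have h2 : -m < p := lt_of_le_of_lt (le_max_right _ _) hp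
    rw [if_pos (by omega), if_pos (by omega), sub_sub_cancel]

/-- Commuting `L_m` with the unordered terms of `L_n` gives two sums; shifting one of them by `m`
produces `m - n` times the sum for `m + n`. The shift moves the normal ordering wall, and the
mismatch is the central sum. -/
lemma sugawaraOp_sugawaraSum (hJ : IsSmoothRep B J) (hC : IsCasimirPair B h v w) (h1 : 1 + h ≠ 0)
    (m n : ℤ) : sugawaraOp hJ h v w m * sugawaraSum hJ v w n -
      sugawaraSum hJ v w n * sugawaraOp hJ h v w m = ((m - n : ℂ)) • sugawaraSum hJ v w (m + n) +
      (if m + n = 0 then (Fintype.card ι : ℂ) * (((m : ℂ) ^ 3 - m) / 6) else 0) • 1 := by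
  ext x
  have hb := (hasFinSum_bracket (hasFinSum_sugawaraSum hJ v w n) (sugawaraOp hJ h v w m) x).neg
  rw [← LinearMap.neg_apply, neg_sub] at hb
  refine hb.unique ?_
  have hfin := finite_support_normalTerm hJ v w (m + n) x
  have s1 := hasFinSum_finsum (finite_support_smul (fun p : ℤ => (-(p - m) : ℂ)) hfin)
  have s2 := hasFinSum_finsum (finite_support_smul (fun p : ℤ => (-(n - p) : ℂ)) hfin)
  have s12 := (s1.add s2).unique <| ((hasFinSum_sugawaraSum hJ v w (m + n) x).map
    (DistribSMul.toAddMonoidHom W (m - n : ℂ))).congr (y' := (m - n : ℂ) •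
      sugawaraSum hJ v w (m + n) x) (fun p => by
      simp only [DistribSMul.toAddMonoidHom_apply]
      module) rfl
  have s3 : HasFinSum (fun p : ℤ => (if m + n = 0 then (Fintype.card ι : ℂ) * ((p : ℂ) * (p + m) *
      ((if 0 ≤ p then 1 else 0) - (if 0 ≤ p + m then 1 else 0))) else 0) • x)
      ((if m + n = 0 then (Fintype.card ι : ℂ) * (((m : ℂ) ^ 3 - m) / 6) else 0) • x) := by
    split_ifs
    · exact (hasFinSum_central m).map ((AddMonoidHom.flip (smulAddHom ℂ W) x).comp
        (AddMonoidHom.mulLeft (Fintype.card ι : ℂ)))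
    · simpa using hasFinSum_zero (κ := ℤ) (W := W)
  refine (((s1.comp_add m).add s2).add s3).congr (fun p => ?_) ?_
  · rw [← LinearMap.neg_apply, neg_sub]
    have e := normalTerm_bracket hJ hC n p (sugawaraOp hJ h v w m)
    rw [← neg_inj, neg_sub, neg_sub, sugawaraOp_casimirTerm hJ hC h1] at e
    have e1 : casimirTerm J v w (p + m) (n - p) = normalTerm J v w (m + n) (p + m) +
        (if m + n = 0 then (if 0 ≤ p + m then ((p + m : ℤ) : ℂ) * Fintype.card ι else 0)
          else 0) • 1 := by
      rw [normalTerm_eq hJ hC, sub_add_cancel, show m + n - (p + m) = n - p by ring]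
    have e2 : casimirTerm J v w p (n - p + m) = normalTerm J v w (m + n) p +
        (if m + n = 0 then (if 0 ≤ p then (p : ℂ) * Fintype.card ι else 0) else 0) • 1 := by
      rw [normalTerm_eq hJ hC, sub_add_cancel, show m + n - p = n - p + m by ring]
    rw [e, e1, e2]
    simp only [LinearMap.add_apply, LinearMap.smul_apply, Module.End.one_apply]
    by_cases hmn : m + n = 0
    · have hn : (n : ℂ) = -m := by
        rw [show n = -m by omega]
        push_cast
        rfl
      simp only [if_pos hmn]
      push_cast
      rw [hn]
      split_ifs <;> module
    · simp only [if_neg hmn]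
      push_cast
      module
  · rw [s12]
    rfl

lemma sugawaraOp_virasoro (hJ : IsSmoothRep B J) (hC : IsCasimirPair B h v w) (h1 : 1 + h ≠ 0)
    (m n : ℤ) : sugawaraOp hJ h v w m * sugawaraOp hJ h v w n -
      sugawaraOp hJ h v w n * sugawaraOp hJ h v w m = ((m - n : ℂ)) • sugawaraOp hJ h v w (m + n) +
      (if m + n = 0 then (Fintype.card ι : ℂ) / (1 + h) / 12 * ((m : ℂ) ^ 3 - m) else 0) • 1 := by
  have e := congrArg (fun X => (2 * (1 + h))⁻¹ • X) (sugawaraOp_sugawaraSum hJ hC h1 m n)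
  simp only [smul_sub, smul_add] at e
  rw [← mul_smul_comm, ← smul_mul_assoc] at e
  refine e.trans ?_
  rw [smul_comm, smul_smul (2 * (1 + h))⁻¹ (ite _ _ _)]
  congr 2
  split_ifs
  · field_simp
    ring
  · rw [mul_zero]

end Virasoro

/-! ### Deformation of the Sugawara operators by a connection. -/

section Deformation

variable {g : Type*} [LieRing g] [LieAlgebra ℂ g]
  {ι : Type*} [Fintype ι] [DecidableEq ι]
  {W : Type*} [AddCommGroup W] [Module ℂ W]
  {B : LinearMap.BilinForm ℂ g} {h : ℂ} {v w : Module.Basis ι ℂ g}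
  {J : ℤ → g →ₗ[ℂ] Module.End ℂ W}

lemma finite_support_connection (hJ : IsSmoothRep B J) (A : Connection g) (n : ℤ) (x : W) :
    (fun r => J (n - r) (A.1 r) x).support.Finite := by
  obtain ⟨N, hN⟩ := hJ.smooth x
  obtain ⟨N', hN'⟩ := A.2
  refine finite_support_of_window (a := n - N) (b := N') (fun r hr => hN _ (by omega) _)
    (fun r hr => ?_)
  rw [hN' r hr.le, map_zero, LinearMap.zero_apply]

/-- The operator `∑ r, (A_r)_(n - r)` of a connection `d + A`. -/
def connOp (hJ : IsSmoothRep B J) (A : Connection g) (n : ℤ) : Module.End ℂ W :=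
  locSum (fun r => J (n - r) (A.1 r)) (finite_support_connection hJ A n)

lemma hasFinSum_connOp (hJ : IsSmoothRep B J) (A : Connection g) (n : ℤ) (x : W) :
    HasFinSum (fun r => J (n - r) (A.1 r) x) (connOp hJ A n x) :=
  hasFinSum_locSum _ x

lemma finite_support_pairing (B : LinearMap.BilinForm ℂ g) (A : Connection g) (n : ℤ) :
    (fun r => B (A.1 r) (A.1 (n - r))).support.Finite := by
  obtain ⟨N, hN⟩ := A.2
  refine finite_support_of_window (a := n - N) (b := N) (fun r hr => ?_) (fun r hr => ?_)
  · rw [hN (n - r) (by omega), map_zero]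
  · rw [hN r hr.le, map_zero, LinearMap.zero_apply]

lemma sugawaraOp_connOp (hJ : IsSmoothRep B J) (hC : IsCasimirPair B h v w) (h1 : 1 + h ≠ 0)
    (A : Connection g) (m n : ℤ) :
    (sugawaraOp hJ h v w m * connOp hJ A n - connOp hJ A n * sugawaraOp hJ h v w m) -
      (sugawaraOp hJ h v w n * connOp hJ A m - connOp hJ A m * sugawaraOp hJ h v w n) =
      (m - n : ℂ) • connOp hJ A (m + n) := by
  ext x
  have b1 := (hasFinSum_bracket (hasFinSum_connOp hJ A n) (sugawaraOp hJ h v w m) x).neg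
  have b2 := (hasFinSum_bracket (hasFinSum_connOp hJ A m) (sugawaraOp hJ h v w n) x).neg
  rw [← LinearMap.neg_apply, neg_sub] at b1 b2
  rw [LinearMap.sub_apply]
  refine (b1.sub b2).unique ?_
  refine ((hasFinSum_connOp hJ A (m + n) x).map
    (DistribSMul.toAddMonoidHom W (m - n : ℂ))).congr (fun r => ?_) rfl
  rw [sugawaraOp_bracket hJ hC h1, sugawaraOp_bracket hJ hC h1, sub_add_cancel_left,
    sub_add_cancel_left, show m + (n - r) = m + n - r by ring,
    show n + (m - r) = m + n - r by ring]
  simp only [LinearMap.neg_apply, LinearMap.smul_apply, DistribSMul.toAddMonoidHom_apply]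
  push_cast
  module

/-- Average over the reflection `r ↦ m + n - r`: by symmetry of the form only the coefficient
changes, and its mean is `(m - n) / 2`. -/
lemma hasFinSum_pairing (hs : ∀ x y, B x y = B y x) (A : Connection g) (m n : ℤ) :
    HasFinSum (fun r => ((m - r : ℤ) : ℂ) * B (A.1 r) (A.1 (m + n - r)))
      ((m - n : ℂ) / 2 * ∑ᶠ r, B (A.1 r) (A.1 (m + n - r))) := by
  have hfin := finite_support_pairing B A (m + n)
  have s1 := hasFinSum_finsum (finite_support_smul (fun r : ℤ => ((m - r : ℤ) : ℂ)) hfin)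
  have s2 := (s1.add (s1.comp_equiv (Equiv.subLeft (m + n)))).unique <|
    ((hasFinSum_finsum hfin).map (AddMonoidHom.mulLeft (m - n : ℂ))).congr
      (y' := (m - n : ℂ) * ∑ᶠ r, B (A.1 r) (A.1 (m + n - r))) (fun r => by
        simp only [Equiv.subLeft_apply, sub_sub_cancel, smul_eq_mul, AddMonoidHom.coe_mulLeft,
          hs (A.1 (m + n - r)) (A.1 r)]
        push_cast
        ring) rfl
  refine s1.congr (fun r => rfl) ?_
  rw [div_mul_eq_mul_div, ← s2]
  ring

lemma connOp_bracket (hJ : IsSmoothRep B J) (hs : ∀ x y, B x y = B y x) (A : Connection g)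
    (m n : ℤ) : connOp hJ A m * connOp hJ A n - connOp hJ A n * connOp hJ A m =
      ((m - n : ℂ) / 2 * ∑ᶠ r, B (A.1 r) (A.1 (m + n - r))) • 1 := by
  ext x
  have hb := hasFinSum_bracket_prod (hasFinSum_connOp hJ A m) (hasFinSum_connOp hJ A n) x
  have hd := (((hasFinSum_pairing hs A m n).graph (m + n)).map
    (AddMonoidHom.flip (smulAddHom ℂ W) x)).congr (y' := (((m - n : ℂ) / 2 *
      ∑ᶠ r, B (A.1 r) (A.1 (m + n - r))) • (1 : Module.End ℂ W)) x) (fun _ => rfl) rfl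
  rw [← sub_eq_zero]
  -- The central terms lie on the antidiagonal and are removed by `hd`; what remains is `[A_r, A_s]`
  -- in degree `m + n - r - s`, antisymmetric in `r` and `s`.
  refine (hb.sub hd).eq_zero_of_antisymm (fun r s => ?_)
  have e : ∀ m n r s : ℤ, J (m - r) (A.1 r) * J (n - s) (A.1 s) -
      J (n - s) (A.1 s) * J (m - r) (A.1 r) = J (m + n - r - s) ⁅A.1 r, A.1 s⁆ +
        (if r + s = m + n then ((m - r : ℤ) : ℂ) * B (A.1 r) (A.1 (m + n - r)) else 0) • 1 := by
    intro m n r s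
    rw [hJ.comm, add_assoc, add_sub_cancel_left, show m - r + (n - s) = m + n - r - s by ring]
    congr 2
    by_cases hrs : r + s = m + n
    · rw [if_pos (by omega), if_pos hrs, show m + n - r = s by omega]
    · rw [if_neg (by omega), if_neg hrs]
  simp only [e, LinearMap.add_apply, LinearMap.smul_apply, Module.End.one_apply,
    AddMonoidHom.flip_apply, smulAddHom_apply, add_sub_cancel_right]
  rw [← lie_skew, map_neg, LinearMap.neg_apply, sub_right_comm]

/-- The Sugawara operators deformed by a connection. -/
def deformedOp (hJ : IsSmoothRep B J) (h : ℂ) (v w : ι → g) (A : Connection g) (n : ℤ) :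
    Module.End ℂ W :=
  sugawaraOp hJ h v w n - connOp hJ A n + (1 / 2 * ∑ᶠ r, B (A.1 r) (A.1 (n - r))) • 1

/-- Scalars drop out of the commutator. The quadratic term needed on the right comes instead from
the commutator of the linear terms, which explains its coefficient `1/2`, and the central charge is
unchanged. -/
theorem deformedOp_virasoro (hJ : IsSmoothRep B J) (hC : IsCasimirPair B h v w) (h1 : 1 + h ≠ 0)
    (A : Connection g) (m n : ℤ) : deformedOp hJ h v w A m * deformedOp hJ h v w A n -
      deformedOp hJ h v w A n * deformedOp hJ h v w A m =
      (m - n : ℂ) • deformedOp hJ h v w A (m + n) +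
      (if m + n = 0 then (Fintype.card ι : ℂ) / (1 + h) / 12 * ((m : ℂ) ^ 3 - m) else 0) • 1 := by
  have key : ∀ (x y x' y' : Module.End ℂ W) (s t : ℂ), (x - y + s • 1) * (x' - y' + t • 1) -
      (x' - y' + t • 1) * (x - y + s • 1) = (x * x' - x' * x) -
        ((x * y' - y' * x) - (x' * y - y * x')) + (y * y' - y' * y) := by
    intro x y x' y' s t
    simp only [add_mul, mul_add, sub_mul, mul_sub, smul_mul_assoc, mul_smul_comm, mul_one, one_mul]
    module
  rw [deformedOp, deformedOp, key, sugawaraOp_virasoro hJ hC h1, sugawaraOp_connOp hJ hC h1,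
    connOp_bracket hJ hC.symm, deformedOp]
  module

end Deformation

/-! ### From operators back to modules of level one. -/

section LevelOneModules

variable {g : Type*} [LieRing g] [LieAlgebra ℂ g]
  {ι : Type*} [Fintype ι] [DecidableEq ι]
  {B : LinearMap.BilinForm ℂ g} {h : ℂ} {v w : Module.Basis ι ℂ g}
  {W : Type*} [AddCommGroup W] [Module (LevelOne B) W]

theorem isVirasoroAction_deformedL (hC : IsCasimirPair B h v w) (h1 : 1 + h ≠ 0)
    (A : Connection g) (hW : IsSmooth ℂ B (fun _ : Unit => (1 : ℂ)) W) :
    IsVirasoroAction (LevelOne B) (deformedL (W := W) B h v w A)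
      ((Fintype.card ι : ℂ) / (1 + h)) := by
  -- The module comes only with an action of the level one algebra; the complex structure is the one
  -- through its scalars.
  let _ : Module ℂ W := Module.compHom W (algebraMap ℂ (LevelOne B))
  have hsm : ∀ (c : ℂ) (x : W), algebraMap ℂ (LevelOne B) c • x = c • x := fun _ _ => rfl
  have : IsScalarTower ℂ (LevelOne B) W := IsScalarTower.of_algebraMap_smul hsm
  have : SMulCommClass (LevelOne B) ℂ W := IsScalarTower.to_smulCommClass'
  let J : ℤ → g →ₗ[ℂ] Module.End ℂ W := fun n =>
    (Algebra.lsmul ℂ ℂ W : LevelOne B →ₐ[ℂ] Module.End ℂ W).toLinearMap ∘ₗ modeOneLin B n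
  have hJa : ∀ n a x, J n a x = modeOne B a n • x := fun _ _ _ => rfl
  have hJ : IsSmoothRep B J := by
    refine ⟨fun a b m n => ?_, fun x => ?_⟩
    · have e := congrArg (Algebra.lsmul ℂ ℂ W : LevelOne B →ₐ[ℂ] Module.End ℂ W)
        (mode_mul ℂ B (fun _ : Unit => (1 : ℂ)) () a b m n)
      rw [map_add, map_add, map_mul, map_mul, AlgHom.commutes, Algebra.algebraMap_eq_smul_one,
        mul_one] at e
      exact e
    · obtain ⟨N, hN⟩ := hW x
      exact ⟨N, fun n hn a => hN n hn () a⟩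
  have hD : ∀ n x, deformedL B h v w A n x = deformedOp hJ h v w A n x := by
    intro n x
    rw [deformedL, deformedOp, LinearMap.add_apply, LinearMap.sub_apply, sugawara, sugawaraOp]
    have e1 : ∑ᶠ m : ℤ, ∑ i, normalOrdered (modeOne B) (v i) (w i) m (n - m) • x =
        sugawaraSum hJ v w n x := by
      rw [← (hasFinSum_sugawaraSum hJ v w n x).2]
      refine finsum_congr fun m => ?_
      change _ = (∑ i, normalOrdered (fun a k => J k a) (v i) (w i) m (n - m)) x
      rw [LinearMap.sum_apply]
      refine Finset.sum_congr rfl fun i _ => ?_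
      simp only [normalOrdered]
      split_ifs
      · rw [mul_smul]
        rfl
      · rw [mul_smul]
        rfl
    have e2 : ∑ᶠ m : ℤ, modeOne B (A.1 (n - m)) m • x = connOp hJ A n x := by
      rw [← ((hasFinSum_connOp hJ A n x).comp_equiv (Equiv.subLeft n)).2]
      refine finsum_congr fun m => ?_
      change _ = J (n - (n - m)) (A.1 (n - m)) x
      rw [hJa, sub_sub_cancel]
    rw [e1, e2, hsm, hsm]
    rfl
  refine ⟨fun n x y => ?_, fun n t x => ?_, fun m n x => ?_⟩
  · rw [hD, hD, hD, map_add]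
  · rw [hD, hD, hsm, hsm, map_smul]
  · have e := LinearMap.congr_fun (deformedOp_virasoro hJ hC h1 A m n) x
    simp only [hD, hsm]
    exact e

end LevelOneModules

/-! ### The Casimir eigenvalue and positivity of `h`. -/

section SimpleLieAlgebra

variable {g : Type*} [LieRing g] [LieAlgebra ℂ g] [FiniteDimensional ℂ g]

/-- Pairing the Casimir element applied to `a` with `b` gives, by invariance, the trace of `ad a ad
b` computed in dual bases. That is the Killing form, `2h` times the given form. -/
lemma isCasimirPair_of_smul_killingForm {B : LinearMap.BilinForm ℂ g} {h : ℂ} (h0 : h ≠ 0)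
    (hB : B = (2 * h)⁻¹ • killingForm ℂ g) {ι : Type*} [Fintype ι] [DecidableEq ι]
    {v w : Module.Basis ι ℂ g} (hvw : ∀ i j, B (v i) (w j) = if i = j then 1 else 0) :
    IsCasimirPair B h v w := by
  have hs : ∀ x y, B x y = B y x := fun x y => by
    rw [hB, LinearMap.smul_apply, LinearMap.smul_apply, LinearMap.smul_apply,
      LinearMap.smul_apply, killingForm, LieModule.traceForm_comm]
  have hi : ∀ x a y : g, B ⁅x, a⁆ y = B x ⁅a, y⁆ := fun x a y => by
    rw [hB, LinearMap.smul_apply, LinearMap.smul_apply, LinearMap.smul_apply,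
      LinearMap.smul_apply, killingForm, LieModule.traceForm_apply_lie_apply]
  have hwv : ∀ i j, B (w i) (v j) = if i = j then 1 else 0 := fun i j => by
    rw [hs, hvw]
    simp only [eq_comm]
  refine ⟨hs, hi, hvw, fun a => ?_⟩
  have htr : ∀ T : g →ₗ[ℂ] g, LinearMap.trace ℂ g T = ∑ i, B (v i) (T (w i)) := fun T => by
    rw [LinearMap.trace_eq_matrix_trace ℂ w, Matrix.trace]
    refine Finset.sum_congr rfl fun i _ => ?_
    rw [Matrix.diag_apply, LinearMap.toMatrix_apply]
    have := congrArg (B (v i)) (w.sum_repr (T (w i)))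
    rw [← this]
    simp only [map_sum, map_smul, hvw, smul_eq_mul, mul_ite, mul_one, mul_zero,
      Finset.sum_ite_eq, Finset.mem_univ, if_true]
  have hK : ∀ x y, killingForm ℂ g x y = 2 * h * B x y := fun x y => by
    rw [hB, LinearMap.smul_apply, LinearMap.smul_apply, smul_eq_mul, mul_inv_cancel_left₀
      (mul_ne_zero two_ne_zero h0)]
  have key : ∀ b, B (∑ i, ⁅v i, ⁅w i, a⁆⁆) b = B ((2 * h) • a) b := fun b => by
    rw [map_smul, LinearMap.smul_apply, smul_eq_mul, ← hK, hs, ← LieModule.traceForm_comm,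
      ← killingForm, killingForm_apply_apply, htr, map_sum]
    refine Finset.sum_congr rfl fun i _ => ?_
    rw [hs, hi, LinearMap.comp_apply, LieAlgebra.ad_apply, LieAlgebra.ad_apply, ← lie_skew,
      ← lie_skew a, lie_neg]
  rw [← sum_dual_smul hwv (∑ i, ⁅v i, ⁅w i, a⁆⁆)]
  conv_rhs => rw [← sum_dual_smul hwv ((2 * h) • a)]
  simp only [key]

/-- The Killing norm of a coroot is the sum over the roots of the squares of integers, and `θ`
itself contributes a positive term. It is used only to see that `h` and `1 + h` are nonzero. -/
lemma exists_dualCoxeter_eq [LieAlgebra.IsKilling ℂ g] (H : LieSubalgebra ℂ g)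
    [H.IsCartanSubalgebra] (θ : LieModule.Weight ℂ H g) (hθ : θ.IsNonZero) :
    ∃ n : ℤ, 0 < n ∧ dualCoxeter H θ = n / 4 := by
  let z : LieModule.Weight ℂ H g → ℤ := fun α => LieModule.chainBotCoeff θ α -
    LieModule.chainTopCoeff θ α
  have hz : ∀ α : LieModule.Weight ℂ H g, α (LieAlgebra.IsKilling.coroot θ) = z α := fun α =>
    LieAlgebra.IsKilling.apply_coroot_eq_cast θ α
  refine ⟨∑ α ∈ H.root, z α * z α, ?_, ?_⟩
  · have hθ' : z θ ≠ 0 := by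
      intro h0
      have := LieAlgebra.IsKilling.root_apply_coroot hθ
      rw [hz, h0] at this
      norm_num at this
    refine Finset.sum_pos' (fun α _ => mul_self_nonneg _) ⟨θ, ?_, ?_⟩
    · simpa [LieSubalgebra.root] using hθ
    · exact mul_self_pos.mpr hθ'
  · have e := LinearMap.congr_fun₂ (LieAlgebra.IsKilling.restrict_killingForm_eq_sum (K := ℂ)
      (L := g) (H := H)) (LieAlgebra.IsKilling.coroot θ) (LieAlgebra.IsKilling.coroot θ)
    rw [dualCoxeter]
    congr 1
    refine Eq.trans e ?_
    rw [LinearMap.sum_apply, LinearMap.sum_apply, Int.cast_sum]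
    refine Finset.sum_congr rfl fun α _ => ?_
    rw [LinearMap.smulRight_apply, LinearMap.smul_apply, smul_eq_mul]
    change α _ * α _ = _
    rw [hz, Int.cast_mul]

end SimpleLieAlgebra

end AffineCoset

end

theorem mainTheorem1 {g : Type*} [LieRing g] [LieAlgebra ℂ g]
    [FiniteDimensional ℂ g] [LieAlgebra.IsSimple ℂ g]
    (H : LieSubalgebra ℂ g) [H.IsCartanSubalgebra] (hsl : IsSimplyLaced H)
    (θ : LieModule.Weight ℂ H g) (hθ : θ.IsNonZero)
    (h : ℂ) (hh : h = dualCoxeter H θ)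
    (B : LinearMap.BilinForm ℂ g) (hB : B = normalizedForm H θ)
    {ι : Type*} [Fintype ι] [DecidableEq ι] (v w : Module.Basis ι ℂ g)
    (hvw : ∀ i j, B (v i) (w j) = if i = j then 1 else 0) :
    -- the limit is a (trivial) bundle over the space of connections, with fibre the level one
    -- algebra, the function `⟨A_n, a⟩` being `a_n^{(κ)} / κ`
    (∃ e : functionRing B ⊗[ℂ] LevelOne B ≃ₐ[ℂ] Limit B,
      (∀ a n, e (coord B a n ⊗ₜ 1) = toLimit B (scaledDiag B a n)) ∧
      ∀ u, e (1 ⊗ₜ u) = toLimit B (inclOne B u)) ∧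
    ∀ A : Connection g,
      -- the fibre of the algebra at `d + A` is the level one algebra
      (∃ e : LevelOne B ≃ₗ[LevelOne B] Coinv B A (intForm B), e 1 = Coinv.mk B A 1) ∧
      -- likewise for the universal smooth modules
      (∀ N : ℕ, IsSmooth (RatFunc ℂ) B ![kap - 1, 1] (UnivSmooth B N)) ∧
      (∀ N : ℕ, (∀ n : ℤ, N ≤ n → A.1 n = 0) →
        ∃ e : (LevelOne B ⧸ highModes ℂ B (fun _ : Unit => (1 : ℂ)) N) ≃ₗ[LevelOne B]
            Coinv B A (univLattice B N),
          e (Submodule.Quotient.mk 1) = Coinv.mk B A (univLatticeVec B N)) ∧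
      -- the coset Virasoro operators preserve integral forms and descend to the fibre
      (∀ (V : Type*) [AddCommGroup V] [Module (Generic B) V],
        IsSmooth (RatFunc ℂ) B ![kap - 1, 1] V →
        ∀ M : Submodule (intForm B) V,
          IsSmooth ℂ B (fun _ : Unit => (1 : ℂ)) (Coinv B A M) ∧
          ∀ (n : ℤ) (z : M), ∃ hz : cosetL B h v w n (z : V) ∈ M,
            Coinv.mk B A (⟨cosetL B h v w n (z : V), hz⟩ : M) =
              deformedL B h v w A n (Coinv.mk B A z)) ∧
      -- the deformed operators are a Virasoro action on smooth modules of level one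
      ∀ (W : Type*) [AddCommGroup W] [Module (LevelOne B) W],
        IsSmooth ℂ B (fun _ : Unit => (1 : ℂ)) W →
        IsVirasoroAction (LevelOne B) (deformedL (W := W) B h v w A)
          (Module.finrank ℂ g / (1 + h)) := by
  -- Positivity excludes both the degenerate form `h = 0` and the critical case `1 + h = 0`.
  obtain ⟨n, hn, hn'⟩ := exists_dualCoxeter_eq H θ hθ
  rw [← hh] at hn'
  have h0 : h ≠ 0 := by
    rw [hn']
    exact div_ne_zero (Int.cast_ne_zero.mpr hn.ne') (by norm_num)
  have h1 : 1 + h ≠ 0 := by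
    rw [hn', show (1 : ℂ) + n / 4 = ((4 + n : ℤ) : ℂ) / 4 by push_cast; ring]
    exact div_ne_zero (Int.cast_ne_zero.mpr (by omega)) (by norm_num)
  have hB' : B = (2 * h)⁻¹ • killingForm ℂ g := by rw [hB, normalizedForm, hh]
  have hC : IsCasimirPair B h v w := isCasimirPair_of_smul_killingForm h0 hB' hvw
  have hs : B.IsSymm := ⟨fun x y => hC.symm x y⟩
  have hi : B.lieInvariant g := fun x y z => by
    rw [← lie_skew, map_neg, LinearMap.neg_apply, hC.invariant]
  refine ⟨exists_bundle_equiv B v w hs hi hC.dual' (Module.finBasis ℂ g), fun A =>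
    ⟨exists_fibre_equiv B A hs hi (Module.finBasis ℂ g), isSmooth_univSmooth B,
      exists_univ_fibre_equiv B A hs hi (Module.finBasis ℂ g), fun V _ _ hV M =>
      ⟨isSmooth_coinv B A hV M, cosetL_descends B v w h hC.dual' hvw A hV M⟩,
      fun W _ _ hW => ?_⟩⟩
  rw [Module.finrank_eq_card_basis v]
  exact isVirasoroAction_deformedL hC h1 A hW
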